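/- Let $P$ be an oriented smooth $3$-manifold with a conformal structure $[g]$, let $M$ be an oriented smooth surface, and let $\pi\colon P\to M$ be a smooth submersion. Fix any metric $g\in[g]$ and let $T$ be the $g$-unit vector field tangent to the fibers of $\pi$ such that $(T,X,Y)$ is positively oriented whenever $(d\pi X,d\pi Y)$ is. On $P$ consider the CR structure $H=(\ker d\pi)^{\perp}$ with $\mathcal J X=T\times X$. Identify the bundle $SP$ of oriented tangent lines, with projection $p\colon SP\to P$, with the unit sphere bundle of $g$. LeBrun's CR structure on $SP$ has the Levi distribution $H_{v}=\{X\in T_{v}SP\mid dp(X)\perp v\}$. The Levi-Civita connection of $g$ splits $H_v$ into a horizontal and a vertical part, each canonically isomorphic to $v^\perp\subset T_{p(v)}P$, and $\mathcal J$ acts on both parts by $w\mapsto v\times w$. Let $\Psi\colon P\to SP$, $\Psi=[T]$, be the map which sends each point to its oriented fiber direction. $\Psi$ is called CR holomorphic if it is smooth and $d\Psi$ maps $H$ into the Levi distribution of $SP$ and commutes there with the $\mathcal J$'s. The submersion $\pi$ is called conformal for a complex structure on (an open subset of) $M$ if for each point $q$ the map $d_q\pi\colon(\ker d_q\pi)^\perp\to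 T_{\pi(q)}M$ is conformal for the conformal class determined by the complex structure. A complex structure on a surface means a smooth, formally integrable field of endomorphisms $J$ with $J^2=-1$, compatible with the orientation. Then: 1. If the fibers of $\pi$ are connected, there is a complex structure on the surface $\pi(P)$ (which is $M$ if $\pi$ is onto) for which $\pi$ is conformal if and only if $\Psi$ is CR holomorphic. 2. For every submersion $\pi$, with connected fibers or not, $\Psi$ is CR holomorphic if and only if each point of $P$ has an open neighborhood $U$ such that $\pi|_U\colon U\to\pi(U)$ is conformal for a suitable complex structure on $\pi(U)$. In particular, $\Psi$ is CR holomorphic whenever $\pi$ is conformal for some complex structure on $M$. -/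

import Mathlib

open Set Function Bundle
open scoped Manifold ContDiff Topology

noncomputable section

/-- A Riemannian metric of class `C^∞` on a manifold modelled on `ℝⁿ`. -/
abbrev SmoothMetric (n : ℕ) (M : Type*) [TopologicalSpace M]
    [ChartedSpace (EuclideanSpace ℝ (Fin n)) M] [IsManifold (𝓡 n) ∞ M] :=
  ContMDiffRiemannianMetric (𝓡 n) ∞ (EuclideanSpace ℝ (Fin n))
    (fun x : M => TangentSpace (𝓡 n) x)

instance instFiniteDimensionalTangent {n : ℕ} {M : Type*} [TopologicalSpace M]
    [ChartedSpace (EuclideanSpace ℝ (Fin n)) M] (p : M) :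
    FiniteDimensional ℝ (TangentSpace (𝓡 n) p) :=
  inferInstanceAs (FiniteDimensional ℝ (EuclideanSpace ℝ (Fin n)))

/-- A conformal structure `[g]`: an equivalence class of smooth Riemannian metrics, two metrics
being equivalent if they differ by a smooth positive factor. -/
structure ConformalStructure (n : ℕ) (M : Type*) [TopologicalSpace M]
    [ChartedSpace (EuclideanSpace ℝ (Fin n)) M] [IsManifold (𝓡 n) ∞ M] where
  metrics : Set (SmoothMetric n M)
  nonempty : metrics.Nonempty
  mem_iff : ∀ g ∈ metrics, ∀ g' : SmoothMetric n M, g' ∈ metrics ↔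
    ∃ f : M → ℝ, ContMDiff (𝓡 n) 𝓘(ℝ, ℝ) ∞ f ∧ (∀ x, 0 < f x) ∧
      ∀ (x : M) (v w : TangentSpace (𝓡 n) x), g'.inner x v w = f x * g.inner x v w

/-- An orientation of a manifold: an orientation of each tangent space which is locally constant
when read in the local trivialisations of the tangent bundle given by the charts. -/
structure ManifoldOrientation (n : ℕ) (M : Type*) [TopologicalSpace M]
    [ChartedSpace (EuclideanSpace ℝ (Fin n)) M] [IsManifold (𝓡 n) ∞ M] where
  at_point : ∀ x : M, Orientation ℝ (TangentSpace (𝓡 n) x) (Fin n)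
  locallyConstant : ∀ x : M, ∃ s : Orientation ℝ (EuclideanSpace ℝ (Fin n)) (Fin n),
    ∀ᶠ y in 𝓝 x, ∀ hy : y ∈ (trivializationAt (EuclideanSpace ℝ (Fin n))
        (TangentSpace (𝓡 n) : M → Type _) x).baseSet,
      Orientation.map (Fin n) ((trivializationAt (EuclideanSpace ℝ (Fin n))
        (TangentSpace (𝓡 n) : M → Type _) x).continuousLinearEquivAt ℝ y hy).toLinearEquiv
        (at_point y) = s

/-- `v₁, …, vₙ` is a basis of `V` that is positive for the orientation `o`. -/
def IsPositiveBasis {V : Type*} [AddCommGroup V] [Module ℝ V] {n : ℕ}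
    (o : Orientation ℝ V (Fin n)) (v : Fin n → V) : Prop :=
  ∃ b : Module.Basis (Fin n) ℝ V, ⇑b = v ∧ b.orientation = o

section CrossProduct

variable {P : Type*} [TopologicalSpace P] [ChartedSpace (EuclideanSpace ℝ (Fin 3)) P]
  [IsManifold (𝓡 3) ∞ P]

theorem exists_positive_orthonormal_basis (g : SmoothMetric 3 P) (o : ManifoldOrientation 3 P)
    (p : P) : ∃ e : Module.Basis (Fin 3) ℝ (TangentSpace (𝓡 3) p),
      (∀ i j, g.inner p (e i) (e j) = if i = j then 1 else 0) ∧
        e.orientation = o.at_point p := by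
  let c := g.toRiemannianMetric.toCore p
  let _ : NormedAddCommGroup (TangentSpace (𝓡 3) p) := c.toNormedAddCommGroup
  let _ : InnerProductSpace ℝ (TangentSpace (𝓡 3) p) := InnerProductSpace.ofCore c.toCore
  have h : Module.finrank ℝ (TangentSpace (𝓡 3) p) = 3 :=
    (finrank_euclideanSpace_fin : Module.finrank ℝ (EuclideanSpace ℝ (Fin 3)) = 3)
  let e := (o.at_point p).finOrthonormalBasis (by norm_num) h
  refine ⟨e.toBasis, fun i j => ?_, ?_⟩
  · have := orthonormal_iff_ite.1 e.orthonormal i j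
    rw [← this]
    simp only [OrthonormalBasis.coe_toBasis]
    rfl
  · exact (o.at_point p).finOrthonormalBasis_orientation (by norm_num) h

/-- A positively oriented `g`-orthonormal basis of `T_pP`. -/
def positiveFrame (g : SmoothMetric 3 P) (o : ManifoldOrientation 3 P) (p : P) :
    Module.Basis (Fin 3) ℝ (TangentSpace (𝓡 3) p) :=
  (exists_positive_orthonormal_basis g o p).choose

/-- The cross product `v × w` on `T_pP` determined by the metric and the orientation: the usual
one in the coordinates of a positively oriented orthonormal basis. -/
def tangentCross (g : SmoothMetric 3 P) (o : ManifoldOrientation 3 P) (p : P)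
    (v : TangentSpace (𝓡 3) p) : TangentSpace (𝓡 3) p →ₗ[ℝ] TangentSpace (𝓡 3) p :=
  (positiveFrame g o p).equivFun.symm.toLinearMap ∘ₗ
    crossProduct ((positiveFrame g o p).equivFun v) ∘ₗ
      (positiveFrame g o p).equivFun.toLinearMap

end CrossProduct

section LeviCivita

/-- Christoffel symbols of the first kind of the metric `G` on an open subset of `E`:
`Γ(a, b)(c) = ½ (∂ₐ G(b, c) + ∂_b G(a, c) - ∂_c G(a, b))`. -/
def firstChristoffel {E : Type*} [NormedAddCommGroup E] [NormedSpace ℝ E]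
    (G : E → E →L[ℝ] E →L[ℝ] ℝ) (x : E) : E →ₗ[ℝ] E →ₗ[ℝ] Module.Dual ℝ E :=
  LinearMap.mk₂ ℝ
    (fun a b =>
      { toFun := fun c => (1 / 2 : ℝ) *
          (fderiv ℝ G x a b c + fderiv ℝ G x b a c - fderiv ℝ G x c a b)
        map_add' := fun c c' => by
          simp only [ContinuousLinearMap.map_add, add_apply]
          ring
        map_smul' := fun r c => by
          simp only [ContinuousLinearMap.map_smul, smul_apply, smul_eq_mul]
          simp only [RingHom.id_apply]
          ring })
    (fun a a' b => by
      ext c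
      simp only [LinearMap.coe_mk, AddHom.coe_mk, LinearMap.add_apply,
        ContinuousLinearMap.map_add, add_apply]
      ring)
    (fun r a b => by
      ext c
      simp only [LinearMap.coe_mk, AddHom.coe_mk, LinearMap.smul_apply,
        ContinuousLinearMap.map_smul, smul_apply, smul_eq_mul]
      ring)
    (fun a b b' => by
      ext c
      simp only [LinearMap.coe_mk, AddHom.coe_mk, LinearMap.add_apply,
        ContinuousLinearMap.map_add, add_apply]
      ring)
    (fun r a b => by
      ext c
      simp only [LinearMap.coe_mk, AddHom.coe_mk, LinearMap.smul_apply,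
        ContinuousLinearMap.map_smul, smul_apply, smul_eq_mul]
      ring)

set_option synthInstance.maxHeartbeats 400000 in
theorem exists_hasFDerivAt_quadratic {E : Type*} [NormedAddCommGroup E] [NormedSpace ℝ E]
    {G : E → E →L[ℝ] E →L[ℝ] ℝ} {x : E} (hG : DifferentiableAt ℝ G x) (u : E) :
    ∃ f' : E × E →L[ℝ] ℝ, HasFDerivAt (fun z : E × E => G z.1 z.2 z.2) f' (x, u) ∧
      ∀ z, f' z = fderiv ℝ G x z.1 u u + G x z.2 u + G x u z.2 := by
  have h0 : HasFDerivAt (fun z : E × E => z.1) (ContinuousLinearMap.fst ℝ E E) (x, u) :=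
    hasFDerivAt_fst
  have h1 : HasFDerivAt (fun z : E × E => G z.1)
      ((fderiv ℝ G x).comp (ContinuousLinearMap.fst ℝ E E)) (x, u) :=
    HasFDerivAt.comp (g := G) (f := fun z : E × E => z.1) (x, u) hG.hasFDerivAt h0
  refine ⟨_, (h1.clm_apply hasFDerivAt_snd).clm_apply hasFDerivAt_snd, fun z => ?_⟩
  simp
  ring

variable {n : ℕ} {M : Type*} [TopologicalSpace M] [ChartedSpace (EuclideanSpace ℝ (Fin n)) M]
  [IsManifold (𝓡 n) ∞ M]

/-- The metric as a bilinear form on `T_pM`. -/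
def metricForm (g : SmoothMetric n M) (p : M) :
    LinearMap.BilinForm ℝ (TangentSpace (𝓡 n) p) :=
  LinearMap.mk₂ ℝ (fun v w => g.inner p v w) (by simp) (by simp) (by simp) (by simp)

theorem metricForm_nondegenerate (g : SmoothMetric n M) (p : M) :
    (metricForm g p).Nondegenerate := by
  refine ⟨fun v hv => ?_, fun v hv => ?_⟩ <;>
  · by_contra h
    exact (g.pos p v h).ne' (hv v)

/-- The metric in the chart at `p`: the matrix-valued function `x ↦ (g_{ij}(x))`. -/
def chartMetric (g : SmoothMetric n M) (p : M) (x : EuclideanSpace ℝ (Fin n)) :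
    EuclideanSpace ℝ (Fin n) →L[ℝ] EuclideanSpace ℝ (Fin n) →L[ℝ] ℝ :=
  let s := (trivializationAt (EuclideanSpace ℝ (Fin n))
    (TangentSpace (𝓡 n) : M → Type _) p).symmL ℝ ((extChartAt (𝓡 n) p).symm x)
  (ContinuousLinearMap.precomp ℝ s).comp ((g.inner ((extChartAt (𝓡 n) p).symm x)).comp s)

/-- The Christoffel symbols of the first kind at `p`, in the chart at `p`. -/
def christoffelForm (g : SmoothMetric n M) (p : M) :
    TangentSpace (𝓡 n) p →ₗ[ℝ] TangentSpace (𝓡 n) p →ₗ[ℝ]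
      Module.Dual ℝ (TangentSpace (𝓡 n) p) :=
  firstChristoffel (E := EuclideanSpace ℝ (Fin n)) (chartMetric g p) (extChartAt (𝓡 n) p p)

/-- Christoffel symbols of the second kind at `p` in the chart at `p`; they determine the
Levi-Civita connection of `g`. -/
def christoffel (g : SmoothMetric n M) (p : M) :
    TangentSpace (𝓡 n) p →ₗ[ℝ] TangentSpace (𝓡 n) p →ₗ[ℝ] TangentSpace (𝓡 n) p :=
  (christoffelForm g p).compr₂
    ((metricForm g p).toDual (metricForm_nondegenerate g p)).symm.toLinearMap

end LeviCivita

section SphereBundle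

variable {n : ℕ} {P : Type*} [TopologicalSpace P] [ChartedSpace (EuclideanSpace ℝ (Fin n)) P]
  [IsManifold (𝓡 n) ∞ P]

/-- The differential of the bundle projection `TP → P` at `v`. -/
def projDeriv (v : TangentBundle (𝓡 n) P) :
    TangentSpace (𝓡 n).tangent v →ₗ[ℝ] TangentSpace (𝓡 n) v.proj :=
  (mfderiv (𝓡 n).tangent (𝓡 n) (TotalSpace.proj : TangentBundle (𝓡 n) P → P) v).toLinearMap

/-- The coordinates `(ẋ, v̇)` of a tangent vector of `TP` at `v`, in the chart of `TP` induced by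
the chart of `P` at the base point of `v`. -/
def tangentCoord (v : TangentBundle (𝓡 n) P) : TangentSpace (𝓡 n).tangent v ≃ₗ[ℝ]
    TangentSpace (𝓡 n) v.proj × TangentSpace (𝓡 n) v.proj :=
  LinearEquiv.refl ℝ (EuclideanSpace ℝ (Fin n) × EuclideanSpace ℝ (Fin n))

/-- The connection map `T_v TP → T_{p(v)}P` of the Levi-Civita connection, `v̇ + Γ(ẋ, v)` in
coordinates. Its kernel is the horizontal space; for a vector field `V` on `P` one has
`∇_X V = connectionMap (dV (X))`. -/
def connectionMap (g : SmoothMetric n P) (v : TangentBundle (𝓡 n) P) :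
    TangentSpace (𝓡 n).tangent v →ₗ[ℝ] TangentSpace (𝓡 n) v.proj :=
  LinearMap.snd ℝ _ _ ∘ₗ (tangentCoord v).toLinearMap +
    (christoffel g v.proj).flip v.snd ∘ₗ projDeriv v

/-- The tangent vector of `TP` at `v` with horizontal part `w` and vertical part `u`, that is
with `dp = w` and `connectionMap = u`. -/
def tangentLift (g : SmoothMetric n P) (v : TangentBundle (𝓡 n) P) :
    TangentSpace (𝓡 n) v.proj × TangentSpace (𝓡 n) v.proj →ₗ[ℝ]
      TangentSpace (𝓡 n).tangent v :=
  (tangentCoord v).symm.toLinearMap ∘ₗ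
    LinearMap.prod (LinearMap.fst ℝ _ _)
      (LinearMap.snd ℝ _ _ - (christoffel g v.proj).flip v.snd ∘ₗ LinearMap.fst ℝ _ _)

theorem extChartAt_tangent_symm_proj (v : TangentBundle (𝓡 n) P)
    (z : EuclideanSpace ℝ (Fin n) × EuclideanSpace ℝ (Fin n)) :
    ((extChartAt (𝓡 n).tangent v).symm z).proj = (extChartAt (𝓡 n) v.proj).symm z.1 :=
  rfl

theorem extChartAt_tangent_apply_self (v : TangentBundle (𝓡 n) P) :
    extChartAt (𝓡 n).tangent v v = (extChartAt (𝓡 n) v.proj v.proj, v.snd) := by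
  refine Prod.ext rfl ?_
  change ((tangentBundleCore (𝓡 n) P).coordChange _ _ _ _) = _
  exact (tangentBundleCore (𝓡 n) P).coordChange_self _ _ (mem_chart_source _ _) _

theorem tangent_target_mem_nhds (v : TangentBundle (𝓡 n) P) :
    (Prod.fst ⁻¹' (extChartAt (𝓡 n) v.proj).target :
      Set (EuclideanSpace ℝ (Fin n) × EuclideanSpace ℝ (Fin n))) ∈
        𝓝 (extChartAt (𝓡 n).tangent v v) := by
  rw [extChartAt_tangent_apply_self]
  have h : (extChartAt (𝓡 n) v.proj).target ∈ 𝓝 (extChartAt (𝓡 n) v.proj v.proj) :=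
    extChartAt_target_mem_nhds v.proj
  exact (continuous_fst (X := EuclideanSpace ℝ (Fin n))
    (Y := EuclideanSpace ℝ (Fin n))).continuousAt.preimage_mem_nhds h

theorem extChartAt_tangent_symm_snd (v : TangentBundle (𝓡 n) P)
    (z : EuclideanSpace ℝ (Fin n) × EuclideanSpace ℝ (Fin n))
    (hz : z.1 ∈ (extChartAt (𝓡 n) v.proj).target) :
    ((extChartAt (𝓡 n).tangent v).symm z).snd =
      (trivializationAt (EuclideanSpace ℝ (Fin n)) (TangentSpace (𝓡 n) : P → Type _)
        v.proj).symmL ℝ ((extChartAt (𝓡 n) v.proj).symm z.1) z.2 := by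
  have h : (extChartAt (𝓡 n) v.proj).symm z.1 ∈
      (chartAt (EuclideanSpace ℝ (Fin n)) v.proj).source := by
    have := (extChartAt (𝓡 n) v.proj).map_target hz
    rwa [extChartAt_source] at this
  rw [TangentBundle.symmL_trivializationAt_eq_core h]
  rfl

theorem projDeriv_apply (v : TangentBundle (𝓡 n) P) (X : TangentSpace (𝓡 n).tangent v) :
    projDeriv v X = (tangentCoord v X).1 := by
  have h : HasMFDerivAt (𝓡 n).tangent (𝓡 n) (TotalSpace.proj : TangentBundle (𝓡 n) P → P) v
      (ContinuousLinearMap.fst ℝ (EuclideanSpace ℝ (Fin n)) (EuclideanSpace ℝ (Fin n))) := by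
    refine ⟨(FiberBundle.continuous_proj _ _).continuousAt, ?_⟩
    refine HasFDerivAt.hasFDerivWithinAt ?_
    refine (ContinuousLinearMap.fst ℝ (EuclideanSpace ℝ (Fin n))
      (EuclideanSpace ℝ (Fin n))).hasFDerivAt.congr_of_eventuallyEq ?_
    filter_upwards [tangent_target_mem_nhds v] with z hz
    change extChartAt (𝓡 n) v.proj ((extChartAt (𝓡 n) v.proj).symm z.1) = z.1
    exact (extChartAt (𝓡 n) v.proj).right_inv hz
  unfold projDeriv
  rw [h.mfderiv]
  rfl

theorem projDeriv_tangentLift (g : SmoothMetric n P) (v : TangentBundle (𝓡 n) P)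
    (w u : TangentSpace (𝓡 n) v.proj) : projDeriv v (tangentLift g v (w, u)) = w := by
  simp [projDeriv_apply, tangentLift]

theorem connectionMap_tangentLift (g : SmoothMetric n P) (v : TangentBundle (𝓡 n) P)
    (w u : TangentSpace (𝓡 n) v.proj) : connectionMap g v (tangentLift g v (w, u)) = u := by
  simp [connectionMap, projDeriv_tangentLift]
  simp [tangentLift]

theorem tangentLift_eq (g : SmoothMetric n P) (v : TangentBundle (𝓡 n) P)
    (X : TangentSpace (𝓡 n).tangent v) :
    tangentLift g v (projDeriv v X, connectionMap g v X) = X := by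
  apply (tangentCoord v).injective
  simp [connectionMap, projDeriv_apply, tangentLift]

/-- The function `w ↦ g(w, w)` on `TP`. -/
def normSqFun (g : SmoothMetric n P) (w : TangentBundle (𝓡 n) P) : ℝ :=
  g.inner w.proj w.snd w.snd

theorem chartMetric_apply (g : SmoothMetric n P) (p : P) (x a b : EuclideanSpace ℝ (Fin n)) :
    chartMetric g p x a b = g.inner ((extChartAt (𝓡 n) p).symm x)
      ((trivializationAt (EuclideanSpace ℝ (Fin n)) (TangentSpace (𝓡 n) : P → Type _) p).symmL ℝ
        ((extChartAt (𝓡 n) p).symm x) a)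
      ((trivializationAt (EuclideanSpace ℝ (Fin n)) (TangentSpace (𝓡 n) : P → Type _) p).symmL ℝ
        ((extChartAt (𝓡 n) p).symm x) b) := rfl

theorem chartMetric_self (g : SmoothMetric n P) (p : P) (a b : TangentSpace (𝓡 n) p) :
    chartMetric g p (extChartAt (𝓡 n) p p) a b = g.inner p a b := by
  have key : ∀ (q : P), q = p → ∀ a b : EuclideanSpace ℝ (Fin n),
      g.inner q ((trivializationAt (EuclideanSpace ℝ (Fin n))
          (TangentSpace (𝓡 n) : P → Type _) p).symmL ℝ q a)
        ((trivializationAt (EuclideanSpace ℝ (Fin n))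
          (TangentSpace (𝓡 n) : P → Type _) p).symmL ℝ q b) = g.inner p a b := by
    rintro q rfl a b
    rw [TangentBundle.symmL_trivializationAt_eq_core (mem_chart_source _ q)]
    congr 1
    · congr 1
      exact (tangentBundleCore (𝓡 n) P).coordChange_self _ _ (mem_chart_source _ _) _
    · exact (tangentBundleCore (𝓡 n) P).coordChange_self _ _ (mem_chart_source _ _) _
  exact key _ (extChartAt_to_inv p) a b

theorem chartMetric_differentiableAt (g : SmoothMetric n P) (p : P) :
    DifferentiableAt ℝ (chartMetric g p) (extChartAt (𝓡 n) p p) := by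
  have h1 := (contMDiffAt_section (IB := 𝓡 n) (n := ∞)
    (F := EuclideanSpace ℝ (Fin n) →L[ℝ] EuclideanSpace ℝ (Fin n) →L[ℝ] ℝ)
    (E := fun x : P => TangentSpace (𝓡 n) x →L[ℝ] TangentSpace (𝓡 n) x →L[ℝ] ℝ)
    (s := g.inner) p).1 (g.contMDiff p)
  have h2 := ((contMDiffOn_extChartAt_symm (I := 𝓡 n) (n := ∞) p) _
    (mem_extChartAt_target p)).contMDiffAt (extChartAt_target_mem_nhds p)
  have h4 := (h1.comp_of_eq h2 (extChartAt_to_inv p)).contDiffAt.differentiableAt (by simp)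
  refine h4.congr_of_eventuallyEq ?_
  filter_upwards [extChartAt_target_mem_nhds p] with x hx
  have hb : (extChartAt (𝓡 n) p).symm x ∈ (trivializationAt (EuclideanSpace ℝ (Fin n))
      (TangentSpace (𝓡 n) : P → Type _) p).baseSet := by
    have := (extChartAt (𝓡 n) p).map_target hx
    rwa [extChartAt_source] at this
  ext a b
  rw [chartMetric_apply]
  simp only [comp_apply, hom_trivializationAt_apply]
  have hs : ∀ c : EuclideanSpace ℝ (Fin n),
      (trivializationAt (EuclideanSpace ℝ (Fin n)) (TangentSpace (𝓡 n) : P → Type _) p).symmL ℝ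
        ((extChartAt (𝓡 n) p).symm x) c =
      (trivializationAt (EuclideanSpace ℝ (Fin n)) (TangentSpace (𝓡 n) : P → Type _) p).symm
        ((extChartAt (𝓡 n) p).symm x) c := fun c => Trivialization.symmL_apply _ hb c
  rw [inCoordinates_apply_eq₂ hb hb (mem_univ _), hs, hs]
  simp

theorem mfderiv_normSqFun (g : SmoothMetric n P) (v : TangentBundle (𝓡 n) P)
    (X : TangentSpace (𝓡 n).tangent v) :
    mfderiv (𝓡 n).tangent 𝓘(ℝ, ℝ) (normSqFun g) v X =
      (2 * g.inner v.proj v.snd (connectionMap g v X) : ℝ) := by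
  let x₀ : EuclideanSpace ℝ (Fin n) × EuclideanSpace ℝ (Fin n) :=
    (extChartAt (𝓡 n) v.proj v.proj, v.snd)
  have hx₀ : extChartAt (𝓡 n).tangent v v = x₀ := extChartAt_tangent_apply_self v
  let F : EuclideanSpace ℝ (Fin n) × EuclideanSpace ℝ (Fin n) → ℝ :=
    fun z => chartMetric g v.proj z.1 z.2 z.2
  obtain ⟨f', h1, hf'⟩ : ∃ f' : EuclideanSpace ℝ (Fin n) × EuclideanSpace ℝ (Fin n) →L[ℝ] ℝ,
      HasFDerivAt F f' x₀ ∧ _ :=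
    exists_hasFDerivAt_quadratic (chartMetric_differentiableAt g v.proj) v.snd
  have hF : ∀ z : EuclideanSpace ℝ (Fin n) × EuclideanSpace ℝ (Fin n),
      z.1 ∈ (extChartAt (𝓡 n) v.proj).target →
      normSqFun g ((extChartAt (𝓡 n).tangent v).symm z) = F z := by
    intro z hz
    change g.inner _ ((extChartAt (𝓡 n).tangent v).symm z).snd
        ((extChartAt (𝓡 n).tangent v).symm z).snd = _
    rw [extChartAt_tangent_symm_snd v z hz]
    rfl
  have h2 : HasMFDerivAt (𝓡 n).tangent 𝓘(ℝ, ℝ) (normSqFun g) v f' := by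
    refine ⟨?_, ?_⟩
    rotate_left
    · refine HasFDerivAt.hasFDerivWithinAt ?_
      rw [hx₀]
      refine h1.congr_of_eventuallyEq ?_
      rw [← hx₀]
      filter_upwards [tangent_target_mem_nhds v] with z hz
      exact hF z hz
    · have h3 : ContinuousAt (F ∘ extChartAt (𝓡 n).tangent v) v := by
        refine ContinuousAt.comp ?_ (continuousAt_extChartAt v)
        rw [hx₀]
        exact h1.continuousAt
      refine h3.congr ?_
      filter_upwards [(continuousAt_extChartAt (I := (𝓡 n).tangent) v).preimage_mem_nhds
        (tangent_target_mem_nhds v), extChartAt_source_mem_nhds (I := (𝓡 n).tangent) v] with w hw hw'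
      rw [comp_apply, ← hF _ hw, (extChartAt (𝓡 n).tangent v).left_inv hw']
  rw [h2.mfderiv]
  have h4 : ∀ a b : TangentSpace (𝓡 n) v.proj,
      g.inner v.proj a (christoffel g v.proj b v.snd) = christoffelForm g v.proj b v.snd a := by
    intro a b
    rw [g.symm]
    exact LinearMap.BilinForm.apply_toDual_symm_apply
      (hB := metricForm_nondegenerate g v.proj) _ _
  have h5 : connectionMap g v X =
      (tangentCoord v X).2 + christoffel g v.proj (tangentCoord v X).1 v.snd := by
    simp [connectionMap, projDeriv_apply]
  rw [h5, map_add, h4]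
  refine (hf' (tangentCoord v X)).trans ?_
  have h6 : christoffelForm g v.proj (tangentCoord v X).1 v.snd v.snd = (1 / 2 : ℝ) *
      (fderiv ℝ (chartMetric g v.proj) (extChartAt (𝓡 n) v.proj v.proj)
          (tangentCoord v X).1 v.snd v.snd +
        fderiv ℝ (chartMetric g v.proj) (extChartAt (𝓡 n) v.proj v.proj)
          v.snd (tangentCoord v X).1 v.snd -
        fderiv ℝ (chartMetric g v.proj) (extChartAt (𝓡 n) v.proj v.proj)
          v.snd (tangentCoord v X).1 v.snd) := rfl
  have h7 := chartMetric_self g v.proj (tangentCoord v X).2 v.snd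
  have h8 := chartMetric_self g v.proj v.snd (tangentCoord v X).2
  rw [h6, g.symm v.proj v.snd, ← h7]
  rw [g.symm v.proj, ← h7] at h8
  rw [h8]
  ring

end SphereBundle

section FibreDirection

theorem isPositiveBasis_iff_det_pos {V : Type*} [AddCommGroup V] [Module ℝ V] {n : ℕ}
    (b : Module.Basis (Fin n) ℝ V) (v : Fin n → V) :
    IsPositiveBasis b.orientation v ↔ 0 < b.det v := by
  constructor
  · rintro ⟨e, rfl, he⟩
    exact (b.orientation_eq_iff_det_pos e).1 he.symm
  · intro h
    obtain ⟨h1, h2⟩ := (Module.Basis.is_basis_iff_det b).2 (isUnit_iff_ne_zero.2 h.ne')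
    refine ⟨Module.Basis.mk h1 h2.ge, by simp, ?_⟩
    refine ((b.orientation_eq_iff_det_pos _).2 ?_).symm
    simpa using h

theorem exists_positive_kernel_vector {V W : Type*} [AddCommGroup V] [Module ℝ V]
    [AddCommGroup W] [Module ℝ W] (hV : Module.finrank ℝ V = 3)
    (hW : Module.finrank ℝ W = 2) (A : V →ₗ[ℝ] W) (hA : Surjective A)
    (B : LinearMap.BilinForm ℝ V) (hB : ∀ v, v ≠ 0 → 0 < B v v)
    (oV : Orientation ℝ V (Fin 3)) (oW : Orientation ℝ W (Fin 2)) :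
    ∃ t : V, A t = 0 ∧ B t t = 1 ∧
      ∀ X Y : V, IsPositiveBasis oW ![A X, A Y] → IsPositiveBasis oV ![t, X, Y] := by
  have : FiniteDimensional ℝ V := Module.finite_of_finrank_pos (by omega)
  have : FiniteDimensional ℝ W := Module.finite_of_finrank_pos (by omega)
  obtain ⟨bV, rfl⟩ : ∃ b : Module.Basis (Fin 3) ℝ V, b.orientation = oV :=
    ⟨oV.someBasis (by simp [hV]), oV.someBasis_orientation _⟩
  obtain ⟨bW, rfl⟩ : ∃ b : Module.Basis (Fin 2) ℝ W, b.orientation = oW :=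
    ⟨oW.someBasis (by simp [hW]), oW.someBasis_orientation _⟩
  obtain ⟨k, hk, hk0⟩ : ∃ k : V, A k = 0 ∧ k ≠ 0 := by
    have h1 := A.finrank_range_add_finrank_ker
    rw [LinearMap.range_eq_top.2 hA, finrank_top, hW, hV] at h1
    have h2 : LinearMap.ker A ≠ ⊥ := by
      intro h
      rw [h, finrank_bot] at h1
      omega
    obtain ⟨k, hk, hk0⟩ := Submodule.exists_mem_ne_zero_of_ne_bot h2
    exact ⟨k, hk, hk0⟩
  obtain ⟨t, ht, ht1⟩ : ∃ t : V, A t = 0 ∧ B t t = 1 := by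
    have h := hB k hk0
    refine ⟨(Real.sqrt (B k k))⁻¹ • k, by simp [hk], ?_⟩
    have hs : Real.sqrt (B k k) ≠ 0 := (Real.sqrt_pos.2 h).ne'
    simp only [map_smul, LinearMap.smul_apply, smul_eq_mul]
    field_simp
    rw [Real.sq_sqrt h.le]
  have ht0 : t ≠ 0 := by
    rintro rfl
    simp at ht1
  obtain ⟨X₀, hX₀⟩ := hA (bW 0)
  obtain ⟨Y₀, hY₀⟩ := hA (bW 1)
  have hli : LinearIndependent ℝ ![t, X₀, Y₀] := by
    rw [Fintype.linearIndependent_iff]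
    intro c hc
    simp only [Fin.sum_univ_three, Matrix.cons_val_zero, Matrix.cons_val_one,
      Matrix.cons_val] at hc
    have h1 := congrArg A hc
    simp only [map_add, map_smul, ht, hX₀, hY₀, smul_zero, zero_add, map_zero] at h1
    have h2 := Fintype.linearIndependent_iff.1 bW.linearIndependent ![c 1, c 2]
      (by simpa [Fin.sum_univ_two] using h1)
    have h3 : c 1 = 0 := h2 0
    have h4 : c 2 = 0 := h2 1
    rw [h3, h4] at hc
    have h5 : c 0 = 0 := by simpa [ht0] using hc
    intro i
    fin_cases i <;> assumption
  let e := basisOfLinearIndependentOfCardEqFinrank hli (by simp [hV])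
  have he : ⇑e = ![t, X₀, Y₀] := coe_basisOfLinearIndependentOfCardEqFinrank _ _
  have key : ∀ X Y : V, bV.det ![t, X, Y] = bV.det e * bW.det ![A X, A Y] := by
    intro X Y
    have hrt : e.repr t = Finsupp.single 0 1 := by
      have : e 0 = t := by rw [he]; rfl
      rw [← this, e.repr_self]
    have hA' : ∀ Z : V, A Z = e.repr Z 1 • bW 0 + e.repr Z 2 • bW 1 := by
      intro Z
      conv_lhs => rw [← e.sum_repr Z]
      simp [Fin.sum_univ_three, he, ht, hX₀, hY₀]
    have h1 : bV.det ![t, X, Y] = bV.det e * e.det ![t, X, Y] := by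
      conv_lhs => rw [bV.det.eq_smul_basis_det e]
      rfl
    rw [h1]
    congr 1
    rw [Module.Basis.det_apply, Module.Basis.det_apply, Matrix.det_fin_three, Matrix.det_fin_two]
    simp [Module.Basis.toMatrix_apply, hrt, hA']
  have hc : bV.det e ≠ 0 := (bV.isUnit_det e).ne_zero
  rcases lt_or_gt_of_ne hc with hneg | hpos
  · refine ⟨-t, by simp [ht], by simp [ht1], fun X Y h => ?_⟩
    rw [isPositiveBasis_iff_det_pos] at h ⊢
    have h1 : bV.det ![-t, X, Y] = - bV.det ![t, X, Y] := by
      have e1 : update ![t, X, Y] 0 (-t) = ![-t, X, Y] := by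
        funext i
        fin_cases i <;> rfl
      have e2 : update ![t, X, Y] 0 t = ![t, X, Y] := by
        funext i
        fin_cases i <;> rfl
      rw [← e1, AlternatingMap.map_update_neg, e2]
    rw [h1, key]
    nlinarith
  · refine ⟨t, ht, ht1, fun X Y h => ?_⟩
    rw [isPositiveBasis_iff_det_pos] at h ⊢
    rw [key]
    positivity

theorem exists_smul_of_mem_kernel {V W : Type*} [AddCommGroup V] [Module ℝ V]
    [AddCommGroup W] [Module ℝ W] (hV : Module.finrank ℝ V = 3)
    (hW : Module.finrank ℝ W = 2) (A : V →ₗ[ℝ] W) (hA : Surjective A) (t : V) (ht : A t = 0)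
    (ht0 : t ≠ 0) (k : V) (hk : A k = 0) : ∃ s : ℝ, k = s • t := by
  have : FiniteDimensional ℝ V := Module.finite_of_finrank_pos (by omega)
  have h1 := A.finrank_range_add_finrank_ker
  rw [LinearMap.range_eq_top.2 hA, finrank_top, hW, hV] at h1
  have h2 : Module.finrank ℝ (LinearMap.ker A) = 1 := by omega
  obtain ⟨s, hs⟩ := (finrank_eq_one_iff_of_nonzero' (⟨t, ht⟩ : LinearMap.ker A)
    (fun h => ht0 (congrArg Subtype.val h))).1 h2 ⟨k, hk⟩
  exact ⟨s, (congrArg Subtype.val hs).symm⟩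

variable {P M : Type*} [TopologicalSpace P] [ChartedSpace (EuclideanSpace ℝ (Fin 3)) P]
  [IsManifold (𝓡 3) ∞ P] [TopologicalSpace M] [ChartedSpace (EuclideanSpace ℝ (Fin 2)) M]
  [IsManifold (𝓡 2) ∞ M]

theorem finrank_tangent {n : ℕ} {N : Type*} [TopologicalSpace N]
    [ChartedSpace (EuclideanSpace ℝ (Fin n)) N] (p : N) :
    Module.finrank ℝ (TangentSpace (𝓡 n) p) = n :=
  (finrank_euclideanSpace_fin : Module.finrank ℝ (EuclideanSpace ℝ (Fin n)) = n)

theorem exists_unitFibreVector (g : SmoothMetric 3 P) (oP : ManifoldOrientation 3 P)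
    (oM : ManifoldOrientation 2 M) (f : P → M) (p : P)
    (hsub : Surjective (mfderiv (𝓡 3) (𝓡 2) f p)) :
    ∃ t : TangentSpace (𝓡 3) p, mfderiv (𝓡 3) (𝓡 2) f p t = 0 ∧ g.inner p t t = 1 ∧
      ∀ X Y : TangentSpace (𝓡 3) p,
        IsPositiveBasis (oM.at_point (f p))
          ![mfderiv (𝓡 3) (𝓡 2) f p X, mfderiv (𝓡 3) (𝓡 2) f p Y] →
        IsPositiveBasis (oP.at_point p) ![t, X, Y] :=
  exists_positive_kernel_vector (finrank_tangent p) (finrank_tangent (f p))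
    (mfderiv (𝓡 3) (𝓡 2) f p).toLinearMap hsub (metricForm g p) (g.pos p) _ _

/-- The unit length vector field `T` in the positive fibre direction: `T` is tangent to the fibres
of `f`, `g(T, T) = 1`, and `(T, X, Y)` is positively oriented in `P` whenever `(df X, df Y)` is
positively oriented in `M`. These properties determine `T`. -/
def unitFibreField (g : SmoothMetric 3 P) (oP : ManifoldOrientation 3 P)
    (oM : ManifoldOrientation 2 M) (f : P → M)
    (hsub : ∀ p, Surjective (mfderiv (𝓡 3) (𝓡 2) f p)) (p : P) : TangentSpace (𝓡 3) p :=
  (exists_unitFibreVector g oP oM f p (hsub p)).choose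

theorem unitFibreField_spec (g : SmoothMetric 3 P) (oP : ManifoldOrientation 3 P)
    (oM : ManifoldOrientation 2 M) (f : P → M)
    (hsub : ∀ p, Surjective (mfderiv (𝓡 3) (𝓡 2) f p)) (p : P) :
    mfderiv (𝓡 3) (𝓡 2) f p (unitFibreField g oP oM f hsub p) = 0 ∧
      g.inner p (unitFibreField g oP oM f hsub p) (unitFibreField g oP oM f hsub p) = 1 ∧
      ∀ X Y : TangentSpace (𝓡 3) p,
        IsPositiveBasis (oM.at_point (f p))
          ![mfderiv (𝓡 3) (𝓡 2) f p X, mfderiv (𝓡 3) (𝓡 2) f p Y] →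
        IsPositiveBasis (oP.at_point p) ![unitFibreField g oP oM f hsub p, X, Y] :=
  (exists_unitFibreVector g oP oM f p (hsub p)).choose_spec

end FibreDirection

section CrossProductLemmas

variable {P : Type*} [TopologicalSpace P] [ChartedSpace (EuclideanSpace ℝ (Fin 3)) P]
  [IsManifold (𝓡 3) ∞ P]

theorem inner_eq_dotProduct (g : SmoothMetric 3 P) (o : ManifoldOrientation 3 P) (p : P)
    (v w : TangentSpace (𝓡 3) p) : g.inner p v w =
      (positiveFrame g o p).equivFun v ⬝ᵥ (positiveFrame g o p).equivFun w := by
  have h := (exists_positive_orthonormal_basis g o p).choose_spec.1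
  conv_lhs => rw [← (positiveFrame g o p).sum_equivFun v, ← (positiveFrame g o p).sum_equivFun w]
  have h' : ∀ i j, g.inner p (positiveFrame g o p i) (positiveFrame g o p j) =
    if i = j then 1 else 0 := h
  simp only [Fin.sum_univ_three, map_add, map_smul, add_apply, smul_apply, h', dotProduct]
  simp
  ring

theorem inner_tangentCross (g : SmoothMetric 3 P) (o : ManifoldOrientation 3 P) (p : P)
    (v w : TangentSpace (𝓡 3) p) : g.inner p (tangentCross g o p v w) v = 0 := by
  rw [g.symm, inner_eq_dotProduct g o]
  simp only [tangentCross, LinearMap.comp_apply, LinearEquiv.coe_coe,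
    LinearEquiv.apply_symm_apply, dot_self_cross]

theorem tangentCross_tangentCross (g : SmoothMetric 3 P) (o : ManifoldOrientation 3 P) (p : P)
    (v w : TangentSpace (𝓡 3) p) (hv : g.inner p v v = 1) (hw : g.inner p w v = 0) :
    tangentCross g o p v (tangentCross g o p v w) = -w := by
  rw [inner_eq_dotProduct g o] at hv hw
  apply (positiveFrame g o p).equivFun.injective
  simp only [tangentCross, LinearMap.comp_apply, LinearEquiv.coe_coe,
    LinearEquiv.apply_symm_apply, map_neg]
  rw [cross_cross_eq_smul_sub_smul', hv, dotProduct_comm, hw]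
  simp

end CrossProductLemmas

section CRStructures

/-- The data `(H, 𝒥)` of a CR structure of hypersurface type along a subset (in practice a
submanifold) `carrier` of a manifold `N`: the Levi distribution `H`, whose fibres are subspaces of
the tangent spaces of `carrier`, with its complex structure `𝒥 : H → H`, `𝒥² = -1`. Only the values
of `𝒥` on `H` are meaningful. Formal integrability, which holds for both structures constructed
below, plays no role in the notion of a CR holomorphic map and is not recorded. -/
structure LeviStructure {E H' : Type*} [NormedAddCommGroup E] [NormedSpace ℝ E]
    [TopologicalSpace H'] (I : ModelWithCorners ℝ E H') (N : Type*) [TopologicalSpace N]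
    [ChartedSpace H' N] where
  carrier : Set N
  H : ∀ x : N, Submodule ℝ (TangentSpace I x)
  J : ∀ x : N, TangentSpace I x →ₗ[ℝ] TangentSpace I x
  J_mem : ∀ x ∈ carrier, ∀ X ∈ H x, J x X ∈ H x
  J_sq : ∀ x ∈ carrier, ∀ X ∈ H x, J x (J x X) = -X

/-- A CR holomorphic map from a manifold with a CR structure: a smooth map into the target whose differential maps the Levi distribution complex
linearly into the Levi distribution of the target. -/
def IsCRHolomorphic {E H' E₂ H₂ : Type*} [NormedAddCommGroup E] [NormedSpace ℝ E]
    [TopologicalSpace H'] {I : ModelWithCorners ℝ E H'} [NormedAddCommGroup E₂]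
    [NormedSpace ℝ E₂] [TopologicalSpace H₂] {I₂ : ModelWithCorners ℝ E₂ H₂}
    {N N₂ : Type*} [TopologicalSpace N] [ChartedSpace H' N] [TopologicalSpace N₂]
    [ChartedSpace H₂ N₂] (S : LeviStructure I N) (S₂ : LeviStructure I₂ N₂)
    (f : N → N₂) : Prop :=
  S.carrier = univ ∧ ContMDiff I I₂ ∞ f ∧ (∀ x, f x ∈ S₂.carrier) ∧
    ∀ (x : N), ∀ X ∈ S.H x, mfderiv I I₂ f x X ∈ S₂.H (f x) ∧
      mfderiv I I₂ f x (S.J x X) = S₂.J (f x) (mfderiv I I₂ f x X)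

variable {P M : Type*} [TopologicalSpace P] [ChartedSpace (EuclideanSpace ℝ (Fin 3)) P]
  [IsManifold (𝓡 3) ∞ P] [TopologicalSpace M] [ChartedSpace (EuclideanSpace ℝ (Fin 2)) M]
  [IsManifold (𝓡 2) ∞ M]

theorem mem_sphereBundle_levi (g : SmoothMetric 3 P) (v : TangentBundle (𝓡 3) P)
    (X : TangentSpace (𝓡 3).tangent v) :
    X ∈ LinearMap.ker (mfderiv (𝓡 3).tangent 𝓘(ℝ, ℝ) (normSqFun g) v).toLinearMap ⊓
      LinearMap.ker ((g.inner v.proj v.snd).toLinearMap ∘ₗ projDeriv v) ↔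
    g.inner v.proj v.snd (connectionMap g v X) = 0 ∧ g.inner v.proj v.snd (projDeriv v X) = 0 := by
  have h := mfderiv_normSqFun g v X
  refine Submodule.mem_inf.trans (and_congr ?_ Iff.rfl)
  rw [LinearMap.mem_ker]
  refine Iff.trans (Eq.congr_left h) ?_
  exact mul_eq_zero_iff_left (two_ne_zero (α := ℝ))

/-- The complex structure `𝒥` on the Levi distribution of the unit sphere bundle: the cross product
with `v` on the horizontal part `dp(X)` and on the vertical part of `X`. -/
def sphereBundleJ (g : SmoothMetric 3 P) (o : ManifoldOrientation 3 P)
    (v : TangentBundle (𝓡 3) P) :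
    TangentSpace (𝓡 3).tangent v →ₗ[ℝ] TangentSpace (𝓡 3).tangent v :=
  tangentLift g v ∘ₗ LinearMap.prod
    (tangentCross g o v.proj v.snd ∘ₗ projDeriv v)
    (tangentCross g o v.proj v.snd ∘ₗ connectionMap g v)

theorem sphereBundleJ_apply (g : SmoothMetric 3 P) (o : ManifoldOrientation 3 P)
    (v : TangentBundle (𝓡 3) P) (X : TangentSpace (𝓡 3).tangent v) :
    sphereBundleJ g o v X = tangentLift g v (tangentCross g o v.proj v.snd (projDeriv v X),
      tangentCross g o v.proj v.snd (connectionMap g v X)) := rfl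

/-- LeBrun's CR structure on the tangent sphere bundle `SP` of an oriented conformal 3-manifold.
By means of a metric `g` in the conformal class, `SP` is identified with the unit sphere bundle
`S_gP = {v | g(v, v) = 1} ⊆ TP`. The Levi distribution at `v` consists of those vectors `X`
tangent to `S_gP` (the kernel of the differential of `w ↦ g(w, w)`) for which `dp(X) ⊥ v`. The
Levi-Civita connection splits it into a horizontal and a vertical part, both isomorphic to `v^⊥`,
and `𝒥` is the cross product with `v` on both parts. -/
def sphereBundleCR (g : SmoothMetric 3 P) (o : ManifoldOrientation 3 P) :
    LeviStructure (𝓡 3).tangent (TangentBundle (𝓡 3) P) where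
  carrier := {v | g.inner v.proj v.snd v.snd = 1}
  H v := LinearMap.ker (mfderiv (𝓡 3).tangent 𝓘(ℝ, ℝ) (normSqFun g) v).toLinearMap ⊓
    LinearMap.ker ((g.inner v.proj v.snd).toLinearMap ∘ₗ projDeriv v)
  J v := sphereBundleJ g o v
  J_mem v hv X hX := by
    rw [mem_sphereBundle_levi] at hX ⊢
    rw [sphereBundleJ_apply, projDeriv_tangentLift, connectionMap_tangentLift]
    exact ⟨(g.symm _ _ _).trans (inner_tangentCross g o _ _ _),
      (g.symm _ _ _).trans (inner_tangentCross g o _ _ _)⟩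
  J_sq v hv X hX := by
    rw [mem_sphereBundle_levi] at hX
    rw [sphereBundleJ_apply, sphereBundleJ_apply, projDeriv_tangentLift, connectionMap_tangentLift,
      tangentCross_tangentCross g o _ _ _ hv ((g.symm _ _ _).trans hX.2),
      tangentCross_tangentCross g o _ _ _ hv ((g.symm _ _ _).trans hX.1), ← Prod.neg_mk, map_neg,
      tangentLift_eq]

/-- The CR structure on `P` defined by a submersion `f` onto an oriented surface: `H` is the
orthogonal complement of `ker df`, and `𝒥` is the rotation by `π/2` in positive direction,
`𝒥 X = T × X`. -/
def fibredCR (g : SmoothMetric 3 P) (oP : ManifoldOrientation 3 P)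
    (oM : ManifoldOrientation 2 M) (f : P → M)
    (hsub : ∀ p, Surjective (mfderiv (𝓡 3) (𝓡 2) f p)) : LeviStructure (𝓡 3) P where
  carrier := univ
  H p := (metricForm g p).orthogonal (LinearMap.ker (mfderiv (𝓡 3) (𝓡 2) f p).toLinearMap)
  J p := tangentCross g oP p (unitFibreField g oP oM f hsub p)
  J_mem p _ X hX := by
    obtain ⟨h1, h2, -⟩ := unitFibreField_spec g oP oM f hsub p
    have h0 : unitFibreField g oP oM f hsub p ≠ 0 := by
      intro h
      rw [h] at h2
      simp at h2
    intro k hk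
    obtain ⟨s, rfl⟩ := exists_smul_of_mem_kernel (finrank_tangent p) (finrank_tangent (f p))
      (mfderiv (𝓡 3) (𝓡 2) f p).toLinearMap (hsub p) _ h1 h0 k hk
    have h3 := inner_tangentCross g oP p (unitFibreField g oP oM f hsub p) X
    rw [g.symm] at h3
    change g.inner p (s • _) _ = 0
    simp [h3]
  J_sq p _ X hX := by
    obtain ⟨h1, h2, -⟩ := unitFibreField_spec g oP oM f hsub p
    exact tangentCross_tangentCross g oP p _ X h2 ((g.symm _ _ _).trans (hX _ h1))

/-- The map `Ψ : P → SP` which assigns to each point the oriented fibre direction `[T]`; in the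
identification of `SP` with the unit sphere bundle of `g` it is the unit vector field `T`. -/
def fibreDirectionMap (g : SmoothMetric 3 P) (oP : ManifoldOrientation 3 P)
    (oM : ManifoldOrientation 2 M) (f : P → M)
    (hsub : ∀ p, Surjective (mfderiv (𝓡 3) (𝓡 2) f p)) (p : P) : TangentBundle (𝓡 3) P :=
  ⟨p, unitFibreField g oP oM f hsub p⟩

end CRStructures

section ConformalSubmersions

variable {P M : Type*} [TopologicalSpace P] [ChartedSpace (EuclideanSpace ℝ (Fin 3)) P]
  [IsManifold (𝓡 3) ∞ P] [TopologicalSpace M] [ChartedSpace (EuclideanSpace ℝ (Fin 2)) M]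
  [IsManifold (𝓡 2) ∞ M]

/-- `J` is a complex structure on the open subset `W` of the oriented surface `M`: a smooth field
of endomorphisms with `J² = -1`, which is formally integrable (its Nijenhuis tensor vanishes) and
compatible with the orientation. The values of `J` outside `W` are irrelevant. -/
structure IsComplexStructureOn (oM : ManifoldOrientation 2 M)
    (J : ∀ y : M, TangentSpace (𝓡 2) y →L[ℝ] TangentSpace (𝓡 2) y) (W : Set M) : Prop where
  isOpen : IsOpen W
  smooth : ContMDiffOn (𝓡 2) ((𝓡 2).prod
      𝓘(ℝ, EuclideanSpace ℝ (Fin 2) →L[ℝ] EuclideanSpace ℝ (Fin 2))) ∞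
    (fun y => TotalSpace.mk' (EuclideanSpace ℝ (Fin 2) →L[ℝ] EuclideanSpace ℝ (Fin 2))
      (E := fun y : M => TangentSpace (𝓡 2) y →L[ℝ] TangentSpace (𝓡 2) y) y (J y)) W
  sq : ∀ y ∈ W, ∀ u : TangentSpace (𝓡 2) y, J y (J y u) = -u
  positive : ∀ y ∈ W, ∀ u : TangentSpace (𝓡 2) y, u ≠ 0 →
    IsPositiveBasis (oM.at_point y) ![u, J y u]
  integrable : ∀ y ∈ W, ∀ X Y : ∀ z : M, TangentSpace (𝓡 2) z,
    ContMDiffAt (𝓡 2) (𝓡 2).tangent ∞ (fun z => (⟨z, X z⟩ : TangentBundle (𝓡 2) M)) y →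
    ContMDiffAt (𝓡 2) (𝓡 2).tangent ∞ (fun z => (⟨z, Y z⟩ : TangentBundle (𝓡 2) M)) y →
    VectorField.mlieBracket (𝓡 2) X Y y
      - VectorField.mlieBracket (𝓡 2) (fun z => J z (X z)) (fun z => J z (Y z)) y
      + J y (VectorField.mlieBracket (𝓡 2) (fun z => J z (X z)) Y y)
      + J y (VectorField.mlieBracket (𝓡 2) X (fun z => J z (Y z)) y) = 0

/-- `b` is an inner product which is Hermitian for `J`, i.e. which belongs to the conformal class
determined by `J`. -/
structure IsHermitianInner {W : Type*} [AddCommGroup W] [Module ℝ W]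
    (J : W → W) (b : LinearMap.BilinForm ℝ W) : Prop where
  symm : ∀ u v, b u v = b v u
  pos : ∀ u, u ≠ 0 → 0 < b u u
  hermitian : ∀ u v, b (J u) (J v) = b u v

/-- The submersion `f` is conformal on `U ⊆ P`, for the conformal structure of `P` and the one
on the surface `M` determined by the complex structure `J`: at each point of `U`, the restriction
of `df` to the orthogonal complement of its kernel is a conformal linear map. -/
def IsConformalSubmersionOn (c : ConformalStructure 3 P)
    (J : ∀ y : M, TangentSpace (𝓡 2) y →L[ℝ] TangentSpace (𝓡 2) y) (f : P → M) (U : Set P) :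
    Prop :=
  ∀ g ∈ c.metrics, ∀ p ∈ U, ∀ b : LinearMap.BilinForm ℝ (TangentSpace (𝓡 2) (f p)),
    IsHermitianInner (J (f p)) b → ∃ r : ℝ, 0 < r ∧
      ∀ X ∈ (metricForm g p).orthogonal (LinearMap.ker (mfderiv (𝓡 3) (𝓡 2) f p).toLinearMap),
      ∀ Y ∈ (metricForm g p).orthogonal (LinearMap.ker (mfderiv (𝓡 3) (𝓡 2) f p).toLinearMap),
        b (mfderiv (𝓡 3) (𝓡 2) f p X) (mfderiv (𝓡 3) (𝓡 2) f p Y) = r * g.inner p X Y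

end ConformalSubmersions

end

/-!
Write `T` for the unit fibre field and, at `q : P`, let `A_q` be the endomorphism of the tangent
plane of `M` at `f q` with `A_q (df X) = df (T × X)` (`fibreRotation`). It is well defined since
`T × T = 0`, it squares to `-1`, and it is positive by the choice of the direction of `T`. A
positive complex structure `J` makes `df` conformal on `T^⊥` at `q` if and only if it agrees with
`A_q` there (`isHermitianInner_fibreRotation_scaling`, `eq_fibreRotation_of_conformal`). Hence `f`
is conformal on `U` for some complex structure exactly when `A` is constant along the fibres of `f`
in `U`; smoothness of the descended structure follows from local sections of `f`, and integrability
is automatic on a surface (`nijenhuis_mlieBracket_eq_zero`).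

On the other side, `T` has unit length, so that `dΨ` always maps `T^⊥` into the Levi distribution,
and its horizontal part is complex linear. Therefore `Ψ` is CR holomorphic if and only if
`X ↦ ∇_X T` is complex linear on `T^⊥` (`isCRHolomorphic_iff`), that is, if and only if the
symmetric part of this endomorphism is a multiple of the identity (`commutes_tangentCross_iff`).

The two sides meet in the functions `k_{ij} = g(grad F_i, grad F_j)`, where `F_0`, `F_1` are the
pullbacks to `P` of two coordinates of `M`. As `dF_i (T) = 0`, one has
`T k_{ij} = -(g(grad F_i, ∇_{grad F_j} T) + g(grad F_j, ∇_{grad F_i} T))` (`mfderiv_gradientInner`).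
Since the gradients span `T^⊥`, the symmetric part of `∇T` is a multiple of the identity if and
only if `T k_{ij} = r k_{ij}` for some `r`, which means that the ratios `k_{ij} / √(det k)` have
derivative zero along `T` (`commutes_covDeriv_iff_mfderiv_conformalRatio`). But up to sign these
ratios are the entries of the matrix of `A` in the given coordinates
(`tangentComponents_fibreRotation`). So `Ψ` is CR holomorphic if and only if `A` is stationary along
the fibres. A submersion has locally connected fibres
(`exists_open_eq_of_mfderiv_eq_zero_on_ker`), which gives the local equivalence, and if the fibres
are connected then `A` is constant along whole fibres.
-/

noncomputable section

/-! ### Cross product and adapted frames -/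

section AdaptedFrames

theorem IsPositiveBasis.not_update_neg {V : Type*} [AddCommGroup V] [Module ℝ V] {n : ℕ}
    {o : Orientation ℝ V (Fin n)} {v : Fin n → V} (h : IsPositiveBasis o v) (i : Fin n) :
    ¬ IsPositiveBasis o (update v i (-v i)) := by
  obtain ⟨b, rfl, rfl⟩ := h
  rw [isPositiveBasis_iff_det_pos, AlternatingMap.map_update_neg, update_eq_self,
    Module.Basis.det_self]
  norm_num

variable {P : Type*} [TopologicalSpace P] [ChartedSpace (EuclideanSpace ℝ (Fin 3)) P]
  [IsManifold (𝓡 3) ∞ P]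

theorem positiveFrame_orientation (g : SmoothMetric 3 P) (o : ManifoldOrientation 3 P) (p : P) :
    (positiveFrame g o p).orientation = o.at_point p :=
  (exists_positive_orthonormal_basis g o p).choose_spec.2

theorem equivFun_tangentCross (g : SmoothMetric 3 P) (o : ManifoldOrientation 3 P) (p : P)
    (v w : TangentSpace (𝓡 3) p) : (positiveFrame g o p).equivFun (tangentCross g o p v w) =
      crossProduct ((positiveFrame g o p).equivFun v) ((positiveFrame g o p).equivFun w) := by
  simp only [tangentCross, LinearMap.comp_apply, LinearEquiv.coe_coe,
    LinearEquiv.apply_symm_apply]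

theorem tangentCross_self (g : SmoothMetric 3 P) (o : ManifoldOrientation 3 P) (p : P)
    (v : TangentSpace (𝓡 3) p) : tangentCross g o p v v = 0 := by
  apply (positiveFrame g o p).equivFun.injective
  rw [equivFun_tangentCross, cross_self, map_zero]

theorem isPositiveBasis_tangentCross (g : SmoothMetric 3 P) (o : ManifoldOrientation 3 P) (p : P)
    (v w : TangentSpace (𝓡 3) p) (h : 0 < g.inner p (tangentCross g o p v w)
      (tangentCross g o p v w)) :
    IsPositiveBasis (o.at_point p) ![v, w, tangentCross g o p v w] := by
  rw [← positiveFrame_orientation g o p, isPositiveBasis_iff_det_pos]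
  rw [inner_eq_dotProduct g o] at h
  have h1 : (positiveFrame g o p).det ![v, w, tangentCross g o p v w] =
      (positiveFrame g o p).equivFun (tangentCross g o p v w) ⬝ᵥ
        (positiveFrame g o p).equivFun (tangentCross g o p v w) := by
    have h2 := equivFun_tangentCross g o p v w
    rw [Module.Basis.det_apply, Matrix.det_fin_three]
    simp only [Module.Basis.toMatrix_apply, ← Module.Basis.equivFun_apply, Matrix.cons_val_zero,
      Matrix.cons_val_one, Matrix.cons_val, h2, cross_apply, dotProduct, Fin.sum_univ_three]
    ring
  rwa [h1]

theorem inner_tangentCross_self (g : SmoothMetric 3 P) (o : ManifoldOrientation 3 P) (p : P)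
    (v w : TangentSpace (𝓡 3) p) : g.inner p (tangentCross g o p v w) (tangentCross g o p v w) =
      g.inner p v v * g.inner p w w - g.inner p v w ^ 2 := by
  simp only [inner_eq_dotProduct g o, equivFun_tangentCross, cross_dot_cross]
  rw [dotProduct_comm ((positiveFrame g o p).equivFun w) ((positiveFrame g o p).equivFun v)]
  ring

theorem exists_unit_orthogonal (g : SmoothMetric 3 P) (o : ManifoldOrientation 3 P) (p : P)
    (v : TangentSpace (𝓡 3) p) (hv : g.inner p v v = 1) :
    ∃ e : TangentSpace (𝓡 3) p, g.inner p v e = 0 ∧ g.inner p e e = 1 := by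
  have h : ∃ e : TangentSpace (𝓡 3) p, g.inner p v e = 0 ∧ e ≠ 0 := by
    by_contra! h
    have h1 : ∀ w, tangentCross g o p v w = 0 := fun w =>
      h _ ((g.symm _ _ _).trans (inner_tangentCross g o p v w))
    have h2 : ∀ w, g.inner p w w = g.inner p v w ^ 2 := fun w => by
      have := inner_tangentCross_self g o p v w
      rw [h1 w, hv] at this
      simp at this
      linarith
    have h3 : ∀ w, w = g.inner p v w • v := fun w => by
      rw [← sub_eq_zero]
      apply h
      simp [hv]
    have h4 : Module.finrank ℝ (TangentSpace (𝓡 3) p) ≤ 1 :=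
      finrank_le_one v fun w => ⟨_, (h3 w).symm⟩
    rw [finrank_tangent] at h4
    omega
  obtain ⟨e, he, he0⟩ := h
  have h0 := g.pos p e he0
  refine ⟨(Real.sqrt (g.inner p e e))⁻¹ • e, by simp [he], ?_⟩
  have hs : Real.sqrt (g.inner p e e) ≠ 0 := (Real.sqrt_pos.2 h0).ne'
  simp only [map_smul, smul_apply, smul_eq_mul]
  field_simp
  rw [Real.sq_sqrt h0.le]

/-- A unit vector `v` can be completed to an orthonormal basis `(v, e, v × e)`, in which `v × ·`
is the rotation by a right angle of the plane spanned by `e` and `v × e`. -/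
theorem exists_adapted_frame (g : SmoothMetric 3 P) (o : ManifoldOrientation 3 P) (p : P)
    (v : TangentSpace (𝓡 3) p) (hv : g.inner p v v = 1) :
    ∃ e e' : TangentSpace (𝓡 3) p, g.inner p v e = 0 ∧ g.inner p e e = 1 ∧
      g.inner p v e' = 0 ∧ g.inner p e' e' = 1 ∧ g.inner p e e' = 0 ∧
      tangentCross g o p v e = e' ∧ tangentCross g o p v e' = -e ∧
      ∀ X, X = g.inner p v X • v + g.inner p e X • e + g.inner p e' X • e' := by
  obtain ⟨e, he, he1⟩ := exists_unit_orthogonal g o p v hv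
  have h1 : g.inner p (tangentCross g o p v e) (tangentCross g o p v e) = 1 := by
    rw [inner_tangentCross_self, hv, he1, he]
    norm_num
  have h2 : g.inner p v (tangentCross g o p v e) = 0 :=
    (g.symm _ _ _).trans (inner_tangentCross g o p v e)
  have h3 : g.inner p e (tangentCross g o p v e) = 0 := by
    rw [inner_eq_dotProduct g o, equivFun_tangentCross, dot_cross_self]
  refine ⟨e, tangentCross g o p v e, he, he1, h2, h1, h3, rfl,
    tangentCross_tangentCross g o p v e hv ((g.symm _ _ _).trans he), fun X => ?_⟩
  obtain ⟨b, hb, -⟩ := isPositiveBasis_tangentCross g o p v e (by rw [h1]; norm_num)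
  have hX : X = b.repr X 0 • v + b.repr X 1 • e + b.repr X 2 • tangentCross g o p v e := by
    conv_lhs => rw [← b.sum_repr X]
    simp [Fin.sum_univ_three, hb]
  have hs := g.symm p
  have c0 : g.inner p v X = b.repr X 0 := by
    conv_lhs => rw [hX]
    simp [hv, he, h2]
  have c1 : g.inner p e X = b.repr X 1 := by
    conv_lhs => rw [hX]
    simp [he1, hs e v, he, h3]
  have c2 : g.inner p (tangentCross g o p v e) X = b.repr X 2 := by
    conv_lhs => rw [hX]
    simp [h1, hs _ v, h2, hs _ e, h3]
  rw [c0, c1, c2]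
  exact hX

end AdaptedFrames

/-! ### The rotation induced on the base -/

section FibreRotation

variable {P M : Type*} [TopologicalSpace P] [ChartedSpace (EuclideanSpace ℝ (Fin 3)) P]
  [IsManifold (𝓡 3) ∞ P] [TopologicalSpace M] [ChartedSpace (EuclideanSpace ℝ (Fin 2)) M]
  [IsManifold (𝓡 2) ∞ M]
  (g : SmoothMetric 3 P) (oP : ManifoldOrientation 3 P) (oM : ManifoldOrientation 2 M)
  (f : P → M) (hsub : ∀ p, Surjective (mfderiv (𝓡 3) (𝓡 2) f p))

theorem mfderiv_unitFibreField (p : P) :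
    mfderiv (𝓡 3) (𝓡 2) f p (unitFibreField g oP oM f hsub p) = 0 :=
  (unitFibreField_spec g oP oM f hsub p).1

theorem inner_unitFibreField_self (p : P) :
    g.inner p (unitFibreField g oP oM f hsub p) (unitFibreField g oP oM f hsub p) = 1 :=
  (unitFibreField_spec g oP oM f hsub p).2.1

theorem unitFibreField_ne_zero (p : P) : unitFibreField g oP oM f hsub p ≠ 0 := by
  intro h
  have := inner_unitFibreField_self g oP oM f hsub p
  rw [h] at this
  simp at this

theorem exists_eq_smul_unitFibreField (p : P) (k : TangentSpace (𝓡 3) p)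
    (hk : mfderiv (𝓡 3) (𝓡 2) f p k = 0) : ∃ s : ℝ, k = s • unitFibreField g oP oM f hsub p :=
  exists_smul_of_mem_kernel (finrank_tangent p) (finrank_tangent (f p))
    (mfderiv (𝓡 3) (𝓡 2) f p).toLinearMap (hsub p) _ (mfderiv_unitFibreField g oP oM f hsub p)
    (unitFibreField_ne_zero g oP oM f hsub p) k hk

theorem mem_orthogonal_ker_mfderiv_iff (p : P) (X : TangentSpace (𝓡 3) p) :
    X ∈ (metricForm g p).orthogonal (LinearMap.ker (mfderiv (𝓡 3) (𝓡 2) f p).toLinearMap) ↔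
      g.inner p (unitFibreField g oP oM f hsub p) X = 0 := by
  constructor
  · intro h
    exact h _ (mfderiv_unitFibreField g oP oM f hsub p)
  · intro h k hk
    obtain ⟨s, rfl⟩ := exists_eq_smul_unitFibreField g oP oM f hsub p k hk
    change g.inner p (s • _) X = 0
    simp [h]

theorem mfderiv_sub_smul_unitFibreField (p : P) (X : TangentSpace (𝓡 3) p) (s : ℝ) :
    mfderiv (𝓡 3) (𝓡 2) f p (X - s • unitFibreField g oP oM f hsub p) =
      mfderiv (𝓡 3) (𝓡 2) f p X := by
  simp [mfderiv_unitFibreField]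

/-- The right-handed rotation of the horizontal plane becomes a rotation in the positive sense
of the base. -/
theorem isPositiveBasis_mfderiv_tangentCross (p : P) (X : TangentSpace (𝓡 3) p)
    (hX : mfderiv (𝓡 3) (𝓡 2) f p X ≠ 0) :
    IsPositiveBasis (oM.at_point (f p)) ![mfderiv (𝓡 3) (𝓡 2) f p X, mfderiv (𝓡 3) (𝓡 2) f p
      (tangentCross g oP p (unitFibreField g oP oM f hsub p) X)] := by
  obtain ⟨-, hT, hpos⟩ := unitFibreField_spec g oP oM f hsub p
  have hLT := mfderiv_unitFibreField g oP oM f hsub p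
  have hker := exists_eq_smul_unitFibreField g oP oM f hsub p
  set T := unitFibreField g oP oM f hsub p with hTdef
  set L := mfderiv (𝓡 3) (𝓡 2) f p with hL
  set Y := tangentCross g oP p T X with hY
  have hTY : g.inner p T Y = 0 := (g.symm _ _ _).trans (inner_tangentCross g oP p T X)
  have hXY : g.inner p X Y = 0 := by
    rw [inner_eq_dotProduct g oP, hY, equivFun_tangentCross, dot_cross_self]
  have hYY : 0 < g.inner p Y Y := by
    refine g.pos p Y fun h0 => hX ?_
    have h1 := inner_tangentCross_self g oP p T X
    rw [← hY, h0, hT] at h1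
    have h2 : X - g.inner p T X • T = 0 := by
      by_contra hne
      have h3 := g.pos p _ hne
      simp only [map_sub, map_smul, sub_apply, smul_apply, smul_eq_mul, hT, g.symm p X T] at h3
      simp at h1
      nlinarith
    rw [sub_eq_zero.1 h2, map_smul, hLT, smul_zero]
  have hli : LinearIndependent ℝ ![L X, L Y] := by
    rw [LinearIndependent.pair_iff]
    intro a b hab
    rw [← map_smul, ← map_smul, ← map_add] at hab
    obtain ⟨s, hs⟩ := hker _ hab
    have hb : b = 0 := by
      have := congrArg (fun Z => g.inner p Z Y) hs
      simp only [map_add, map_smul, add_apply, smul_apply, hXY, hTY, smul_eq_mul, mul_zero,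
        zero_add] at this
      exact (mul_eq_zero.1 this).resolve_right hYY.ne'
    refine ⟨?_, hb⟩
    subst hb
    by_contra ha
    apply hX
    simp only [zero_smul, add_zero, map_smul] at hab
    exact (smul_eq_zero.1 hab).resolve_left ha
  let b := basisOfLinearIndependentOfCardEqFinrank hli (by simp [finrank_tangent])
  have hb : ⇑b = ![L X, L Y] := coe_basisOfLinearIndependentOfCardEqFinrank _ _
  rcases eq_or_ne b.orientation (oM.at_point (f p)) with h | h
  · exact ⟨b, hb, h⟩
  -- Otherwise `(df X, df (-Y))` is positive, hence so is `(T, X, -Y)`; but `(T, X, Y)` is positive.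
  · exfalso
    have hneg : IsPositiveBasis (oM.at_point (f p)) ![L X, L (-Y)] := by
      obtain ⟨bW, hbW⟩ : ∃ bW : Module.Basis (Fin 2) ℝ (TangentSpace (𝓡 2) (f p)),
          bW.orientation = oM.at_point (f p) :=
        ⟨(oM.at_point (f p)).someBasis (by simp [finrank_tangent]),
          (oM.at_point (f p)).someBasis_orientation _⟩
      rw [← hbW, isPositiveBasis_iff_det_pos]
      have h1 : bW.det ![L X, L (-Y)] = - bW.det ![L X, L Y] := by
        rw [Module.Basis.det_apply, Module.Basis.det_apply, Matrix.det_fin_two, Matrix.det_fin_two]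
        simp [Module.Basis.toMatrix_apply]
        ring
      rw [h1, ← hb]
      have h2 : bW.det b ≠ 0 := (bW.isUnit_det b).ne_zero
      have h3 : ¬ 0 < bW.det b := fun h3 =>
        h (by rw [← hbW]; exact ((bW.orientation_eq_iff_det_pos b).2 h3).symm)
      rcases lt_or_gt_of_ne h2 with h4 | h4
      · linarith
      · exact absurd h4 h3
    have h5 := hpos X (-Y) hneg
    have h6 := isPositiveBasis_tangentCross g oP p T X hYY
    refine h6.not_update_neg 2 ?_
    convert h5 using 1
    funext i
    fin_cases i <;> rfl

/-- Vectors with the same image under `df` differ by a multiple of `T`, which `T × ·` kills. -/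
theorem exists_fibreRotation (p : P) :
    ∃ A : TangentSpace (𝓡 2) (f p) →L[ℝ] TangentSpace (𝓡 2) (f p), ∀ X,
      A (mfderiv (𝓡 3) (𝓡 2) f p X) = mfderiv (𝓡 3) (𝓡 2) f p
        (tangentCross g oP p (unitFibreField g oP oM f hsub p) X) := by
  obtain ⟨S, hS⟩ := (mfderiv (𝓡 3) (𝓡 2) f p).toLinearMap.exists_rightInverse_of_surjective
    (LinearMap.range_eq_top.2 (hsub p))
  have : T2Space (TangentSpace (𝓡 2) (f p)) :=
    inferInstanceAs (T2Space (EuclideanSpace ℝ (Fin 2)))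
  refine ⟨LinearMap.toContinuousLinearMap ((mfderiv (𝓡 3) (𝓡 2) f p).toLinearMap ∘ₗ
    tangentCross g oP p (unitFibreField g oP oM f hsub p) ∘ₗ S), fun X => ?_⟩
  have h : mfderiv (𝓡 3) (𝓡 2) f p (S (mfderiv (𝓡 3) (𝓡 2) f p X) - X) = 0 := by
    rw [map_sub, sub_eq_zero]
    exact LinearMap.congr_fun hS _
  obtain ⟨s, hs⟩ := exists_eq_smul_unitFibreField g oP oM f hsub p _ h
  rw [sub_eq_iff_eq_add] at hs
  change mfderiv (𝓡 3) (𝓡 2) f p (tangentCross g oP p (unitFibreField g oP oM f hsub p)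
    (S (mfderiv (𝓡 3) (𝓡 2) f p X))) = _
  rw [hs, map_add, map_smul, tangentCross_self, smul_zero, zero_add]

/-- The complex structure which the rotation `T × ·` of the horizontal plane at `p` induces on the
tangent plane of the base at `f p`: the endomorphism `A` with `A (df X) = df (T × X)`. -/
def fibreRotation (p : P) : TangentSpace (𝓡 2) (f p) →L[ℝ] TangentSpace (𝓡 2) (f p) :=
  (exists_fibreRotation g oP oM f hsub p).choose

theorem fibreRotation_mfderiv (p : P) (X : TangentSpace (𝓡 3) p) :
    fibreRotation g oP oM f hsub p (mfderiv (𝓡 3) (𝓡 2) f p X) = mfderiv (𝓡 3) (𝓡 2) f p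
      (tangentCross g oP p (unitFibreField g oP oM f hsub p) X) :=
  (exists_fibreRotation g oP oM f hsub p).choose_spec X

theorem fibreRotation_fibreRotation (p : P) (u : TangentSpace (𝓡 2) (f p)) :
    fibreRotation g oP oM f hsub p (fibreRotation g oP oM f hsub p u) = -u := by
  obtain ⟨X, rfl⟩ := hsub p u
  have hT := inner_unitFibreField_self g oP oM f hsub p
  -- Replace `X` by its horizontal part, where `T × ·` squares to `-1`.
  rw [← mfderiv_sub_smul_unitFibreField g oP oM f hsub p X
    (g.inner p (unitFibreField g oP oM f hsub p) X), fibreRotation_mfderiv, fibreRotation_mfderiv,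
    tangentCross_tangentCross _ _ _ _ _ hT, map_neg]
  rw [g.symm]
  simp [hT]

theorem isPositiveBasis_fibreRotation (p : P) (u : TangentSpace (𝓡 2) (f p)) (hu : u ≠ 0) :
    IsPositiveBasis (oM.at_point (f p)) ![u, fibreRotation g oP oM f hsub p u] := by
  obtain ⟨X, rfl⟩ := hsub p u
  rw [fibreRotation_mfderiv]
  exact isPositiveBasis_mfderiv_tangentCross g oP oM f hsub p X hu

/-- The differential of `f` on the horizontal plane is conformal for the complex structure
`fibreRotation`: it maps an orthonormal basis `(e, T × e)` to a basis `(u, A u)`, which is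
orthogonal with vectors of equal length for every Hermitian inner product. -/
theorem isHermitianInner_fibreRotation_scaling (p : P)
    (b : LinearMap.BilinForm ℝ (TangentSpace (𝓡 2) (f p)))
    (hb : IsHermitianInner (fibreRotation g oP oM f hsub p) b) :
    ∃ r : ℝ, 0 < r ∧ ∀ X Y : TangentSpace (𝓡 3) p,
      g.inner p (unitFibreField g oP oM f hsub p) X = 0 →
      g.inner p (unitFibreField g oP oM f hsub p) Y = 0 →
      b (mfderiv (𝓡 3) (𝓡 2) f p X) (mfderiv (𝓡 3) (𝓡 2) f p Y) = r * g.inner p X Y := by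
  obtain ⟨e, e', h1, h2, h3, h4, h5, h6, h7, h8⟩ := exists_adapted_frame g oP p _
    (inner_unitFibreField_self g oP oM f hsub p)
  set A := fibreRotation g oP oM f hsub p with hA
  set L := mfderiv (𝓡 3) (𝓡 2) f p with hL
  have hAe : A (L e) = L e' := by rw [← h6]; exact fibreRotation_mfderiv g oP oM f hsub p e
  have hAe' : A (L e') = -L e := by
    rw [← map_neg, ← h7]; exact fibreRotation_mfderiv g oP oM f hsub p e'
  have hb1 : b (L e') (L e') = b (L e) (L e) := by
    have := hb.hermitian (L e) (L e)
    rwa [hAe] at this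
  have hb2 : b (L e) (L e') = 0 := by
    have := hb.hermitian (L e) (L e')
    rw [hAe, hAe', map_neg, hb.symm (L e')] at this
    linarith
  have hb3 : b (L e') (L e) = 0 := (hb.symm _ _).trans hb2
  refine ⟨b (L e) (L e), hb.pos _ fun h0 => ?_, fun X Y hX hY => ?_⟩
  · obtain ⟨s, hs⟩ := exists_eq_smul_unitFibreField g oP oM f hsub p e h0
    rw [hs] at h1 h2
    rw [map_smul, inner_unitFibreField_self] at h1
    simp only [smul_eq_mul, mul_one] at h1
    rw [h1] at h2
    simp at h2
  · rw [h8 X, h8 Y, hX, hY]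
    simp only [zero_smul, zero_add, map_add, map_smul, add_apply, smul_apply, LinearMap.add_apply,
      LinearMap.smul_apply, smul_eq_mul, hb1, hb2, hb3, h2, h4, h5, g.symm p e' e]
    ring

/-- If `df` is conformal for a positive complex structure `A`, then `A` is the rotation induced
by `T × ·`: a horizontal lift of `A (df X)` has the length of `X` and is perpendicular to it,
which determines it up to sign, and the sign is given by the orientation. -/
theorem eq_fibreRotation_of_conformal (p : P)
    (A : TangentSpace (𝓡 2) (f p) →L[ℝ] TangentSpace (𝓡 2) (f p)) (hsq : ∀ u, A (A u) = -u)
    (hpos : ∀ u, u ≠ 0 → IsPositiveBasis (oM.at_point (f p)) ![u, A u])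
    (hconf : ∀ b : LinearMap.BilinForm ℝ (TangentSpace (𝓡 2) (f p)), IsHermitianInner A b →
      ∃ r : ℝ, 0 < r ∧
        ∀ X ∈ (metricForm g p).orthogonal (LinearMap.ker (mfderiv (𝓡 3) (𝓡 2) f p).toLinearMap),
        ∀ Y ∈ (metricForm g p).orthogonal (LinearMap.ker (mfderiv (𝓡 3) (𝓡 2) f p).toLinearMap),
          b (mfderiv (𝓡 3) (𝓡 2) f p X) (mfderiv (𝓡 3) (𝓡 2) f p Y) = r * g.inner p X Y) :
    A = fibreRotation g oP oM f hsub p := by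
  let i : TangentSpace (𝓡 2) (f p) →ₗ[ℝ] EuclideanSpace ℝ (Fin 2) := LinearMap.id
  let B : LinearMap.BilinForm ℝ (EuclideanSpace ℝ (Fin 2)) := innerₗ (EuclideanSpace ℝ (Fin 2))
  -- A Hermitian inner product for `A`: the average of the Euclidean one and its pullback by `A`.
  let b : LinearMap.BilinForm ℝ (TangentSpace (𝓡 2) (f p)) :=
    B.comp i i + B.comp (i ∘ₗ A.toLinearMap) (i ∘ₗ A.toLinearMap)
  have hbdef : ∀ u v, b u v = inner ℝ (i u) (i v) + inner ℝ (i (A u)) (i (A v)) :=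
    fun u v => rfl
  have hb : IsHermitianInner A b := by
    refine ⟨fun u v => ?_, fun u hu => ?_, fun u v => ?_⟩
    · rw [hbdef, hbdef, real_inner_comm, real_inner_comm (i (A v))]
    · rw [hbdef]
      have h1 : 0 < inner ℝ (i u) (i u) := real_inner_self_pos.2 hu
      have h2 : 0 ≤ inner ℝ (i (A u)) (i (A u)) := real_inner_self_nonneg
      linarith
    · rw [hbdef, hbdef, hsq, hsq, map_neg, map_neg, inner_neg_neg, add_comm]
  obtain ⟨r, hr, hconf⟩ := hconf b hb
  simp only [mem_orthogonal_ker_mfderiv_iff g oP oM f hsub] at hconf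
  obtain ⟨e, e', h1, h2, h3, h4, h5, h6, h7, h8⟩ := exists_adapted_frame g oP p _
    (inner_unitFibreField_self g oP oM f hsub p)
  have hLT := mfderiv_unitFibreField g oP oM f hsub p
  set R := fibreRotation g oP oM f hsub p with hR
  set L := mfderiv (𝓡 3) (𝓡 2) f p with hL
  have hRe : R (L e) = L e' := by rw [← h6]; exact fibreRotation_mfderiv g oP oM f hsub p e
  have hRe' : R (L e') = -L e := by
    rw [← map_neg, ← h7]; exact fibreRotation_mfderiv g oP oM f hsub p e'
  have hspan : ∀ u, ∃ x y : ℝ, u = x • L e + y • L e' := by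
    intro u
    obtain ⟨X, rfl⟩ := hsub p u
    refine ⟨g.inner p e X, g.inner p e' X, ?_⟩
    change L X = _
    conv_lhs => rw [h8 X]
    rw [map_add, map_add, map_smul, map_smul, map_smul, hLT, smul_zero, zero_add]
  have b1 : b (L e) (L e) = r := by rw [hconf e h1 e h1, h2, mul_one]
  have b2 : b (L e) (L e') = 0 := by rw [hconf e h1 e' h3, h5, mul_zero]
  have b3 : b (L e') (L e') = r := by rw [hconf e' h3 e' h3, h4, mul_one]
  obtain ⟨x, y, hxy⟩ := hspan (A (L e))
  have c1 : b (A (L e)) (L e) = 0 := by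
    have := hb.hermitian (A (L e)) (L e)
    rw [hsq, map_neg, LinearMap.neg_apply, hb.symm (L e)] at this
    linarith
  have c2 := hb.hermitian (L e) (L e)
  rw [hxy] at c1 c2
  simp only [map_add, map_smul, LinearMap.add_apply, LinearMap.smul_apply, smul_eq_mul,
    hb.symm (L e') (L e), b1, b2, b3, mul_zero, add_zero, zero_add] at c1 c2
  have hx : x = 0 := (mul_eq_zero.1 c1).resolve_right hr.ne'
  rw [hx] at c2 hxy
  have hy : y = 1 ∨ y = -1 := by
    have h : (y - 1) * (y + 1) * r = 0 := by linarith
    rcases mul_eq_zero.1 ((mul_eq_zero.1 h).resolve_right hr.ne') with h | h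
    · exact Or.inl (by linarith)
    · exact Or.inr (by linarith)
  have hLe : L e ≠ 0 := by
    intro h
    rw [h] at b1
    simp at b1
    exact hr.ne b1
  have hy1 : y = 1 := by
    refine hy.resolve_right fun hy1 => ?_
    have p1 := hpos (L e) hLe
    have p2 := isPositiveBasis_fibreRotation g oP oM f hsub p (L e) hLe
    refine p2.not_update_neg 1 ?_
    convert p1 using 1
    funext i
    fin_cases i
    · rfl
    · change -(R (L e)) = A (L e)
      rw [hxy, hRe, hy1]
      simp
  have hAe : A (L e) = L e' := by rw [hxy, hy1]; simp
  have hAe' : A (L e') = -L e := by rw [← hAe, hsq]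
  ext1 u
  obtain ⟨x, y, rfl⟩ := hspan u
  rw [map_add, map_add, map_smul, map_smul, map_smul, map_smul, hAe, hAe', hRe, hRe']

end FibreRotation

/-! ### Gradients of functions annihilated by a vector field, in coordinates -/

section CoordinateComputation

variable {E : Type*} [NormedAddCommGroup E] [NormedSpace ℝ E]

theorem fderiv_clm_apply_apply {F : Type*} [NormedAddCommGroup F] [NormedSpace ℝ F]
    {A : E → E →L[ℝ] F} {b : E → E} {x : E} (hA : DifferentiableAt ℝ A x)
    (hb : DifferentiableAt ℝ b x) (w : E) :
    fderiv ℝ (fun y => A y (b y)) x w = fderiv ℝ A x w (b x) + A x (fderiv ℝ b x w) := by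
  rw [fderiv_clm_apply hA hb]
  simp [add_comm]

/-- The Hessian identity `D²φ(T, w) = -dφ(D_w T)` for a function `φ` annihilated by `T`. -/
theorem fderiv_fderiv_of_annihilated {φ : E → ℝ} {T : E → E} {x : E} (hφ : ContDiffAt ℝ 2 φ x)
    (hT : DifferentiableAt ℝ T x) (hφT : ∀ᶠ y in 𝓝 x, fderiv ℝ φ y (T y) = 0) (w : E) :
    fderiv ℝ (fderiv ℝ φ) x (T x) w = - fderiv ℝ φ x (fderiv ℝ T x w) := by
  have hd : DifferentiableAt ℝ (fderiv ℝ φ) x :=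
    (hφ.fderiv_right (m := 1) (by norm_num)).differentiableAt (by norm_num)
  have h1 : fderiv ℝ (fun y => fderiv ℝ φ y (T y)) x w = 0 := by
    rw [Filter.EventuallyEq.fderiv_eq (f := fun _ => (0 : ℝ)) hφT]
    simp
  rw [fderiv_clm_apply_apply hd hT] at h1
  have h2 : IsSymmSndFDerivAt ℝ φ x := hφ.isSymmSndFDerivAt (by simp)
  rw [h2.eq (T x) w]
  linarith

/-- The derivative along `T` of the inner product of the gradients `a`, `b` of two functions
annihilated by `T` is minus the Lie derivative of the metric along `T`, evaluated on `a`
and `b`. -/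
theorem fderiv_inner_gradient {G : E → E →L[ℝ] E →L[ℝ] ℝ} {φ ψ : E → ℝ} {T a b : E → E} {x : E}
    (hG : DifferentiableAt ℝ G x) (hGs : ∀ᶠ y in 𝓝 x, ∀ v w, G y v w = G y w v)
    (hφ : ContDiffAt ℝ 2 φ x) (hψ : ContDiffAt ℝ 2 ψ x) (hT : DifferentiableAt ℝ T x)
    (hb : DifferentiableAt ℝ b x)
    (haφ : ∀ᶠ y in 𝓝 x, G y (a y) = fderiv ℝ φ y) (hbψ : ∀ᶠ y in 𝓝 x, G y (b y) = fderiv ℝ ψ y)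
    (hφT : ∀ᶠ y in 𝓝 x, fderiv ℝ φ y (T y) = 0) (hψT : ∀ᶠ y in 𝓝 x, fderiv ℝ ψ y (T y) = 0) :
    fderiv ℝ (fun y => G y (a y) (b y)) x (T x) =
      -(G x (a x) (fderiv ℝ T x (b x)) + G x (b x) (fderiv ℝ T x (a x))
        + fderiv ℝ G x (T x) (a x) (b x)) := by
  have hdφ : DifferentiableAt ℝ (fderiv ℝ φ) x :=
    (hφ.fderiv_right (m := 1) (by norm_num)).differentiableAt (by norm_num)
  have h1 : (fun y => G y (a y) (b y)) =ᶠ[𝓝 x] fun y => fderiv ℝ φ y (b y) := by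
    filter_upwards [haφ] with y hy
    rw [hy]
  have h2 : fderiv ℝ (fderiv ℝ ψ) x (T x) =
      fderiv ℝ G x (T x) (b x) + G x (fderiv ℝ b x (T x)) := by
    rw [← fderiv_clm_apply_apply hG hb]
    exact congrArg (fun A : E →L[ℝ] E →L[ℝ] ℝ => A (T x)) (Filter.EventuallyEq.fderiv_eq hbψ).symm
  have h3 : fderiv ℝ G x (T x) (a x) (b x) = fderiv ℝ G x (T x) (b x) (a x) := by
    have e1 : ∀ v w : E, fderiv ℝ (fun y => G y v w) x (T x) = fderiv ℝ G x (T x) v w := by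
      intro v w
      have := fderiv_clm_apply_apply (F := ℝ) (A := fun y => G y v) (b := fun _ => w)
        (hG.clm_apply (differentiableAt_const v)) (differentiableAt_const w) (T x)
      rw [this, fderiv_clm_apply_apply hG (differentiableAt_const v)]
      simp
    rw [← e1, ← e1]
    congr 1
    apply Filter.EventuallyEq.fderiv_eq
    filter_upwards [hGs] with y hy
    exact hy _ _
  have h4 := DFunLike.congr_fun h2 (a x)
  rw [fderiv_fderiv_of_annihilated hψ hT hψT, add_apply] at h4
  have h5 := fderiv_fderiv_of_annihilated hφ hT hφT (b x)
  rw [h1.fderiv_eq, fderiv_clm_apply_apply hdφ hb, h5, ← haφ.self_of_nhds]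
  rw [← hbψ.self_of_nhds] at h4
  rw [hGs.self_of_nhds (a x) (fderiv ℝ b x (T x)), h3]
  linarith

/-- The identity `Γ(a, t)(b) + Γ(b, t)(a) = ∂_t G(a, b)`, that is, the metric is parallel. -/
theorem inner_add_christoffel {G : E → E →L[ℝ] E →L[ℝ] ℝ} {x : E}
    (hGs : ∀ w a b : E, fderiv ℝ G x w a b = fderiv ℝ G x w b a) (a b t : E) :
    firstChristoffel G x a t b + firstChristoffel G x b t a = fderiv ℝ G x t a b := by
  change (1 / 2 : ℝ) * (fderiv ℝ G x a t b + fderiv ℝ G x t a b - fderiv ℝ G x b a t) +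
    (1 / 2 : ℝ) * (fderiv ℝ G x b t a + fderiv ℝ G x t b a - fderiv ℝ G x a b t) = _
  rw [hGs a b t, hGs b a t, hGs t b a]
  ring

end CoordinateComputation

/-! ### Metric and gradients in a chart -/

section ChartGradient

variable {n : ℕ} {P : Type*} [TopologicalSpace P] [ChartedSpace (EuclideanSpace ℝ (Fin n)) P]

theorem extChartAt_symm_mem_chart_source (p : P) {x : EuclideanSpace ℝ (Fin n)}
    (hx : x ∈ (extChartAt (𝓡 n) p).target) :
    (extChartAt (𝓡 n) p).symm x ∈ (chartAt (EuclideanSpace ℝ (Fin n)) p).source := by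
  have := (extChartAt (𝓡 n) p).map_target hx
  rwa [extChartAt_source] at this

theorem contMDiffAt_of_comp_extChartAt_symm {F : Type*} [NormedAddCommGroup F] [NormedSpace ℝ F]
    {φ : P → F} {p : P}
    (hφ : ContDiffAt ℝ ∞ (φ ∘ (extChartAt (𝓡 n) p).symm) (extChartAt (𝓡 n) p p)) :
    ContMDiffAt (𝓡 n) 𝓘(ℝ, F) ∞ φ p := by
  have h1 : ContMDiffAt (𝓡 n) 𝓘(ℝ, F) ∞
      ((φ ∘ (extChartAt (𝓡 n) p).symm) ∘ extChartAt (𝓡 n) p) p :=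
    hφ.contMDiffAt.comp p contMDiffAt_extChartAt
  refine h1.congr_of_eventuallyEq ?_
  filter_upwards [extChartAt_source_mem_nhds (I := 𝓡 n) p] with q hq
  simp only [comp_apply, (extChartAt (𝓡 n) p).left_inv hq]

variable [IsManifold (𝓡 n) ∞ P]

/-- The tangent vector at the point with coordinates `x` in the chart at `p` that has the
components `v` in this chart. -/
def chartVector (p : P) (x v : EuclideanSpace ℝ (Fin n)) :
    TangentSpace (𝓡 n) ((extChartAt (𝓡 n) p).symm x) :=
  (trivializationAt (EuclideanSpace ℝ (Fin n)) (TangentSpace (𝓡 n) : P → Type _) p).symmL ℝ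
    ((extChartAt (𝓡 n) p).symm x) v

theorem chartMetric_eq_inner_chartVector (g : SmoothMetric n P) (p : P)
    (x v w : EuclideanSpace ℝ (Fin n)) : chartMetric g p x v w =
      g.inner _ (chartVector p x v) (chartVector p x w) := rfl

theorem chartVector_surjective (p : P) {x : EuclideanSpace ℝ (Fin n)}
    (hx : x ∈ (extChartAt (𝓡 n) p).target) : Surjective (chartVector p x) := fun v =>
  ⟨_, (trivializationAt (EuclideanSpace ℝ (Fin n)) (TangentSpace (𝓡 n) : P → Type _) p
    ).symmL_continuousLinearMapAt (R := ℝ) (extChartAt_symm_mem_chart_source p hx) v⟩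

theorem chartVector_injective (p : P) {x : EuclideanSpace ℝ (Fin n)}
    (hx : x ∈ (extChartAt (𝓡 n) p).target) : Injective (chartVector p x) := by
  refine LeftInverse.injective (g := (trivializationAt (EuclideanSpace ℝ (Fin n))
    (TangentSpace (𝓡 n) : P → Type _) p).continuousLinearMapAt ℝ
      ((extChartAt (𝓡 n) p).symm x)) fun v => ?_
  exact (trivializationAt (EuclideanSpace ℝ (Fin n)) (TangentSpace (𝓡 n) : P → Type _) p
    ).continuousLinearMapAt_symmL (R := ℝ) (extChartAt_symm_mem_chart_source p hx) v

theorem mfderiv_chartVector {F : Type*} [NormedAddCommGroup F] [NormedSpace ℝ F] (φ : P → F)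
    (p : P) {x : EuclideanSpace ℝ (Fin n)} (hx : x ∈ (extChartAt (𝓡 n) p).target)
    (hφ : MDifferentiableAt (𝓡 n) 𝓘(ℝ, F) φ ((extChartAt (𝓡 n) p).symm x))
    (v : EuclideanSpace ℝ (Fin n)) :
    mfderiv (𝓡 n) 𝓘(ℝ, F) φ ((extChartAt (𝓡 n) p).symm x) (chartVector p x v) =
      fderiv ℝ (φ ∘ (extChartAt (𝓡 n) p).symm) x v := by
  have h1 : MDifferentiableAt 𝓘(ℝ, EuclideanSpace ℝ (Fin n)) (𝓡 n)
      (extChartAt (𝓡 n) p).symm x :=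
    (((contMDiffOn_extChartAt_symm (I := 𝓡 n) (n := ∞) p) _ hx).contMDiffAt
      ((isOpen_extChartAt_target p).mem_nhds hx)).mdifferentiableAt (by simp)
  have h2 : chartVector p x v = mfderiv 𝓘(ℝ, EuclideanSpace ℝ (Fin n)) (𝓡 n)
      (extChartAt (𝓡 n) p).symm x v := by
    rw [chartVector, TangentBundle.symmL_trivializationAt (extChartAt_symm_mem_chart_source p hx),
      (extChartAt (𝓡 n) p).right_inv hx]
    simp only [modelWithCornersSelf_coe, range_id, mfderivWithin_univ]
    rfl
  rw [h2, ← mfderiv_eq_fderiv]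
  exact (mfderiv_comp_apply x hφ h1 v).symm

theorem chartMetric_contDiffAt (g : SmoothMetric n P) (p : P) :
    ContDiffAt ℝ ∞ (chartMetric g p) (extChartAt (𝓡 n) p p) := by
  have h1 := (contMDiffAt_section (IB := 𝓡 n) (n := ∞)
    (F := EuclideanSpace ℝ (Fin n) →L[ℝ] EuclideanSpace ℝ (Fin n) →L[ℝ] ℝ)
    (E := fun x : P => TangentSpace (𝓡 n) x →L[ℝ] TangentSpace (𝓡 n) x →L[ℝ] ℝ)
    (s := g.inner) p).1 (g.contMDiff p)
  have h2 := ((contMDiffOn_extChartAt_symm (I := 𝓡 n) (n := ∞) p) _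
    (mem_extChartAt_target p)).contMDiffAt (extChartAt_target_mem_nhds p)
  have h4 := (h1.comp_of_eq h2 (extChartAt_to_inv p)).contDiffAt
  refine h4.congr_of_eventuallyEq ?_
  filter_upwards [extChartAt_target_mem_nhds p] with x hx
  have hb : (extChartAt (𝓡 n) p).symm x ∈ (trivializationAt (EuclideanSpace ℝ (Fin n))
      (TangentSpace (𝓡 n) : P → Type _) p).baseSet := extChartAt_symm_mem_chart_source p hx
  ext a b
  rw [chartMetric_apply]
  simp only [comp_apply, hom_trivializationAt_apply]
  have hs : ∀ c : EuclideanSpace ℝ (Fin n),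
      (trivializationAt (EuclideanSpace ℝ (Fin n)) (TangentSpace (𝓡 n) : P → Type _) p).symmL ℝ
        ((extChartAt (𝓡 n) p).symm x) c =
      (trivializationAt (EuclideanSpace ℝ (Fin n)) (TangentSpace (𝓡 n) : P → Type _) p).symm
        ((extChartAt (𝓡 n) p).symm x) c := fun c => Trivialization.symmL_apply _ hb c
  rw [inCoordinates_apply_eq₂ hb hb (mem_univ _), hs, hs]
  simp

theorem chartMetric_symm (g : SmoothMetric n P) (p : P) (x v w : EuclideanSpace ℝ (Fin n)) :
    chartMetric g p x v w = chartMetric g p x w v :=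
  g.symm _ _ _

theorem chartMetric_isInvertible (g : SmoothMetric n P) (p : P) {x : EuclideanSpace ℝ (Fin n)}
    (hx : x ∈ (extChartAt (𝓡 n) p).target) : (chartMetric g p x).IsInvertible := by
  have hinj : Injective (chartMetric g p x).toLinearMap := by
    rw [← LinearMap.ker_eq_bot, LinearMap.ker_eq_bot']
    intro v hv
    by_contra hne
    have h0 : chartVector p x v ≠ 0 := fun h => hne <| chartVector_injective p hx <| by
      rw [h]
      exact (map_zero _).symm
    have h1 := g.pos _ _ h0
    rw [← chartMetric_eq_inner_chartVector] at h1
    have h2 : chartMetric g p x v v = 0 := DFunLike.congr_fun hv v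
    exact h1.ne' h2
  have hfin : Module.finrank ℝ (EuclideanSpace ℝ (Fin n)) =
      Module.finrank ℝ (EuclideanSpace ℝ (Fin n) →L[ℝ] ℝ) := by
    rw [← (LinearMap.toContinuousLinearMap (𝕜 := ℝ) (E := EuclideanSpace ℝ (Fin n))
      (F' := ℝ)).finrank_eq]
    exact Subspace.dual_finrank_eq.symm
  refine ⟨(LinearEquiv.ofInjectiveOfFinrankEq _ hinj hfin).toContinuousLinearEquiv, ?_⟩
  ext v w
  rfl

/-- The gradient of a real function at a point, the vector dual to its differential with respect to
the metric. -/
def metricGradient (g : SmoothMetric n P) (φ : P → ℝ) (p : P) : TangentSpace (𝓡 n) p :=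
  ((metricForm g p).toDual (metricForm_nondegenerate g p)).symm
    (mfderiv (𝓡 n) 𝓘(ℝ, ℝ) φ p).toLinearMap

theorem inner_metricGradient (g : SmoothMetric n P) (φ : P → ℝ) (p : P)
    (X : TangentSpace (𝓡 n) p) :
    g.inner p (metricGradient g φ p) X = mfderiv (𝓡 n) 𝓘(ℝ, ℝ) φ p X :=
  LinearMap.BilinForm.apply_toDual_symm_apply (hB := metricForm_nondegenerate g p) _ _

theorem eq_metricGradient (g : SmoothMetric n P) (φ : P → ℝ) (p : P)
    (Y : TangentSpace (𝓡 n) p)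
    (hY : ∀ X, g.inner p Y X = mfderiv (𝓡 n) 𝓘(ℝ, ℝ) φ p X) : Y = metricGradient g φ p := by
  rw [← sub_eq_zero]
  by_contra h
  have h1 := g.pos p _ h
  have h2 := (hY (Y - metricGradient g φ p)).trans (inner_metricGradient g φ p _).symm
  rw [map_sub (g.inner p) Y, sub_apply, h2, sub_self] at h1
  exact lt_irrefl _ h1

/-- The inner product of the gradients of two functions. -/
def gradientInner (g : SmoothMetric n P) (φ ψ : P → ℝ) (p : P) : ℝ :=
  g.inner p (metricGradient g φ p) (metricGradient g ψ p)

/-- The components of the gradient of `φ` in the chart at `p`, as a function of the coordinates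
of the point. -/
def chartGradient (g : SmoothMetric n P) (φ : P → ℝ) (p : P) (x : EuclideanSpace ℝ (Fin n)) :
    EuclideanSpace ℝ (Fin n) :=
  (chartMetric g p x).inverse (fderiv ℝ (φ ∘ (extChartAt (𝓡 n) p).symm) x)

theorem chartMetric_chartGradient (g : SmoothMetric n P) (φ : P → ℝ) (p : P)
    {x : EuclideanSpace ℝ (Fin n)} (hx : x ∈ (extChartAt (𝓡 n) p).target) :
    chartMetric g p x (chartGradient g φ p x) =
      fderiv ℝ (φ ∘ (extChartAt (𝓡 n) p).symm) x :=
  (chartMetric_isInvertible g p hx).self_apply_inverse _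

theorem chartVector_chartGradient (g : SmoothMetric n P) (φ : P → ℝ) (p : P)
    {x : EuclideanSpace ℝ (Fin n)} (hx : x ∈ (extChartAt (𝓡 n) p).target)
    (hφ : MDifferentiableAt (𝓡 n) 𝓘(ℝ, ℝ) φ ((extChartAt (𝓡 n) p).symm x)) :
    chartVector p x (chartGradient g φ p x) =
      metricGradient g φ ((extChartAt (𝓡 n) p).symm x) := by
  apply eq_metricGradient
  intro X
  obtain ⟨w, rfl⟩ := chartVector_surjective p hx X
  rw [← chartMetric_eq_inner_chartVector, chartMetric_chartGradient g φ p hx,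
    mfderiv_chartVector φ p hx hφ]

theorem contDiffAt_comp_extChartAt_symm {F : Type*} [NormedAddCommGroup F] [NormedSpace ℝ F]
    {φ : P → F} {p : P} (hφ : ContMDiffAt (𝓡 n) 𝓘(ℝ, F) ∞ φ p) :
    ContDiffAt ℝ ∞ (φ ∘ (extChartAt (𝓡 n) p).symm) (extChartAt (𝓡 n) p p) := by
  have h2 := ((contMDiffOn_extChartAt_symm (I := 𝓡 n) (n := ∞) p) _
    (mem_extChartAt_target p)).contMDiffAt (extChartAt_target_mem_nhds p)
  exact (hφ.comp_of_eq h2 (extChartAt_to_inv p)).contDiffAt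

theorem chartGradient_contDiffAt (g : SmoothMetric n P) {φ : P → ℝ} {p : P}
    (hφ : ContMDiffAt (𝓡 n) 𝓘(ℝ, ℝ) ∞ φ p) :
    ContDiffAt ℝ ∞ (chartGradient g φ p) (extChartAt (𝓡 n) p p) := by
  have h1 : ContDiffAt ℝ ∞ (fun x => (chartMetric g p x).inverse) (extChartAt (𝓡 n) p p) :=
    (chartMetric_isInvertible g p (mem_extChartAt_target p)).contDiffAt_map_inverse.comp _
      (chartMetric_contDiffAt g p)
  exact h1.clm_apply ((contDiffAt_comp_extChartAt_symm hφ).fderiv_right (by simp))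

theorem eventually_mdifferentiableAt_symm {φ : P → ℝ} {p : P}
    (hφ : ContMDiffAt (𝓡 n) 𝓘(ℝ, ℝ) ∞ φ p) : ∀ᶠ x in 𝓝 (extChartAt (𝓡 n) p p),
      MDifferentiableAt (𝓡 n) 𝓘(ℝ, ℝ) φ ((extChartAt (𝓡 n) p).symm x) := by
  have h1 : ∀ᶠ q in 𝓝 p, ContMDiffAt (𝓡 n) 𝓘(ℝ, ℝ) 1 φ q :=
    contMDiffAt_iff_contMDiffAt_nhds (by simp) |>.1 (hφ.of_le (by simp))
  have h2 : Filter.Tendsto (extChartAt (𝓡 n) p).symm (𝓝 (extChartAt (𝓡 n) p p)) (𝓝 p) := by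
    have := continuousAt_extChartAt_symm (I := 𝓡 n) p
    rwa [ContinuousAt, extChartAt_to_inv] at this
  filter_upwards [h2.eventually h1] with x hx
  exact hx.mdifferentiableAt (by simp)

theorem gradientInner_eventuallyEq (g : SmoothMetric n P) {φ ψ : P → ℝ} {p : P}
    (hφ : ContMDiffAt (𝓡 n) 𝓘(ℝ, ℝ) ∞ φ p) (hψ : ContMDiffAt (𝓡 n) 𝓘(ℝ, ℝ) ∞ ψ p) :
    gradientInner g φ ψ ∘ (extChartAt (𝓡 n) p).symm =ᶠ[𝓝 (extChartAt (𝓡 n) p p)]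
      fun x => chartMetric g p x (chartGradient g φ p x) (chartGradient g ψ p x) := by
  filter_upwards [extChartAt_target_mem_nhds p, eventually_mdifferentiableAt_symm hφ,
    eventually_mdifferentiableAt_symm hψ] with x hx h1 h2
  rw [chartMetric_eq_inner_chartVector, chartVector_chartGradient g φ p hx h1,
    chartVector_chartGradient g ψ p hx h2]
  rfl

theorem gradientInner_contMDiffAt (g : SmoothMetric n P) {φ ψ : P → ℝ} {p : P}
    (hφ : ContMDiffAt (𝓡 n) 𝓘(ℝ, ℝ) ∞ φ p) (hψ : ContMDiffAt (𝓡 n) 𝓘(ℝ, ℝ) ∞ ψ p) :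
    ContMDiffAt (𝓡 n) 𝓘(ℝ, ℝ) ∞ (gradientInner g φ ψ) p := by
  apply contMDiffAt_of_comp_extChartAt_symm
  refine ContDiffAt.congr_of_eventuallyEq ?_ (gradientInner_eventuallyEq g hφ hψ)
  exact ((chartMetric_contDiffAt g p).clm_apply (chartGradient_contDiffAt g hφ)).clm_apply
    (chartGradient_contDiffAt g hψ)

end ChartGradient

/-! ### The covariant derivative -/

section CovariantDerivative

variable {n : ℕ} {P : Type*} [TopologicalSpace P] [ChartedSpace (EuclideanSpace ℝ (Fin n)) P]

theorem mfderiv_apply_eq_fderiv {φ : P → ℝ} {p : P}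
    (hφ : MDifferentiableAt (𝓡 n) 𝓘(ℝ, ℝ) φ p) (X : TangentSpace (𝓡 n) p) :
    mfderiv (𝓡 n) 𝓘(ℝ, ℝ) φ p X =
      fderiv ℝ (φ ∘ (extChartAt (𝓡 n) p).symm) (extChartAt (𝓡 n) p p) X := by
  have h : fderivWithin ℝ (writtenInExtChartAt (𝓡 n) 𝓘(ℝ, ℝ) p φ) (range (𝓡 n))
      (extChartAt (𝓡 n) p p) =
        fderiv ℝ (φ ∘ (extChartAt (𝓡 n) p).symm) (extChartAt (𝓡 n) p p) := by
    rw [ModelWithCorners.range_eq_univ, fderivWithin_univ]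
    rfl
  rw [hφ.mfderiv]
  exact DFunLike.congr_fun h X

variable [IsManifold (𝓡 n) ∞ P]

/-- The components of a vector field in the chart at `p`, as a function of the coordinates. -/
def fieldInChart (V : ∀ q : P, TangentSpace (𝓡 n) q) (p : P) (x : EuclideanSpace ℝ (Fin n)) :
    EuclideanSpace ℝ (Fin n) :=
  (trivializationAt (EuclideanSpace ℝ (Fin n)) (TangentSpace (𝓡 n) : P → Type _) p
    ⟨(extChartAt (𝓡 n) p).symm x, V ((extChartAt (𝓡 n) p).symm x)⟩).2

theorem chartVector_fieldInChart (V : ∀ q : P, TangentSpace (𝓡 n) q) (p : P)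
    {x : EuclideanSpace ℝ (Fin n)} (hx : x ∈ (extChartAt (𝓡 n) p).target) :
    chartVector p x (fieldInChart V p x) = V ((extChartAt (𝓡 n) p).symm x) := by
  have h := (trivializationAt (EuclideanSpace ℝ (Fin n)) (TangentSpace (𝓡 n) : P → Type _) p
    ).symmL_continuousLinearMapAt (R := ℝ) (extChartAt_symm_mem_chart_source p hx)
    (V ((extChartAt (𝓡 n) p).symm x))
  rw [Trivialization.continuousLinearMapAt_apply,
    Trivialization.linearMapAt_apply, if_pos (show _ ∈ (trivializationAt _ _ p).baseSet from
      extChartAt_symm_mem_chart_source p hx)] at h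
  exact h

theorem contMDiffAt_vectorField_iff (V : ∀ q : P, TangentSpace (𝓡 n) q) (p : P) :
    ContMDiffAt (𝓡 n) (𝓡 n).tangent ∞ (fun q => (⟨q, V q⟩ : TangentBundle (𝓡 n) P)) p ↔
      ContDiffAt ℝ ∞ (fieldInChart V p) (extChartAt (𝓡 n) p p) := by
  have h := contMDiffAt_section (IB := 𝓡 n) (n := ∞) (F := EuclideanSpace ℝ (Fin n))
    (E := (TangentSpace (𝓡 n) : P → Type _)) (s := V) p
  exact h.trans ⟨contDiffAt_comp_extChartAt_symm, fun h => contMDiffAt_of_comp_extChartAt_symm h⟩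

theorem fieldInChart_self (V : ∀ q : P, TangentSpace (𝓡 n) q) (p : P) :
    fieldInChart V p (extChartAt (𝓡 n) p p) = V p := by
  have h : ∀ q, q = p → (trivializationAt (EuclideanSpace ℝ (Fin n))
      (TangentSpace (𝓡 n) : P → Type _) p ⟨q, V q⟩).2 = V p := by
    rintro q rfl
    exact (tangentBundleCore (𝓡 n) P).coordChange_self _ _ (mem_chart_source _ _) _
  exact h _ (extChartAt_to_inv p)

theorem tangentCoord_mfderiv_section {V : ∀ q : P, TangentSpace (𝓡 n) q} {p : P}
    (hV : ContMDiffAt (𝓡 n) (𝓡 n).tangent ∞ (fun q => (⟨q, V q⟩ : TangentBundle (𝓡 n) P)) p)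
    (X : TangentSpace (𝓡 n) p) :
    tangentCoord (⟨p, V p⟩ : TangentBundle (𝓡 n) P) (mfderiv (𝓡 n) (𝓡 n).tangent
      (fun q => (⟨q, V q⟩ : TangentBundle (𝓡 n) P)) p X) =
      (X, fderiv ℝ (fieldInChart V p) (extChartAt (𝓡 n) p p) X) := by
  have hd := ((contMDiffAt_vectorField_iff V p).1 hV).differentiableAt (by simp)
  have h : HasMFDerivAt (𝓡 n) (𝓡 n).tangent (fun q => (⟨q, V q⟩ : TangentBundle (𝓡 n) P)) p
      ((ContinuousLinearMap.id ℝ (EuclideanSpace ℝ (Fin n))).prod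
        (fderiv ℝ (fieldInChart V p) (extChartAt (𝓡 n) p p))) := by
    refine ⟨hV.continuousAt, HasFDerivAt.hasFDerivWithinAt ?_⟩
    refine ((hasFDerivAt_id _).prodMk hd.hasFDerivAt).congr_of_eventuallyEq ?_
    filter_upwards [extChartAt_target_mem_nhds p] with x hx
    refine Prod.ext ?_ rfl
    exact (extChartAt (𝓡 n) p).right_inv hx
  rw [h.mfderiv]
  rfl

/-- The covariant derivative `X ↦ ∇_X V` at `p` for the Levi-Civita connection: the connection map
applied to the differential of `V`, regarded as a map to the tangent bundle. It is meaningful if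
`V` is differentiable at `p`. -/
def covDeriv (g : SmoothMetric n P) (V : ∀ q : P, TangentSpace (𝓡 n) q) (p : P) :
    TangentSpace (𝓡 n) p →ₗ[ℝ] TangentSpace (𝓡 n) p :=
  connectionMap g (⟨p, V p⟩ : TangentBundle (𝓡 n) P) ∘ₗ
    (mfderiv (𝓡 n) (𝓡 n).tangent (fun q => (⟨q, V q⟩ : TangentBundle (𝓡 n) P)) p).toLinearMap

theorem projDeriv_mfderiv_section {V : ∀ q : P, TangentSpace (𝓡 n) q} {p : P}
    (hV : ContMDiffAt (𝓡 n) (𝓡 n).tangent ∞ (fun q => (⟨q, V q⟩ : TangentBundle (𝓡 n) P)) p)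
    (X : TangentSpace (𝓡 n) p) :
    projDeriv (⟨p, V p⟩ : TangentBundle (𝓡 n) P) (mfderiv (𝓡 n) (𝓡 n).tangent
      (fun q => (⟨q, V q⟩ : TangentBundle (𝓡 n) P)) p X) = X := by
  rw [projDeriv_apply, tangentCoord_mfderiv_section hV]

/-- The coordinate formula `∇_X V = D_X V + Γ(X, V)`, paired with a vector `Y`. -/
theorem inner_covDeriv (g : SmoothMetric n P) {V : ∀ q : P, TangentSpace (𝓡 n) q} {p : P}
    (hV : ContMDiffAt (𝓡 n) (𝓡 n).tangent ∞ (fun q => (⟨q, V q⟩ : TangentBundle (𝓡 n) P)) p)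
    (Y X : TangentSpace (𝓡 n) p) :
    g.inner p Y (covDeriv g V p X) =
      chartMetric g p (extChartAt (𝓡 n) p p) Y
        (fderiv ℝ (fieldInChart V p) (extChartAt (𝓡 n) p p) X) +
      firstChristoffel (E := EuclideanSpace ℝ (Fin n)) (chartMetric g p) (extChartAt (𝓡 n) p p)
        X (V p) Y := by
  have h4 : ∀ a b c : TangentSpace (𝓡 n) p,
      g.inner p a (christoffel g p b c) = christoffelForm g p b c a := by
    intro a b c
    rw [g.symm]
    exact LinearMap.BilinForm.apply_toDual_symm_apply
      (hB := metricForm_nondegenerate g p) _ _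
  let D : TangentSpace (𝓡 n) p := fderiv ℝ (fieldInChart V p) (extChartAt (𝓡 n) p p) X
  have h5 : covDeriv g V p X = D + christoffel g p X (V p) := by
    change connectionMap g (⟨p, V p⟩ : TangentBundle (𝓡 n) P) (mfderiv (𝓡 n) (𝓡 n).tangent
      (fun q => (⟨q, V q⟩ : TangentBundle (𝓡 n) P)) p X) = _
    have h6 : ∀ Z, connectionMap g (⟨p, V p⟩ : TangentBundle (𝓡 n) P) Z =
      (tangentCoord (⟨p, V p⟩ : TangentBundle (𝓡 n) P) Z).2 +
        christoffel g p (tangentCoord (⟨p, V p⟩ : TangentBundle (𝓡 n) P) Z).1 (V p) := by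
      intro Z
      rw [← projDeriv_apply]
      simp [connectionMap]
    rw [h6, tangentCoord_mfderiv_section hV]
  rw [h5, map_add, h4]
  congr 1
  exact (chartMetric_self g p _ _).symm

theorem chartGradient_self (g : SmoothMetric n P) {φ : P → ℝ} {p : P}
    (hφ : MDifferentiableAt (𝓡 n) 𝓘(ℝ, ℝ) φ p) :
    chartGradient g φ p (extChartAt (𝓡 n) p p) = metricGradient g φ p := by
  refine eq_metricGradient g φ p _ fun X => ?_
  refine (chartMetric_self g p _ _).symm.trans ?_
  rw [chartMetric_chartGradient g φ p (mem_extChartAt_target p)]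
  exact (mfderiv_apply_eq_fderiv hφ X).symm

/-- For functions annihilated by the vector field `V`, the derivative along `V` of the inner
product of their gradients is minus the symmetrised covariant derivative of `V`, that is the Lie
derivative of the metric along `V`, evaluated on the gradients. -/
theorem mfderiv_gradientInner (g : SmoothMetric n P) {V : ∀ q : P, TangentSpace (𝓡 n) q} {p : P}
    (hV : ContMDiffAt (𝓡 n) (𝓡 n).tangent ∞ (fun q => (⟨q, V q⟩ : TangentBundle (𝓡 n) P)) p)
    {φ ψ : P → ℝ} (hφ : ContMDiffAt (𝓡 n) 𝓘(ℝ, ℝ) ∞ φ p)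
    (hψ : ContMDiffAt (𝓡 n) 𝓘(ℝ, ℝ) ∞ ψ p)
    (hφV : ∀ᶠ q in 𝓝 p, mfderiv (𝓡 n) 𝓘(ℝ, ℝ) φ q (V q) = (0 : ℝ))
    (hψV : ∀ᶠ q in 𝓝 p, mfderiv (𝓡 n) 𝓘(ℝ, ℝ) ψ q (V q) = (0 : ℝ)) :
    mfderiv (𝓡 n) 𝓘(ℝ, ℝ) (gradientInner g φ ψ) p (V p) =
      (-(g.inner p (metricGradient g φ p) (covDeriv g V p (metricGradient g ψ p)) +
        g.inner p (metricGradient g ψ p) (covDeriv g V p (metricGradient g φ p))) : ℝ) := by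
  have hd := ((contMDiffAt_vectorField_iff V p).1 hV).differentiableAt (by simp)
  have hG := (chartMetric_contDiffAt g p).differentiableAt (by simp)
  have hself := fieldInChart_self V p
  have hann : ∀ χ : P → ℝ, ContMDiffAt (𝓡 n) 𝓘(ℝ, ℝ) ∞ χ p →
      (∀ᶠ q in 𝓝 p, mfderiv (𝓡 n) 𝓘(ℝ, ℝ) χ q (V q) = (0 : ℝ)) →
      ∀ᶠ x in 𝓝 (extChartAt (𝓡 n) p p), fderiv ℝ (χ ∘ (extChartAt (𝓡 n) p).symm) x
        (fieldInChart V p x) = 0 := by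
    intro χ hχ h
    have h2 : Filter.Tendsto (extChartAt (𝓡 n) p).symm (𝓝 (extChartAt (𝓡 n) p p)) (𝓝 p) := by
      have := continuousAt_extChartAt_symm (I := 𝓡 n) p
      rwa [ContinuousAt, extChartAt_to_inv] at this
    filter_upwards [h2.eventually h, extChartAt_target_mem_nhds p,
      eventually_mdifferentiableAt_symm hχ] with x hx hxt hxd
    rw [← mfderiv_chartVector χ p hxt hxd, chartVector_fieldInChart V p hxt, hx]
  have hgr : ∀ χ : P → ℝ, ∀ᶠ x in 𝓝 (extChartAt (𝓡 n) p p),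
      chartMetric g p x (chartGradient g χ p x) = fderiv ℝ (χ ∘ (extChartAt (𝓡 n) p).symm) x := by
    intro χ
    filter_upwards [extChartAt_target_mem_nhds p] with x hx
    exact chartMetric_chartGradient g χ p hx
  have key := fderiv_inner_gradient hG
    (Filter.Eventually.of_forall fun x v w => chartMetric_symm g p x v w)
    ((contDiffAt_comp_extChartAt_symm hφ).of_le (WithTop.coe_le_coe.2 (le_top (a := (2 : ℕ∞)))))
    ((contDiffAt_comp_extChartAt_symm hψ).of_le (WithTop.coe_le_coe.2 (le_top (a := (2 : ℕ∞))))) hd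
    ((chartGradient_contDiffAt g hψ).differentiableAt (by simp))
    (hgr φ) (hgr ψ) (hann φ hφ hφV) (hann ψ hψ hψV)
  have hGs : ∀ w a b, fderiv ℝ (chartMetric g p) (extChartAt (𝓡 n) p p) w a b =
      fderiv ℝ (chartMetric g p) (extChartAt (𝓡 n) p p) w b a := by
    intro w a b
    have e1 : ∀ v u, fderiv ℝ (fun y => chartMetric g p y v u) (extChartAt (𝓡 n) p p) w =
        fderiv ℝ (chartMetric g p) (extChartAt (𝓡 n) p p) w v u := by
      intro v u
      rw [fderiv_clm_apply_apply (hG.clm_apply (differentiableAt_const v))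
        (differentiableAt_const u), fderiv_clm_apply_apply hG (differentiableAt_const v)]
      simp
    rw [← e1, ← e1]
    simp only [chartMetric_symm g p _ a b]
  have hmd := (gradientInner_contMDiffAt g hφ hψ).mdifferentiableAt (by simp)
  rw [mfderiv_apply_eq_fderiv hmd, (gradientInner_eventuallyEq g hφ hψ).fderiv_eq,
    inner_covDeriv g hV, inner_covDeriv g hV]
  rw [hself, chartGradient_self g (hφ.mdifferentiableAt (by simp)),
    chartGradient_self g (hψ.mdifferentiableAt (by simp))] at key
  have hch := inner_add_christoffel (G := chartMetric g p) (x := extChartAt (𝓡 n) p p) hGs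
    (metricGradient g φ p) (metricGradient g ψ p) (V p)
  refine key.trans ?_
  linarith

end CovariantDerivative

/-! ### Orientations in charts -/

section Orientations

theorem isPositiveBasis_map {V W : Type*} [AddCommGroup V] [Module ℝ V] [AddCommGroup W]
    [Module ℝ W] {n : ℕ} (e : V ≃ₗ[ℝ] W) (o : Orientation ℝ V (Fin n)) (v : Fin n → V) :
    IsPositiveBasis (Orientation.map (Fin n) e o) (fun i => e (v i)) ↔ IsPositiveBasis o v := by
  constructor
  · rintro ⟨b, hb, ho⟩
    refine ⟨b.map e.symm, ?_, ?_⟩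
    · funext i
      simp [hb]
    · apply (Orientation.map (Fin n) e).injective
      rw [← Module.Basis.orientation_map, ← ho]
      congr 1
      ext i
      simp
  · rintro ⟨b, rfl, rfl⟩
    exact ⟨b.map e, by funext i; simp, Module.Basis.orientation_map b e⟩

theorem exists_sign_isPositiveBasis_iff {V : Type*} [AddCommGroup V] [Module ℝ V] {n : ℕ}
    (b : Module.Basis (Fin n) ℝ V) (o : Orientation ℝ V (Fin n)) :
    ∃ c : ℝ, (c = 1 ∨ c = -1) ∧ ∀ v : Fin n → V, IsPositiveBasis o v ↔ 0 < c * b.det v := by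
  rcases b.orientation_eq_or_eq_neg o with rfl | rfl
  · exact ⟨1, Or.inl rfl, fun v => by rw [one_mul, isPositiveBasis_iff_det_pos]⟩
  · refine ⟨-1, Or.inr rfl, fun v => ⟨?_, fun h => ?_⟩⟩
    · rintro ⟨e, rfl, he⟩
      have h1 : b.det e ≠ 0 := (b.isUnit_det e).ne_zero
      have h2 : ¬ 0 < b.det e := fun h => by
        rw [← b.orientation_eq_iff_det_pos e, he] at h
        exact Module.Ray.ne_neg_self _ h
      have h3 := lt_of_le_of_ne (not_lt.1 h2) h1
      linarith
    · have h0 : b.det v ≠ 0 := by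
        intro h0
        rw [h0] at h
        simp at h
      obtain ⟨h1, h2⟩ := (Module.Basis.is_basis_iff_det b).2 (isUnit_iff_ne_zero.2 h0)
      refine ⟨Module.Basis.mk h1 h2.ge, by simp, ?_⟩
      refine (b.orientation_ne_iff_eq_neg _).1 fun h3 => ?_
      have h4 := (b.orientation_eq_iff_det_pos _).1 h3.symm
      simp only [Module.Basis.coe_mk] at h4
      linarith

variable {n : ℕ} {M : Type*} [TopologicalSpace M] [ChartedSpace (EuclideanSpace ℝ (Fin n)) M]
  [IsManifold (𝓡 n) ∞ M]

/-- The components of tangent vectors at `y` in the chart at `y₀`; meaningful if `y` lies in the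
domain of the chart. -/
def tangentComponents (y₀ y : M) : TangentSpace (𝓡 n) y →L[ℝ] EuclideanSpace ℝ (Fin n) :=
  (trivializationAt (EuclideanSpace ℝ (Fin n)) (TangentSpace (𝓡 n) : M → Type _)
    y₀).continuousLinearMapAt ℝ y

/-- The determinant of the components of `n` tangent vectors in a chart. -/
def chartDet (y₀ y : M) (v : Fin n → TangentSpace (𝓡 n) y) : ℝ :=
  Matrix.det (Matrix.of fun i j => tangentComponents y₀ y (v j) i)

/-- Near `y₀` an orientation is given by the sign of the determinant in the chart at `y₀`, up to a
sign that does not depend on the point. -/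
theorem exists_sign_chartDet (o : ManifoldOrientation n M) (y₀ : M) :
    ∃ c : ℝ, (c = 1 ∨ c = -1) ∧ ∀ᶠ y in 𝓝 y₀, ∀ v : Fin n → TangentSpace (𝓡 n) y,
      IsPositiveBasis (o.at_point y) v ↔ 0 < c * chartDet y₀ y v := by
  obtain ⟨s, hs⟩ := o.locallyConstant y₀
  obtain ⟨c, hc, h⟩ := exists_sign_isPositiveBasis_iff
    (EuclideanSpace.basisFun (Fin n) ℝ).toBasis s
  refine ⟨c, hc, ?_⟩
  filter_upwards [hs, (chartAt (EuclideanSpace ℝ (Fin n)) y₀).open_source.mem_nhds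
    (mem_chart_source _ y₀)] with y hy hy' v
  have hb : y ∈ (trivializationAt (EuclideanSpace ℝ (Fin n))
    (TangentSpace (𝓡 n) : M → Type _) y₀).baseSet := hy'
  rw [← isPositiveBasis_map ((trivializationAt (EuclideanSpace ℝ (Fin n))
    (TangentSpace (𝓡 n) : M → Type _) y₀).continuousLinearEquivAt ℝ y hb).toLinearEquiv, hy hb, h]
  refine Iff.of_eq (congrArg (fun r => 0 < c * r) ?_)
  rw [Module.Basis.det_apply, chartDet]
  congr 1
  ext i j
  simp only [Module.Basis.toMatrix_apply, Matrix.of_apply, tangentComponents]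
  rw [OrthonormalBasis.coe_toBasis_repr_apply, EuclideanSpace.basisFun_repr]
  exact congrArg (fun w : EuclideanSpace ℝ (Fin n) => w i) (congrFun
    ((trivializationAt (EuclideanSpace ℝ (Fin n)) (TangentSpace (𝓡 n) : M → Type _)
      y₀).coe_continuousLinearEquivAt_eq (R := ℝ) hb) (v j))

end Orientations

/-! ### Coordinates of the base as functions on the total space -/

section BaseCoordinates

variable {P M : Type*} [TopologicalSpace P] [ChartedSpace (EuclideanSpace ℝ (Fin 3)) P]
  [TopologicalSpace M] [ChartedSpace (EuclideanSpace ℝ (Fin 2)) M] [IsManifold (𝓡 2) ∞ M]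

/-- The pullback to `P` of the `i`-th coordinate function of the chart at `y₀`. -/
def baseCoord (f : P → M) (y₀ : M) (i : Fin 2) (q : P) : ℝ :=
  extChartAt (𝓡 2) y₀ (f q) i

theorem baseCoord_contMDiffAt {f : P → M} (hf : ContMDiff (𝓡 3) (𝓡 2) ∞ f) {y₀ : M} {q : P}
    (hq : f q ∈ (chartAt (EuclideanSpace ℝ (Fin 2)) y₀).source) (i : Fin 2) :
    ContMDiffAt (𝓡 3) 𝓘(ℝ, ℝ) ∞ (baseCoord f y₀ i) q := by
  have h1 : ContMDiffAt (𝓡 3) 𝓘(ℝ, EuclideanSpace ℝ (Fin 2)) ∞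
      (fun q => extChartAt (𝓡 2) y₀ (f q)) q :=
    ContMDiffAt.comp q (contMDiffAt_extChartAt' (I := 𝓡 2) (n := ∞) hq) (hf q)
  exact (EuclideanSpace.proj (𝕜 := ℝ) i).contDiff.contMDiff.contMDiffAt.comp q h1

theorem mfderiv_baseCoord {f : P → M} (hf : ContMDiff (𝓡 3) (𝓡 2) ∞ f) {y₀ : M} {q : P}
    (hq : f q ∈ (chartAt (EuclideanSpace ℝ (Fin 2)) y₀).source) (i : Fin 2)
    (X : TangentSpace (𝓡 3) q) :
    mfderiv (𝓡 3) 𝓘(ℝ, ℝ) (baseCoord f y₀ i) q X =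
      tangentComponents y₀ (f q) (mfderiv (𝓡 3) (𝓡 2) f q X) i := by
  have h0 : MDifferentiableAt (𝓡 2) 𝓘(ℝ, EuclideanSpace ℝ (Fin 2)) (extChartAt (𝓡 2) y₀) (f q) :=
    (contMDiffAt_extChartAt' (I := 𝓡 2) (n := ∞) hq).mdifferentiableAt (by simp)
  have h2 : HasMFDerivAt (𝓡 3) 𝓘(ℝ, EuclideanSpace ℝ (Fin 2))
      (fun q => extChartAt (𝓡 2) y₀ (f q)) q
      ((mfderiv (𝓡 2) 𝓘(ℝ, EuclideanSpace ℝ (Fin 2)) (extChartAt (𝓡 2) y₀) (f q)).comp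
        (mfderiv (𝓡 3) (𝓡 2) f q)) :=
    HasMFDerivAt.comp q h0.hasMFDerivAt ((hf q).mdifferentiableAt (by simp)).hasMFDerivAt
  have h3 : HasMFDerivAt (𝓡 3) 𝓘(ℝ, ℝ) (baseCoord f y₀ i) q
      ((EuclideanSpace.proj (𝕜 := ℝ) i : EuclideanSpace ℝ (Fin 2) →L[ℝ] ℝ).comp
        ((mfderiv (𝓡 2) 𝓘(ℝ, EuclideanSpace ℝ (Fin 2)) (extChartAt (𝓡 2) y₀) (f q)).comp
        (mfderiv (𝓡 3) (𝓡 2) f q))) :=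
    HasMFDerivAt.comp q
      (EuclideanSpace.proj (𝕜 := ℝ) i : EuclideanSpace ℝ (Fin 2) →L[ℝ] ℝ).hasMFDerivAt h2
  rw [h3.mfderiv, tangentComponents, TangentBundle.continuousLinearMapAt_trivializationAt hq]
  rfl

theorem tangentComponents_surjective {n : ℕ} {M : Type*} [TopologicalSpace M]
    [ChartedSpace (EuclideanSpace ℝ (Fin n)) M] [IsManifold (𝓡 n) ∞ M] {y₀ y : M}
    (hy : y ∈ (chartAt (EuclideanSpace ℝ (Fin n)) y₀).source) :
    Surjective (tangentComponents (n := n) y₀ y) := fun v =>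
  ⟨_, (trivializationAt (EuclideanSpace ℝ (Fin n)) (TangentSpace (𝓡 n) : M → Type _) y₀
    ).continuousLinearMapAt_symmL (R := ℝ) hy v⟩

theorem tangentComponents_injective {n : ℕ} {M : Type*} [TopologicalSpace M]
    [ChartedSpace (EuclideanSpace ℝ (Fin n)) M] [IsManifold (𝓡 n) ∞ M] {y₀ y : M}
    (hy : y ∈ (chartAt (EuclideanSpace ℝ (Fin n)) y₀).source) :
    Injective (tangentComponents (n := n) y₀ y) :=
  LeftInverse.injective (g := (trivializationAt (EuclideanSpace ℝ (Fin n))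
    (TangentSpace (𝓡 n) : M → Type _) y₀).symmL ℝ y) fun v =>
      (trivializationAt (EuclideanSpace ℝ (Fin n)) (TangentSpace (𝓡 n) : M → Type _) y₀
        ).symmL_continuousLinearMapAt (R := ℝ) hy v

end BaseCoordinates

/-! ### Smoothness of the unit fibre field -/

section SmoothFibreField

/-- The vector whose components are the cross product of the components of two covectors; it spans
the common kernel of the two covectors if they are linearly independent. -/
def covectorCross (a b : EuclideanSpace ℝ (Fin 3) →L[ℝ] ℝ) : EuclideanSpace ℝ (Fin 3) :=
  WithLp.toLp 2 (crossProduct (fun k => a (EuclideanSpace.single k 1))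
    (fun k => b (EuclideanSpace.single k 1)))

theorem clm_apply_eq_sum_three (a : EuclideanSpace ℝ (Fin 3) →L[ℝ] ℝ)
    (X : EuclideanSpace ℝ (Fin 3)) :
    a X = X 0 * a (EuclideanSpace.single 0 1) + X 1 * a (EuclideanSpace.single 1 1) +
      X 2 * a (EuclideanSpace.single 2 1) := by
  have h : X = X 0 • EuclideanSpace.single 0 1 + X 1 • EuclideanSpace.single 1 1 +
      X 2 • EuclideanSpace.single 2 1 := by
    ext i
    fin_cases i <;> simp
  conv_lhs => rw [h]
  simp

theorem apply_covectorCross (a b : EuclideanSpace ℝ (Fin 3) →L[ℝ] ℝ) :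
    a (covectorCross a b) = 0 ∧ b (covectorCross a b) = 0 := by
  rw [clm_apply_eq_sum_three a, clm_apply_eq_sum_three b]
  simp only [covectorCross, cross_apply, Matrix.cons_val_zero, Matrix.cons_val_one,
    Matrix.cons_val]
  constructor <;> ring

theorem det_covectorCross (a b : EuclideanSpace ℝ (Fin 3) →L[ℝ] ℝ)
    (X Y : EuclideanSpace ℝ (Fin 3)) :
    Matrix.det (Matrix.of fun i j => (![covectorCross a b, X, Y] j : EuclideanSpace ℝ (Fin 3)) i) =
      a X * b Y - a Y * b X := by
  rw [clm_apply_eq_sum_three a X, clm_apply_eq_sum_three b X, clm_apply_eq_sum_three a Y,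
    clm_apply_eq_sum_three b Y, Matrix.det_fin_three]
  simp only [covectorCross, cross_apply, Matrix.cons_val_zero, Matrix.cons_val_one,
    Matrix.cons_val, Matrix.of_apply]
  ring

theorem covectorCross_contDiffAt {E : Type*} [NormedAddCommGroup E] [NormedSpace ℝ E]
    {a b : E → EuclideanSpace ℝ (Fin 3) →L[ℝ] ℝ} {x : E} (ha : ContDiffAt ℝ ∞ a x)
    (hb : ContDiffAt ℝ ∞ b x) : ContDiffAt ℝ ∞ (fun y => covectorCross (a y) (b y)) x := by
  have h1 : ∀ k : Fin 3, ContDiffAt ℝ ∞ (fun y => a y (EuclideanSpace.single k 1)) x :=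
    fun k => ha.clm_apply contDiffAt_const
  have h2 : ∀ k : Fin 3, ContDiffAt ℝ ∞ (fun y => b y (EuclideanSpace.single k 1)) x :=
    fun k => hb.clm_apply contDiffAt_const
  rw [contDiffAt_euclidean]
  intro i
  simp only [covectorCross, cross_apply]
  fin_cases i
  · exact ((h1 1).mul (h2 2)).sub ((h1 2).mul (h2 1))
  · exact ((h1 2).mul (h2 0)).sub ((h1 0).mul (h2 2))
  · exact ((h1 0).mul (h2 1)).sub ((h1 1).mul (h2 0))

variable {P M : Type*} [TopologicalSpace P] [ChartedSpace (EuclideanSpace ℝ (Fin 3)) P]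
  [IsManifold (𝓡 3) ∞ P] [TopologicalSpace M] [ChartedSpace (EuclideanSpace ℝ (Fin 2)) M]
  [IsManifold (𝓡 2) ∞ M]

theorem chartDet_chartVector (p : P) {x : EuclideanSpace ℝ (Fin 3)}
    (hx : x ∈ (extChartAt (𝓡 3) p).target) (t X Y : EuclideanSpace ℝ (Fin 3)) :
    chartDet p ((extChartAt (𝓡 3) p).symm x)
      ![chartVector p x t, chartVector p x X, chartVector p x Y] =
    Matrix.det (Matrix.of fun i j => (![t, X, Y] j : EuclideanSpace ℝ (Fin 3)) i) := by
  have h : ∀ v, tangentComponents p ((extChartAt (𝓡 3) p).symm x) (chartVector p x v) = v :=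
    fun v => (trivializationAt (EuclideanSpace ℝ (Fin 3)) (TangentSpace (𝓡 3) : P → Type _) p
      ).continuousLinearMapAt_symmL (R := ℝ) (extChartAt_symm_mem_chart_source p hx) v
  rw [chartDet]
  congr 1
  ext i j
  fin_cases j <;> exact congrArg (fun w : EuclideanSpace ℝ (Fin 3) => w i) (h _)

/-- The unit fibre field is smooth: in a chart it is the normalised cross product of the
differentials of the two coordinates of `f`, up to a sign which the orientations force to be
locally constant. -/
theorem unitFibreField_contMDiffAt (g : SmoothMetric 3 P) (oP : ManifoldOrientation 3 P)
    (oM : ManifoldOrientation 2 M) {f : P → M} (hf : ContMDiff (𝓡 3) (𝓡 2) ∞ f)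
    (hsub : ∀ p, Surjective (mfderiv (𝓡 3) (𝓡 2) f p)) (p : P) :
    ContMDiffAt (𝓡 3) (𝓡 3).tangent ∞
      (fun q => (⟨q, unitFibreField g oP oM f hsub q⟩ : TangentBundle (𝓡 3) P)) p := by
  rw [contMDiffAt_vectorField_iff]
  obtain ⟨cP, hcP, hP⟩ := exists_sign_chartDet oP p
  obtain ⟨cM, hcM, hM⟩ := exists_sign_chartDet oM (f p)
  have hsrc : ∀ᶠ q in 𝓝 p, f q ∈ (chartAt (EuclideanSpace ℝ (Fin 2)) (f p)).source :=
    hf.continuous.continuousAt.eventually ((chartAt (EuclideanSpace ℝ (Fin 2))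
      (f p)).open_source.mem_nhds (mem_chart_source _ (f p)))
  have hsymm : Filter.Tendsto (extChartAt (𝓡 3) p).symm (𝓝 (extChartAt (𝓡 3) p p)) (𝓝 p) := by
    have := continuousAt_extChartAt_symm (I := 𝓡 3) p
    rwa [ContinuousAt, extChartAt_to_inv] at this
  let a : Fin 2 → EuclideanSpace ℝ (Fin 3) → EuclideanSpace ℝ (Fin 3) →L[ℝ] ℝ := fun i x =>
    fderiv ℝ (baseCoord f (f p) i ∘ (extChartAt (𝓡 3) p).symm) x
  have ha : ∀ i, ContDiffAt ℝ ∞ (a i) (extChartAt (𝓡 3) p p) := fun i =>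
    (contDiffAt_comp_extChartAt_symm (baseCoord_contMDiffAt hf (mem_chart_source _ _) i)
      ).fderiv_right (by simp)
  let t : EuclideanSpace ℝ (Fin 3) → EuclideanSpace ℝ (Fin 3) :=
    fun x => covectorCross (a 0 x) (a 1 x)
  have ht : ContDiffAt ℝ ∞ t (extChartAt (𝓡 3) p p) := covectorCross_contDiffAt (ha 0) (ha 1)
  -- The relation between the field `T` and the cross product `t`, at a point near `p`.
  have key : ∀ᶠ x in 𝓝 (extChartAt (𝓡 3) p p), 0 < chartMetric g p x (t x) (t x) ∧
      fieldInChart (unitFibreField g oP oM f hsub) p x =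
        (cP * cM * (Real.sqrt (chartMetric g p x (t x) (t x)))⁻¹) • t x := by
    filter_upwards [extChartAt_target_mem_nhds p, hsymm.eventually hP, hsymm.eventually hsrc,
      hsymm.eventually (hf.continuous.continuousAt.eventually hM)] with x hx hPx hsrcx hMx
    set q := (extChartAt (𝓡 3) p).symm x with hq
    obtain ⟨hT0, hT1, hTpos⟩ := unitFibreField_spec g oP oM f hsub q
    have hVT := chartVector_fieldInChart (unitFibreField g oP oM f hsub) p hx
    set τ := fieldInChart (unitFibreField g oP oM f hsub) p x with hτ
    have hcoord : ∀ i v, a i x v =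
        tangentComponents (f p) (f q) (mfderiv (𝓡 3) (𝓡 2) f q (chartVector p x v)) i := by
      intro i v
      rw [← mfderiv_baseCoord hf hsrcx]
      exact (mfderiv_chartVector _ p hx ((baseCoord_contMDiffAt hf hsrcx i).mdifferentiableAt
        (by simp)) v).symm
    have hdf : mfderiv (𝓡 3) (𝓡 2) f q (chartVector p x (t x)) = 0 := by
      apply tangentComponents_injective hsrcx
      rw [map_zero]
      ext i
      rw [← hcoord]
      fin_cases i
      · exact (apply_covectorCross _ _).1
      · exact (apply_covectorCross _ _).2
    obtain ⟨s, hs⟩ := exists_eq_smul_unitFibreField g oP oM f hsub q _ hdf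
    have hts : t x = s • τ := by
      apply chartVector_injective p hx
      rw [hs, ← hVT]
      exact (map_smul _ s τ).symm
    have hGt : chartMetric g p x (t x) (t x) = s ^ 2 := by
      rw [chartMetric_eq_inner_chartVector, hs]
      simp only [map_smul, smul_apply, smul_eq_mul]
      rw [← hq, hT1]
      ring
    obtain ⟨X, hX⟩ : ∃ X, tangentComponents (f p) (f q)
        (mfderiv (𝓡 3) (𝓡 2) f q (chartVector p x X)) = EuclideanSpace.single 0 1 :=
      ((tangentComponents_surjective hsrcx).comp ((hsub q).comp (chartVector_surjective p hx))) _
    obtain ⟨Y, hY⟩ : ∃ Y, tangentComponents (f p) (f q)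
        (mfderiv (𝓡 3) (𝓡 2) f q (chartVector p x Y)) = EuclideanSpace.single 1 cM :=
      ((tangentComponents_surjective hsrcx).comp ((hsub q).comp (chartVector_surjective p hx))) _
    have hcM2 : cM * cM = 1 := by rcases hcM with rfl | rfl <;> norm_num
    have hcP2 : cP * cP = 1 := by rcases hcP with rfl | rfl <;> norm_num
    have hpos := hTpos (chartVector p x X) (chartVector p x Y) (by
      rw [hMx, chartDet, Matrix.det_fin_two]
      simp [hX, hY, hcM2])
    rw [hPx, ← hVT, chartDet_chartVector p hx] at hpos
    have hdet := det_covectorCross (a 0 x) (a 1 x) X Y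
    have hdet' : a 0 x X * a 1 x Y - a 0 x Y * a 1 x X = cM := by
      simp [hcoord, hX, hY]
    rw [hdet'] at hdet
    have hdets : Matrix.det (Matrix.of fun i j =>
        (![t x, X, Y] j : EuclideanSpace ℝ (Fin 3)) i) =
        s * Matrix.det (Matrix.of fun i j => (![τ, X, Y] j : EuclideanSpace ℝ (Fin 3)) i) := by
      rw [hts, Matrix.det_fin_three, Matrix.det_fin_three]
      simp only [Matrix.of_apply, Matrix.cons_val_zero, Matrix.cons_val_one, Matrix.cons_val,
        PiLp.smul_apply, smul_eq_mul]
      ring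
    change Matrix.det (Matrix.of fun i j => (![t x, X, Y] j : EuclideanSpace ℝ (Fin 3)) i) = cM
      at hdet
    rw [hdets] at hdet
    set D := Matrix.det (Matrix.of fun i j => (![τ, X, Y] j : EuclideanSpace ℝ (Fin 3)) i) with hD
    have hs0 : s ≠ 0 := by
      rintro rfl
      rw [zero_mul] at hdet
      rw [← hdet] at hcM2
      norm_num at hcM2
    have hspos : 0 < cP * cM * s := by
      have h1 : cP * cM * s = s ^ 2 * (cP * D) := by rw [← hdet]; ring
      rw [h1]
      positivity
    have hsqrt : Real.sqrt (chartMetric g p x (t x) (t x)) = cP * cM * s := by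
      rw [hGt, ← Real.sqrt_sq hspos.le]
      congr 1
      linear_combination (-s ^ 2 * cM * cM) * hcP2 - s ^ 2 * hcM2
    refine ⟨by rw [hGt]; positivity, ?_⟩
    rw [hsqrt, hts, smul_smul]
    have hne : cP * cM ≠ 0 := left_ne_zero_of_mul hspos.ne'
    have : cP * cM * (cP * cM * s)⁻¹ * s = 1 := by
      rw [mul_inv (cP * cM), ← mul_assoc, mul_inv_cancel₀ hne, one_mul, inv_mul_cancel₀ hs0]
    rw [this, one_smul]
  have hG : ContDiffAt ℝ ∞ (fun x => chartMetric g p x (t x) (t x)) (extChartAt (𝓡 3) p p) :=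
    ((chartMetric_contDiffAt g p).clm_apply ht).clm_apply ht
  have h0 := key.self_of_nhds.1
  refine ContDiffAt.congr_of_eventuallyEq ?_ (key.mono fun x hx => hx.2)
  exact (contDiffAt_const.mul ((hG.sqrt h0.ne').inv (Real.sqrt_pos.2 h0).ne')).smul ht

end SmoothFibreField

/-! ### Rates of change of symmetric matrices up to scale -/

section ConformalRatios

theorem firstChristoffel_self {E : Type*} [NormedAddCommGroup E] [NormedSpace ℝ E]
    {G : E → E →L[ℝ] E →L[ℝ] ℝ} {x : E} (a t : E) :
    firstChristoffel G x a t t = (1 / 2 : ℝ) * fderiv ℝ G x a t t := by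
  change (1 / 2 : ℝ) * (fderiv ℝ G x a t t + fderiv ℝ G x t a t - fderiv ℝ G x t a t) = _
  ring

theorem fderiv_inner_self_of_const {E : Type*} [NormedAddCommGroup E] [NormedSpace ℝ E]
    {G : E → E →L[ℝ] E →L[ℝ] ℝ} {T : E → E} {x : E} {c : ℝ} (hG : DifferentiableAt ℝ G x)
    (hGs : ∀ v w, G x v w = G x w v) (hT : DifferentiableAt ℝ T x)
    (hc : ∀ᶠ y in 𝓝 x, G y (T y) (T y) = c) (w : E) :
    G x (T x) (fderiv ℝ T x w) = -((1 / 2 : ℝ) * fderiv ℝ G x w (T x) (T x)) := by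
  have h : fderiv ℝ (fun y => G y (T y) (T y)) x w = 0 := by
    rw [Filter.EventuallyEq.fderiv_eq (f := fun _ => c) hc]
    simp
  rw [fderiv_clm_apply_apply (hG.clm_apply hT) hT, fderiv_clm_apply_apply hG hT, add_apply,
    hGs (fderiv ℝ T x w)] at h
  linarith

/-- The entries of a symmetric 2 × 2 matrix function of positive determinant change at a common
logarithmic rate if and only if their quotients by the square root of the determinant are
stationary: the division removes the common scale. -/
theorem exists_rate_iff_deriv_ratio {k : Fin 2 → Fin 2 → ℝ → ℝ} {k' N' : Fin 2 → Fin 2 → ℝ}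
    (hk : ∀ i j, HasDerivAt (k i j) (k' i j) 0)
    (hD : 0 < k 0 0 0 * k 1 1 0 - k 0 1 0 ^ 2)
    (hN : ∀ i j, HasDerivAt
      (fun t => k i j t / Real.sqrt (k 0 0 t * k 1 1 t - k 0 1 t ^ 2)) (N' i j) 0) :
    (∃ r : ℝ, ∀ i j, k' i j = r * k i j 0) ↔ ∀ i j, N' i j = 0 := by
  have hD' := ((hk 0 0).mul (hk 1 1)).sub ((hk 0 1).pow 2)
  have hs := hD'.sqrt hD.ne'
  set D := k 0 0 0 * k 1 1 0 - k 0 1 0 ^ 2 with hDdef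
  have hs0 : Real.sqrt D ≠ 0 := (Real.sqrt_pos.2 hD).ne'
  have hNeq : ∀ i j, N' i j = _ := fun i j => (hN i j).unique ((hk i j).div hs hs0)
  constructor
  · rintro ⟨r, hr⟩ i j
    rw [hNeq]
    simp only [hr, Pi.mul_apply, Pi.sub_apply, Pi.pow_apply, ← hDdef]
    have h2 : r * k 0 0 0 * k 1 1 0 + k 0 0 0 * (r * k 1 1 0) -
        ((2 : ℕ) : ℝ) * k 0 1 0 ^ (2 - 1) * (r * k 0 1 0) = 2 * r * Real.sqrt D ^ 2 := by
      rw [Real.sq_sqrt hD.le, hDdef]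
      norm_num
      ring
    rw [h2]
    field_simp
    ring
  · intro h
    obtain ⟨S, hS⟩ : ∃ S, HasDerivAt
        (fun t => Real.sqrt (k 0 0 t * k 1 1 t - k 0 1 t ^ 2)) S 0 := ⟨_, hs⟩
    refine ⟨S / Real.sqrt D, fun i j => ?_⟩
    have h1 := (hN i j).unique ((hk i j).div hS hs0)
    rw [h, eq_comm, div_eq_zero_iff] at h1
    have h2 := sub_eq_zero.1 (h1.resolve_right (pow_ne_zero 2 hs0))
    rw [div_mul_eq_mul_div, eq_div_iff hs0]
    exact h2.trans (mul_comm _ _)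

variable {n : ℕ} {P : Type*} [TopologicalSpace P] [ChartedSpace (EuclideanSpace ℝ (Fin n)) P]

theorem hasDerivAt_along_chart_line {φ : P → ℝ} {p : P}
    (hφ : MDifferentiableAt (𝓡 n) 𝓘(ℝ, ℝ) φ p) (X : EuclideanSpace ℝ (Fin n)) :
    HasDerivAt (fun t : ℝ => φ ((extChartAt (𝓡 n) p).symm (extChartAt (𝓡 n) p p + t • X)))
      (mfderiv (𝓡 n) 𝓘(ℝ, ℝ) φ p X) 0 := by
  have h1 : HasDerivAt (fun t : ℝ => extChartAt (𝓡 n) p p + t • X) X 0 := by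
    simpa using ((hasDerivAt_id (0 : ℝ)).smul_const X).const_add (extChartAt (𝓡 n) p p)
  have h2 : DifferentiableAt ℝ (φ ∘ (extChartAt (𝓡 n) p).symm) (extChartAt (𝓡 n) p p) := by
    have := hφ.differentiableWithinAt_writtenInExtChartAt
    rw [ModelWithCorners.range_eq_univ, differentiableWithinAt_univ] at this
    exact this
  have h3 : HasFDerivAt (φ ∘ (extChartAt (𝓡 n) p).symm)
      (fderiv ℝ (φ ∘ (extChartAt (𝓡 n) p).symm) (extChartAt (𝓡 n) p p))
      (extChartAt (𝓡 n) p p + (0 : ℝ) • X) := by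
    rw [zero_smul, add_zero]
    exact h2.hasFDerivAt
  exact (h3.comp_hasDerivAt 0 h1).congr_deriv (mfderiv_apply_eq_fderiv hφ X).symm

theorem exists_rate_iff_mfderiv_ratio {k : Fin 2 → Fin 2 → P → ℝ} {p : P}
    (hk : ∀ i j, MDifferentiableAt (𝓡 n) 𝓘(ℝ, ℝ) (k i j) p)
    (hD : 0 < k 0 0 p * k 1 1 p - k 0 1 p ^ 2)
    (hN : ∀ i j, MDifferentiableAt (𝓡 n) 𝓘(ℝ, ℝ)
      (fun q => k i j q / Real.sqrt (k 0 0 q * k 1 1 q - k 0 1 q ^ 2)) p)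
    (X : TangentSpace (𝓡 n) p) :
    (∃ r : ℝ, ∀ i j, mfderiv (𝓡 n) 𝓘(ℝ, ℝ) (k i j) p X = (r * k i j p : ℝ)) ↔
      ∀ i j, mfderiv (𝓡 n) 𝓘(ℝ, ℝ)
        (fun q => k i j q / Real.sqrt (k 0 0 q * k 1 1 q - k 0 1 q ^ 2)) p X = (0 : ℝ) := by
  let X' : EuclideanSpace ℝ (Fin n) := X
  have hinv : (extChartAt (𝓡 n) p).symm (extChartAt (𝓡 n) p p + (0 : ℝ) • X') = p := by
    rw [zero_smul, add_zero, extChartAt_to_inv]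
  have key := exists_rate_iff_deriv_ratio
    (k := fun i j t => k i j ((extChartAt (𝓡 n) p).symm (extChartAt (𝓡 n) p p + t • X')))
    (fun i j => hasDerivAt_along_chart_line (hk i j) X')
    (by simpa only [hinv] using hD)
    (fun i j => hasDerivAt_along_chart_line (hN i j) X')
  simp only [hinv] at key
  exact key

end ConformalRatios

/-! ### The CR condition and the induced conformal class -/

section CRCondition

variable {P M : Type*} [TopologicalSpace P] [ChartedSpace (EuclideanSpace ℝ (Fin 3)) P]
  [IsManifold (𝓡 3) ∞ P] [TopologicalSpace M] [ChartedSpace (EuclideanSpace ℝ (Fin 2)) M]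
  [IsManifold (𝓡 2) ∞ M]
  (g : SmoothMetric 3 P) (oP : ManifoldOrientation 3 P) (oM : ManifoldOrientation 2 M)
  {f : P → M}

/-- `g(T, ∇_X T) = 0` since `T` has constant length. -/
theorem inner_covDeriv_unitFibreField (hf : ContMDiff (𝓡 3) (𝓡 2) ∞ f)
    (hsub : ∀ p, Surjective (mfderiv (𝓡 3) (𝓡 2) f p)) (p : P) (X : TangentSpace (𝓡 3) p) :
    g.inner p (unitFibreField g oP oM f hsub p)
      (covDeriv g (unitFibreField g oP oM f hsub) p X) = 0 := by
  have hV := unitFibreField_contMDiffAt g oP oM hf hsub p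
  have hd := ((contMDiffAt_vectorField_iff _ p).1 hV).differentiableAt (by simp)
  have hG := (chartMetric_contDiffAt g p).differentiableAt (by simp)
  have hself := fieldInChart_self (unitFibreField g oP oM f hsub) p
  set τ := fieldInChart (unitFibreField g oP oM f hsub) p with hτ
  have h1 : (fun x => chartMetric g p x (τ x) (τ x)) =ᶠ[𝓝 (extChartAt (𝓡 3) p p)]
      fun _ => (1 : ℝ) := by
    filter_upwards [extChartAt_target_mem_nhds p] with x hx
    rw [chartMetric_eq_inner_chartVector, hτ, chartVector_fieldInChart _ p hx]
    exact inner_unitFibreField_self g oP oM f hsub _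
  have h2 := fderiv_inner_self_of_const hG (chartMetric_symm g p _) hd h1 X
  rw [hself] at h2
  rw [inner_covDeriv g hV]
  exact (congrArg₂ (· + ·) h2 (firstChristoffel_self _ _)).trans (neg_add_cancel _)

/-- Written with the covariant derivative of the unit fibre field `T`, the fibre direction map is
CR holomorphic if and only if `X ↦ ∇_X T` commutes with `T × ·` on `T^⊥`. -/
theorem isCRHolomorphic_iff (hf : ContMDiff (𝓡 3) (𝓡 2) ∞ f)
    (hsub : ∀ p, Surjective (mfderiv (𝓡 3) (𝓡 2) f p)) :
    IsCRHolomorphic (fibredCR g oP oM f hsub) (sphereBundleCR g oP)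
      (fibreDirectionMap g oP oM f hsub) ↔
    ∀ (p : P) (X : TangentSpace (𝓡 3) p), g.inner p (unitFibreField g oP oM f hsub p) X = 0 →
      covDeriv g (unitFibreField g oP oM f hsub) p
        (tangentCross g oP p (unitFibreField g oP oM f hsub p) X) =
      tangentCross g oP p (unitFibreField g oP oM f hsub p)
        (covDeriv g (unitFibreField g oP oM f hsub) p X) := by
  have hV := unitFibreField_contMDiffAt g oP oM hf hsub
  constructor
  · rintro ⟨-, -, -, h⟩ p X hX
    have h1 := (h p X ((mem_orthogonal_ker_mfderiv_iff g oP oM f hsub p X).2 hX)).2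
    have h2 := congrArg (connectionMap g (fibreDirectionMap g oP oM f hsub p)) h1
    refine h2.trans ?_
    exact connectionMap_tangentLift g (fibreDirectionMap g oP oM f hsub p) _ _
  · intro h
    refine ⟨rfl, hV, fun p => inner_unitFibreField_self g oP oM f hsub p, fun p X hX => ⟨?_, ?_⟩⟩
    · refine (mem_sphereBundle_levi g (fibreDirectionMap g oP oM f hsub p) _).2 ⟨?_, ?_⟩
      · exact inner_covDeriv_unitFibreField g oP oM hf hsub p X
      · exact (congrArg _ (projDeriv_mfderiv_section (hV p) X)).trans
          ((mem_orthogonal_ker_mfderiv_iff g oP oM f hsub p X).1 hX)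
    · have h1 := h p X ((mem_orthogonal_ker_mfderiv_iff g oP oM f hsub p X).1 hX)
      rw [← tangentLift_eq g (fibreDirectionMap g oP oM f hsub p) (mfderiv (𝓡 3) (𝓡 3).tangent
        (fibreDirectionMap g oP oM f hsub) p ((fibredCR g oP oM f hsub).J p X))]
      refine congrArg (tangentLift g (fibreDirectionMap g oP oM f hsub p)) (Prod.ext ?_ ?_)
      · exact (projDeriv_mfderiv_section (hV p) _).trans (congrArg (tangentCross g oP p
          (unitFibreField g oP oM f hsub p)) (projDeriv_mfderiv_section (hV p) X).symm)
      · exact h1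

/-- An endomorphism of the plane `v^⊥` is complex linear if and only if its symmetric part is a
multiple of the identity. -/
theorem commutes_tangentCross_iff (p : P) (v : TangentSpace (𝓡 3) p) (hv : g.inner p v v = 1)
    (A : TangentSpace (𝓡 3) p →ₗ[ℝ] TangentSpace (𝓡 3) p) (hA : ∀ X, g.inner p v (A X) = 0) :
    (∀ X, g.inner p v X = 0 → A (tangentCross g oP p v X) = tangentCross g oP p v (A X)) ↔
      ∃ r : ℝ, ∀ X Y, g.inner p v X = 0 → g.inner p v Y = 0 →
        g.inner p X (A Y) + g.inner p Y (A X) = r * g.inner p X Y := by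
  obtain ⟨e, e', h1, h2, h3, h4, h5, h6, h7, h8⟩ := exists_adapted_frame g oP p v hv
  have hAe := h8 (A e)
  have hAe' := h8 (A e')
  rw [hA, zero_smul, zero_add] at hAe hAe'
  set a := g.inner p e (A e) with ha
  set b := g.inner p e' (A e) with hb
  set c := g.inner p e (A e') with hc
  set d := g.inner p e' (A e') with hd
  have h5' := (g.symm p e' e).trans h5
  have hcr : ∀ x y : ℝ, tangentCross g oP p v (x • e + y • e') = x • e' - y • e := by
    intro x y
    rw [map_add, map_smul, map_smul, h6, h7, smul_neg, sub_eq_add_neg]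
  constructor
  · intro h
    have k1 := h e h1
    rw [h6, hAe', hAe, hcr] at k1
    have k2 := congrArg (g.inner p e) k1
    have k3 := congrArg (g.inner p e') k1
    simp only [map_add, map_sub, map_smul, smul_eq_mul, h2, h4, h5, h5'] at k2 k3
    refine ⟨2 * a, fun X Y hX hY => ?_⟩
    have e1 := h8 X
    have e2 := h8 Y
    rw [hX, zero_smul, zero_add] at e1
    rw [hY, zero_smul, zero_add] at e2
    rw [e1, e2]
    simp only [map_add, map_smul, add_apply, smul_apply, smul_eq_mul, h2, h4, h5, h5',
      ← ha, ← hb, ← hc, ← hd]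
    have k2' : c = -b := by linarith
    have k3' : d = a := by linarith
    rw [k2', k3']
    ring
  · rintro ⟨r, hr⟩ X hX
    have k1 := hr e e h1 h1
    have k2 := hr e e' h1 h3
    have k3 := hr e' e' h3 h3
    rw [h2, ← ha] at k1
    rw [h5, ← hc, ← hb] at k2
    rw [h4, ← hd] at k3
    have k2' : c = -b := by linarith
    have k3' : d = a := by linarith
    have e1 := h8 X
    rw [hX, zero_smul, zero_add] at e1
    rw [e1, hcr, map_sub, map_smul, map_smul, map_add, map_smul, map_smul, hAe, hAe', k2', k3',
      map_add, map_smul, map_smul, hcr, hcr]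
    module

/-- The ratios `k_{ij} / √(det k)`, where `k_{ij}` is the inner product of the gradients of the
pullbacks of the `i`-th and `j`-th coordinate functions of the chart at `y₀`. They determine the
conformal class of the inner product that the horizontal plane induces on the tangent plane of
the base. -/
def conformalRatio (f : P → M) (y₀ : M) (i j : Fin 2) (q : P) : ℝ :=
  gradientInner g (baseCoord f y₀ i) (baseCoord f y₀ j) q /
    Real.sqrt (gradientInner g (baseCoord f y₀ 0) (baseCoord f y₀ 0) q *
      gradientInner g (baseCoord f y₀ 1) (baseCoord f y₀ 1) q -
      gradientInner g (baseCoord f y₀ 0) (baseCoord f y₀ 1) q ^ 2)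

theorem mfderiv_baseCoord_unitFibreField (hf : ContMDiff (𝓡 3) (𝓡 2) ∞ f)
    (hsub : ∀ p, Surjective (mfderiv (𝓡 3) (𝓡 2) f p)) {y₀ : M} {q : P}
    (hq : f q ∈ (chartAt (EuclideanSpace ℝ (Fin 2)) y₀).source) (i : Fin 2) :
    mfderiv (𝓡 3) 𝓘(ℝ, ℝ) (baseCoord f y₀ i) q (unitFibreField g oP oM f hsub q) = (0 : ℝ) := by
  rw [mfderiv_baseCoord hf hq, mfderiv_unitFibreField, map_zero]
  rfl

/-- The gradients of the two base coordinates in a frame `(T, e, e')` adapted to the fibres: they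
are combinations `a i • e + b i • e'`, linearly independent since `df` is onto. -/
theorem exists_frame_metricGradient (hf : ContMDiff (𝓡 3) (𝓡 2) ∞ f)
    (hsub : ∀ p, Surjective (mfderiv (𝓡 3) (𝓡 2) f p)) {y₀ : M} {q : P}
    (hq : f q ∈ (chartAt (EuclideanSpace ℝ (Fin 2)) y₀).source) :
    ∃ (e e' : TangentSpace (𝓡 3) q) (a b : Fin 2 → ℝ),
      g.inner q (unitFibreField g oP oM f hsub q) e = 0 ∧ g.inner q e e = 1 ∧
      g.inner q (unitFibreField g oP oM f hsub q) e' = 0 ∧ g.inner q e' e' = 1 ∧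
      g.inner q e e' = 0 ∧
      tangentCross g oP q (unitFibreField g oP oM f hsub q) e = e' ∧
      tangentCross g oP q (unitFibreField g oP oM f hsub q) e' = -e ∧
      (∀ X, X = g.inner q (unitFibreField g oP oM f hsub q) X • unitFibreField g oP oM f hsub q +
        g.inner q e X • e + g.inner q e' X • e') ∧
      (∀ i, metricGradient g (baseCoord f y₀ i) q = a i • e + b i • e') ∧
      (∀ i j, gradientInner g (baseCoord f y₀ i) (baseCoord f y₀ j) q = a i * a j + b i * b j) ∧
      (∀ i X, tangentComponents y₀ (f q) (mfderiv (𝓡 3) (𝓡 2) f q X) i =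
        a i * g.inner q e X + b i * g.inner q e' X) ∧
      a 0 * b 1 - a 1 * b 0 ≠ 0 := by
  obtain ⟨e, e', h1, h2, h3, h4, h5, h6, h7, h8⟩ := exists_adapted_frame g oP q _
    (inner_unitFibreField_self g oP oM f hsub q)
  have h5' := (g.symm q e' e).trans h5
  have hn : ∀ i, metricGradient g (baseCoord f y₀ i) q =
      g.inner q e (metricGradient g (baseCoord f y₀ i) q) • e +
        g.inner q e' (metricGradient g (baseCoord f y₀ i) q) • e' := by
    intro i
    have h := h8 (metricGradient g (baseCoord f y₀ i) q)
    rwa [g.symm q (unitFibreField g oP oM f hsub q), inner_metricGradient,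
      mfderiv_baseCoord_unitFibreField g oP oM hf hsub hq i, zero_smul, zero_add] at h
  have hcomp : ∀ i X, tangentComponents y₀ (f q) (mfderiv (𝓡 3) (𝓡 2) f q X) i =
      g.inner q e (metricGradient g (baseCoord f y₀ i) q) * g.inner q e X +
        g.inner q e' (metricGradient g (baseCoord f y₀ i) q) * g.inner q e' X := by
    intro i X
    rw [← mfderiv_baseCoord hf hq, ← inner_metricGradient g]
    conv_lhs => rw [hn i]
    simp only [map_add, map_smul, add_apply, smul_apply, smul_eq_mul]
  refine ⟨e, e', fun i => g.inner q e (metricGradient g (baseCoord f y₀ i) q),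
    fun i => g.inner q e' (metricGradient g (baseCoord f y₀ i) q), h1, h2, h3, h4, h5, h6, h7, h8,
    hn, fun i j => ?_, hcomp, ?_⟩
  · rw [gradientInner]
    conv_lhs => rw [hn i]
    simp only [map_add, map_smul, add_apply, smul_apply, smul_eq_mul]
  · obtain ⟨X, hX⟩ := ((tangentComponents_surjective hq).comp (hsub q)) (EuclideanSpace.single 0 1)
    obtain ⟨Y, hY⟩ := ((tangentComponents_surjective hq).comp (hsub q)) (EuclideanSpace.single 1 1)
    have x0 := hcomp 0 X
    have x1 := hcomp 1 X
    have y0 := hcomp 0 Y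
    have y1 := hcomp 1 Y
    simp only [comp_apply] at hX hY
    simp only [hX] at x0 x1
    simp only [hY] at y0 y1
    simp at x0 x1 y0 y1
    intro h0
    set a0 := g.inner q e (metricGradient g (baseCoord f y₀ 0) q)
    set a1 := g.inner q e (metricGradient g (baseCoord f y₀ 1) q)
    set b0 := g.inner q e' (metricGradient g (baseCoord f y₀ 0) q)
    set b1 := g.inner q e' (metricGradient g (baseCoord f y₀ 1) q)
    have : (1 : ℝ) = (a0 * b1 - a1 * b0) *
        (g.inner q e X * g.inner q e' Y - g.inner q e Y * g.inner q e' X) := by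
      linear_combination (a1 * g.inner q e Y + b1 * g.inner q e' Y) * x0 + y1 -
        (a1 * g.inner q e X + b1 * g.inner q e' X) * y0
    change a0 * b1 - a1 * b0 = 0 at h0
    rw [h0, zero_mul] at this
    exact one_ne_zero this

theorem gradientInner_det_pos (oP : ManifoldOrientation 3 P)
    (oM : ManifoldOrientation 2 M) (hf : ContMDiff (𝓡 3) (𝓡 2) ∞ f)
    (hsub : ∀ p, Surjective (mfderiv (𝓡 3) (𝓡 2) f p)) {y₀ : M} {q : P}
    (hq : f q ∈ (chartAt (EuclideanSpace ℝ (Fin 2)) y₀).source) :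
    0 < gradientInner g (baseCoord f y₀ 0) (baseCoord f y₀ 0) q *
      gradientInner g (baseCoord f y₀ 1) (baseCoord f y₀ 1) q -
      gradientInner g (baseCoord f y₀ 0) (baseCoord f y₀ 1) q ^ 2 := by
  obtain ⟨e, e', a, b, -, -, -, -, -, -, -, -, -, hk, -, h0⟩ :=
    exists_frame_metricGradient g oP oM hf hsub hq
  rw [hk, hk, hk]
  have : (a 0 * a 0 + b 0 * b 0) * (a 1 * a 1 + b 1 * b 1) - (a 0 * a 1 + b 0 * b 1) ^ 2 =
    (a 0 * b 1 - a 1 * b 0) ^ 2 := by ring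
  rw [this]
  positivity

theorem conformalRatio_contMDiffAt (oP : ManifoldOrientation 3 P)
    (oM : ManifoldOrientation 2 M) (hf : ContMDiff (𝓡 3) (𝓡 2) ∞ f)
    (hsub : ∀ p, Surjective (mfderiv (𝓡 3) (𝓡 2) f p)) {y₀ : M} {q : P}
    (hq : f q ∈ (chartAt (EuclideanSpace ℝ (Fin 2)) y₀).source) (i j : Fin 2) :
    ContMDiffAt (𝓡 3) 𝓘(ℝ, ℝ) ∞ (conformalRatio g f y₀ i j) q := by
  have h : ∀ i j, ContDiffAt ℝ ∞ (gradientInner g (baseCoord f y₀ i) (baseCoord f y₀ j) ∘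
      (extChartAt (𝓡 3) q).symm) (extChartAt (𝓡 3) q q) := fun i j =>
    contDiffAt_comp_extChartAt_symm
      (gradientInner_contMDiffAt g (baseCoord_contMDiffAt hf hq i) (baseCoord_contMDiffAt hf hq j))
  have h0 := gradientInner_det_pos g oP oM hf hsub hq
  rw [← extChartAt_to_inv (I := 𝓡 3) q] at h0
  apply contMDiffAt_of_comp_extChartAt_symm
  exact (h i j).div ((((h 0 0).mul (h 1 1)).sub ((h 0 1).pow 2)).sqrt h0.ne')
    (Real.sqrt_pos.2 h0).ne'

/-- The CR condition at a point says that the conformal class induced on the base is stationary in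
the direction of the fibre. -/
theorem commutes_covDeriv_iff_mfderiv_conformalRatio (hf : ContMDiff (𝓡 3) (𝓡 2) ∞ f)
    (hsub : ∀ p, Surjective (mfderiv (𝓡 3) (𝓡 2) f p)) {y₀ : M} {p : P}
    (hp : f p ∈ (chartAt (EuclideanSpace ℝ (Fin 2)) y₀).source) :
    (∀ X : TangentSpace (𝓡 3) p, g.inner p (unitFibreField g oP oM f hsub p) X = 0 →
      covDeriv g (unitFibreField g oP oM f hsub) p
        (tangentCross g oP p (unitFibreField g oP oM f hsub p) X) =
      tangentCross g oP p (unitFibreField g oP oM f hsub p)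
        (covDeriv g (unitFibreField g oP oM f hsub) p X)) ↔
    ∀ i j, mfderiv (𝓡 3) 𝓘(ℝ, ℝ) (conformalRatio g f y₀ i j) p
      (unitFibreField g oP oM f hsub p) = (0 : ℝ) := by
  rw [commutes_tangentCross_iff g oP p _ (inner_unitFibreField_self g oP oM f hsub p) _
    (inner_covDeriv_unitFibreField g oP oM hf hsub p)]
  have hsrc : ∀ᶠ q in 𝓝 p, f q ∈ (chartAt (EuclideanSpace ℝ (Fin 2)) y₀).source :=
    hf.continuous.continuousAt.eventually ((chartAt (EuclideanSpace ℝ (Fin 2))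
      y₀).open_source.mem_nhds hp)
  have hk' : ∀ i j, mfderiv (𝓡 3) 𝓘(ℝ, ℝ)
      (gradientInner g (baseCoord f y₀ i) (baseCoord f y₀ j)) p (unitFibreField g oP oM f hsub p) =
      (_ : ℝ) := fun i j =>
    mfderiv_gradientInner g (unitFibreField_contMDiffAt g oP oM hf hsub p)
      (baseCoord_contMDiffAt hf hp i) (baseCoord_contMDiffAt hf hp j)
      (hsrc.mono fun q hq => mfderiv_baseCoord_unitFibreField g oP oM hf hsub hq i)
      (hsrc.mono fun q hq => mfderiv_baseCoord_unitFibreField g oP oM hf hsub hq j)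
  have hD := gradientInner_det_pos g oP oM hf hsub hp
  have key := exists_rate_iff_mfderiv_ratio
    (k := fun i j => gradientInner g (baseCoord f y₀ i) (baseCoord f y₀ j))
    (fun i j => (gradientInner_contMDiffAt g (baseCoord_contMDiffAt hf hp i)
      (baseCoord_contMDiffAt hf hp j)).mdifferentiableAt (by simp)) hD
    (fun i j => (conformalRatio_contMDiffAt g oP oM hf hsub hp i j).mdifferentiableAt (by simp))
    (unitFibreField g oP oM f hsub p)
  refine Iff.trans ?_ key
  clear key
  obtain ⟨e, e', a, b, h1, h2, h3, h4, h5, -, -, h8, hn, -, -, h0⟩ :=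
    exists_frame_metricGradient g oP oM hf hsub hp
  constructor
  · rintro ⟨r, hr⟩
    refine ⟨-r, fun i j => ?_⟩
    have hT : ∀ i, g.inner p (unitFibreField g oP oM f hsub p)
        (metricGradient g (baseCoord f y₀ i) p) = 0 := by
      intro i
      rw [hn i, map_add, map_smul, map_smul, h1, h3]
      simp
    refine (hk' i j).trans (show -(_ + _ : ℝ) = -r * gradientInner g _ _ p from ?_)
    rw [hr _ _ (hT i) (hT j), gradientInner]
    ring
  · rintro ⟨r, hr⟩
    refine ⟨-r, fun X Y hX hY => ?_⟩
    set A := covDeriv g (unitFibreField g oP oM f hsub) p with hA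
    have hB : ∀ i j, g.inner p (metricGradient g (baseCoord f y₀ i) p)
        (A (metricGradient g (baseCoord f y₀ j) p)) +
        g.inner p (metricGradient g (baseCoord f y₀ j) p)
        (A (metricGradient g (baseCoord f y₀ i) p)) =
        -r * g.inner p (metricGradient g (baseCoord f y₀ i) p)
          (metricGradient g (baseCoord f y₀ j) p) := by
      intro i j
      have : -(g.inner p (metricGradient g (baseCoord f y₀ i) p)
          (A (metricGradient g (baseCoord f y₀ j) p)) +
          g.inner p (metricGradient g (baseCoord f y₀ j) p)
          (A (metricGradient g (baseCoord f y₀ i) p))) =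
          r * g.inner p (metricGradient g (baseCoord f y₀ i) p)
            (metricGradient g (baseCoord f y₀ j) p) := (hk' i j).symm.trans (hr i j)
      linarith
    have hspan : ∀ X, g.inner p (unitFibreField g oP oM f hsub p) X = 0 →
        ∃ x y : ℝ, X = x • metricGradient g (baseCoord f y₀ 0) p +
          y • metricGradient g (baseCoord f y₀ 1) p := by
      intro X hX
      have e1 := h8 X
      rw [hX, zero_smul, zero_add] at e1
      obtain ⟨δ, hδ⟩ : ∃ δ, δ = a 0 * b 1 - a 1 * b 0 := ⟨_, rfl⟩
      rw [← hδ] at h0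
      refine ⟨(b 1 * g.inner p e X - a 1 * g.inner p e' X) / δ,
        (a 0 * g.inner p e' X - b 0 * g.inner p e X) / δ, ?_⟩
      conv_lhs => rw [e1]
      rw [hn 0, hn 1]
      match_scalars
      · field_simp
        rw [hδ]
        ring
      · field_simp
        rw [hδ]
        ring
    obtain ⟨x, y, rfl⟩ := hspan X hX
    obtain ⟨z, w, rfl⟩ := hspan Y hY
    have b00 := hB 0 0
    have b01 := hB 0 1
    have b10 := hB 1 0
    have b11 := hB 1 1
    simp only [map_add, map_smul, add_apply, smul_apply, smul_eq_mul]
    linear_combination x * z * b00 + x * w * b01 + y * z * b10 + y * w * b11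

/-- The rotation induced on the base, in the chart at `y₀`, in terms of the conformal ratios. -/
theorem tangentComponents_fibreRotation (hf : ContMDiff (𝓡 3) (𝓡 2) ∞ f)
    (hsub : ∀ p, Surjective (mfderiv (𝓡 3) (𝓡 2) f p)) {y₀ : M} {q : P} {c : ℝ} (hc : c = 1 ∨ c = -1)
    (hq : f q ∈ (chartAt (EuclideanSpace ℝ (Fin 2)) y₀).source)
    (ho : ∀ v : Fin 2 → TangentSpace (𝓡 2) (f q),
      IsPositiveBasis (oM.at_point (f q)) v ↔ 0 < c * chartDet y₀ (f q) v)
    (u : TangentSpace (𝓡 2) (f q)) :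
    tangentComponents y₀ (f q) (fibreRotation g oP oM f hsub q u) =
      WithLp.toLp 2 ![c * (conformalRatio g f y₀ 0 1 q * tangentComponents y₀ (f q) u 0 -
          conformalRatio g f y₀ 0 0 q * tangentComponents y₀ (f q) u 1),
        c * (conformalRatio g f y₀ 1 1 q * tangentComponents y₀ (f q) u 0 -
          conformalRatio g f y₀ 0 1 q * tangentComponents y₀ (f q) u 1)] := by
  obtain ⟨X, rfl⟩ := hsub q u
  obtain ⟨e, e', a, b, h1, h2, h3, h4, h5, h6, h7, h8, hn, hk, hcomp, h0⟩ :=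
    exists_frame_metricGradient g oP oM hf hsub hq
  have h5' := (g.symm q e' e).trans h5
  have hle : mfderiv (𝓡 3) (𝓡 2) f q e ≠ 0 := by
    intro h
    obtain ⟨s, hs⟩ := exists_eq_smul_unitFibreField g oP oM f hsub q e h
    rw [hs, map_smul, inner_unitFibreField_self] at h1
    simp only [smul_eq_mul, mul_one] at h1
    rw [h1, zero_smul] at hs
    rw [hs] at h2
    simp at h2
  have hpos := (ho _).1 (isPositiveBasis_mfderiv_tangentCross g oP oM f hsub q e hle)
  rw [h6, chartDet, Matrix.det_fin_two] at hpos
  simp [hcomp, h2, h4, h5, h5'] at hpos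
  have hδ : Real.sqrt ((a 0 * a 0 + b 0 * b 0) * (a 1 * a 1 + b 1 * b 1) -
      (a 0 * a 1 + b 0 * b 1) ^ 2) = c * (a 0 * b 1 - a 1 * b 0) := by
    have hc2 : c * c = 1 := by rcases hc with rfl | rfl <;> norm_num
    rw [← Real.sqrt_sq (show 0 ≤ c * (a 0 * b 1 - a 1 * b 0) by linarith)]
    congr 1
    linear_combination -(a 0 * b 1 - a 1 * b 0) ^ 2 * hc2
  have hc0 : c ≠ 0 := by rcases hc with rfl | rfl <;> norm_num
  obtain ⟨δ, hδd⟩ : ∃ δ, δ = a 0 * b 1 - a 1 * b 0 := ⟨_, rfl⟩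
  rw [← hδd] at hδ h0
  have hTX : tangentCross g oP q (unitFibreField g oP oM f hsub q) X =
      g.inner q e X • e' - g.inner q e' X • e := by
    conv_lhs => rw [h8 X]
    rw [map_add, map_add, map_smul, map_smul, map_smul, tangentCross_self, h6, h7]
    module
  rw [fibreRotation_mfderiv, hTX]
  simp only [conformalRatio, hk, hδ]
  ext i
  rw [hcomp]
  simp only [map_sub, map_smul, smul_eq_mul, h2, h4, h5, h5', hcomp]
  fin_cases i
  · simp
    field_simp
    rw [hδd]
    ring
  · simp
    field_simp
    rw [hδd]
    ring

end CRCondition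

/-! ### Local geometry of submersions -/

section Submersions

/-- A submersion between finite-dimensional vector spaces is a coordinate projection in suitable
coordinates near a given point. -/
theorem exists_straightening {E G : Type*} [NormedAddCommGroup E] [NormedSpace ℝ E]
    [FiniteDimensional ℝ E] [NormedAddCommGroup G] [NormedSpace ℝ G] [FiniteDimensional ℝ G]
    {F : E → G} {x : E} (hF : ContDiffAt ℝ ∞ F x) (hsurj : Surjective (fderiv ℝ F x)) :
    ∃ (K : Submodule ℝ E) (e : OpenPartialHomeomorph E (G × K)), x ∈ e.source ∧
      (∀ z ∈ e.source, (e z).1 = F z) ∧ ContDiffAt ℝ ∞ e.symm (e x) := by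
  have : CompleteSpace E := FiniteDimensional.complete ℝ E
  obtain ⟨pr, hpr⟩ : ∃ pr : E →L[ℝ] (fderiv ℝ F x).ker, ∀ k : (fderiv ℝ F x).ker, pr k = k :=
    Submodule.ClosedComplemented.of_finiteDimensional _
  have hinj : Injective ((fderiv ℝ F x).prod pr) := by
    rw [injective_iff_map_eq_zero]
    intro v hv
    have h1 : fderiv ℝ F x v = 0 := congrArg Prod.fst hv
    have h2 : pr v = 0 := congrArg Prod.snd hv
    have h3 := hpr ⟨v, h1⟩
    rw [h2] at h3
    exact (congrArg Subtype.val h3).symm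
  have hsur : Surjective ((fderiv ℝ F x).prod pr) := by
    rintro ⟨a, k⟩
    obtain ⟨v, hv⟩ := hsurj a
    have h1 : ∀ z : (fderiv ℝ F x).ker, fderiv ℝ F x z = 0 := fun z => z.2
    refine ⟨v - pr v + k, Prod.ext ?_ ?_⟩
    · change fderiv ℝ F x (v - pr v + k) = a
      rw [map_add, map_sub, h1, h1, hv]
      simp
    · change pr (v - pr v + k) = k
      rw [map_add, map_sub, hpr, hpr]
      simp
  let L : E ≃L[ℝ] G × (fderiv ℝ F x).ker :=
    (LinearEquiv.ofBijective ((fderiv ℝ F x).prod pr).toLinearMap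
      ⟨hinj, hsur⟩).toContinuousLinearEquiv
  have hΦ : ContDiffAt ℝ ∞ (fun z => (F z, pr z)) x := hF.prodMk pr.contDiff.contDiffAt
  have hd : HasFDerivAt (fun z => (F z, pr z)) (L : E →L[ℝ] G × (fderiv ℝ F x).ker) x := by
    have := ((hF.differentiableAt (by simp)).hasFDerivAt).prodMk pr.hasFDerivAt
    exact this
  exact ⟨_, hΦ.toOpenPartialHomeomorph _ hd (by simp),
    hΦ.mem_toOpenPartialHomeomorph_source hd (by simp), fun z _ => rfl,
    hΦ.to_localInverse hd (by simp)⟩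

variable {m n : ℕ} {P M : Type*} [TopologicalSpace P] [ChartedSpace (EuclideanSpace ℝ (Fin m)) P]
  [TopologicalSpace M] [ChartedSpace (EuclideanSpace ℝ (Fin n)) M] {f : P → M}

/-- A submersion read in the charts at `p` and `f p` satisfies the hypotheses of
`exists_straightening`. -/
theorem contDiffAt_in_charts (hf : ContMDiff (𝓡 m) (𝓡 n) ∞ f) {p : P}
    (hsub : Surjective (mfderiv (𝓡 m) (𝓡 n) f p)) :
    ContDiffAt ℝ ∞ (extChartAt (𝓡 n) (f p) ∘ f ∘ (extChartAt (𝓡 m) p).symm)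
        (extChartAt (𝓡 m) p p) ∧
      Surjective (fderiv ℝ (extChartAt (𝓡 n) (f p) ∘ f ∘ (extChartAt (𝓡 m) p).symm)
        (extChartAt (𝓡 m) p p)) := by
  have h := ((contMDiffAt_iff.1 (hf p))).2
  rw [ModelWithCorners.range_eq_univ, contDiffWithinAt_univ] at h
  refine ⟨h, ?_⟩
  have h' : mfderiv (𝓡 m) (𝓡 n) f p =
      fderivWithin ℝ (extChartAt (𝓡 n) (f p) ∘ f ∘ (extChartAt (𝓡 m) p).symm) (range (𝓡 m))
        (extChartAt (𝓡 m) p p) :=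
    ((hf p).mdifferentiableAt (by simp)).mfderiv
  rw [ModelWithCorners.range_eq_univ, fderivWithin_univ] at h'
  intro y
  obtain ⟨v, hv⟩ := hsub y
  exact ⟨v, (DFunLike.congr_fun h' v).symm.trans hv⟩

variable [IsManifold (𝓡 m) ∞ P]

/-- A submersion has a smooth local section through each point. -/
theorem exists_local_section (hf : ContMDiff (𝓡 m) (𝓡 n) ∞ f) {p : P}
    (hsub : Surjective (mfderiv (𝓡 m) (𝓡 n) f p)) :
    ∃ s : M → P, ContMDiffAt (𝓡 n) (𝓡 m) ∞ s (f p) ∧ s (f p) = p ∧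
      ∀ᶠ y in 𝓝 (f p), f (s y) = y := by
  obtain ⟨h1, h2⟩ := contDiffAt_in_charts hf hsub
  obtain ⟨x, hx⟩ : ∃ x, x = extChartAt (𝓡 m) p p := ⟨_, rfl⟩
  rw [← hx] at h1 h2
  obtain ⟨K, e, he, heF, hes⟩ := exists_straightening h1 h2
  have hex : e x = (extChartAt (𝓡 n) (f p) (f p), (e x).2) := by
    refine Prod.ext ?_ rfl
    rw [heF x he]
    simp [hx]
  have hg : ContMDiffAt (𝓡 n) 𝓘(ℝ, EuclideanSpace ℝ (Fin m)) ∞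
      (fun y => e.symm (extChartAt (𝓡 n) (f p) y, (e x).2)) (f p) := by
    refine ContMDiffAt.comp
      (I' := 𝓘(ℝ, EuclideanSpace ℝ (Fin n) × K)) (f p) (g := e.symm) ?_ ?_
    · rw [← hex]
      exact hes.contMDiffAt
    · exact ContMDiffAt.prodMk_space contMDiffAt_extChartAt contMDiffAt_const
  have hgp : e.symm (extChartAt (𝓡 n) (f p) (f p), (e x).2) = x := by
    rw [← hex, e.left_inv he]
  have hsm : ContMDiffAt (𝓡 n) (𝓡 m) ∞
      (fun y => (extChartAt (𝓡 m) p).symm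
        (e.symm (extChartAt (𝓡 n) (f p) y, (e x).2))) (f p) := by
    refine ContMDiffAt.comp (f p) (g := (extChartAt (𝓡 m) p).symm) ?_ hg
    rw [hgp, hx]
    exact (contMDiffOn_extChartAt_symm p).contMDiffAt (extChartAt_target_mem_nhds p)
  refine ⟨_, hsm, ?_, ?_⟩
  · rw [hgp, hx]
    exact extChartAt_to_inv p
  · have hsp : (extChartAt (𝓡 m) p).symm
        (e.symm (extChartAt (𝓡 n) (f p) (f p), (e x).2)) = p := by
      rw [hgp, hx]
      exact extChartAt_to_inv p
    have hc1 : ContinuousAt (fun y : M => (extChartAt (𝓡 n) (f p) y, (e x).2)) (f p) :=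
      (continuousAt_extChartAt (f p)).prodMk continuousAt_const
    have ht : ∀ᶠ y in 𝓝 (f p), (extChartAt (𝓡 n) (f p) y, (e x).2) ∈ e.target := by
      refine hc1.preimage_mem_nhds (e.open_target.mem_nhds ?_)
      rw [← hex]
      exact e.map_source he
    have hfs : ContinuousAt (fun y => f ((extChartAt (𝓡 m) p).symm
        (e.symm (extChartAt (𝓡 n) (f p) y, (e x).2)))) (f p) := by
      refine ContinuousAt.comp (g := f) ?_ hsm.continuousAt
      exact hf.continuous.continuousAt
    have hs : ∀ᶠ y in 𝓝 (f p), f ((extChartAt (𝓡 m) p).symm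
        (e.symm (extChartAt (𝓡 n) (f p) y, (e x).2))) ∈ (extChartAt (𝓡 n) (f p)).source := by
      refine hfs.preimage_mem_nhds ?_
      rw [hsp]
      exact extChartAt_source_mem_nhds (f p)
    filter_upwards [ht, hs, extChartAt_source_mem_nhds (I := 𝓡 n) (f p)] with y h1 h2 h3
    refine (extChartAt (𝓡 n) (f p)).injOn h2 h3 ?_
    have h4 := heF _ (e.map_target h1)
    rw [e.right_inv h1] at h4
    exact h4.symm

theorem isOpen_image_of_submersion (hf : ContMDiff (𝓡 m) (𝓡 n) ∞ f)
    (hsub : ∀ p, Surjective (mfderiv (𝓡 m) (𝓡 n) f p)) {U : Set P} (hU : IsOpen U) :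
    IsOpen (f '' U) := by
  rw [isOpen_iff_mem_nhds]
  rintro _ ⟨p, hp, rfl⟩
  obtain ⟨s, hs, hsp, hfs⟩ := exists_local_section hf (hsub p)
  have h : ∀ᶠ y in 𝓝 (f p), s y ∈ U :=
    hs.continuousAt.preimage_mem_nhds (hU.mem_nhds (by rwa [hsp]))
  filter_upwards [h, hfs] with y h1 h2
  exact ⟨s y, h1, h2⟩

/-- Locally the fibres of a submersion are connected, so that a function whose differential
vanishes along the fibres is locally a function on the base. -/
theorem exists_open_eq_of_mfderiv_eq_zero_on_ker (hf : ContMDiff (𝓡 m) (𝓡 n) ∞ f) {p : P}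
    (hsub : Surjective (mfderiv (𝓡 m) (𝓡 n) f p)) {V : Set P} (hV : V ∈ 𝓝 p) :
    ∃ U : Set P, IsOpen U ∧ p ∈ U ∧ U ⊆ V ∧ ∀ k : P → ℝ,
      (∀ r ∈ U, MDifferentiableAt (𝓡 m) 𝓘(ℝ, ℝ) k r) →
      (∀ r ∈ U, ∀ X : TangentSpace (𝓡 m) r, mfderiv (𝓡 m) (𝓡 n) f r X = 0 →
        (mfderiv (𝓡 m) 𝓘(ℝ, ℝ) k r X : ℝ) = 0) →
      ∀ q ∈ U, ∀ q' ∈ U, f q = f q' → k q = k q' := by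
  obtain ⟨h1, h2⟩ := contDiffAt_in_charts hf hsub
  obtain ⟨x, hx⟩ : ∃ x, x = extChartAt (𝓡 m) p p := ⟨_, rfl⟩
  rw [← hx] at h1 h2
  obtain ⟨F, hF⟩ : ∃ F, F = extChartAt (𝓡 n) (f p) ∘ f ∘ (extChartAt (𝓡 m) p).symm := ⟨_, rfl⟩
  rw [← hF] at h1 h2
  obtain ⟨K, e, he, heF, hes⟩ := exists_straightening h1 h2
  have hsx : e.symm (e x) = x := e.left_inv he
  have hxp : (extChartAt (𝓡 m) p).symm x = p := by rw [hx]; exact extChartAt_to_inv p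
  have hcσ : ContinuousAt e.symm (e x) := hes.continuousAt
  have hcχ : ContinuousAt (fun z => (extChartAt (𝓡 m) p).symm (e.symm z)) (e x) := by
    refine ContinuousAt.comp (g := (extChartAt (𝓡 m) p).symm) ?_ hcσ
    rw [hsx, hx]
    exact continuousAt_extChartAt_symm p
  have hev : ∀ᶠ z in 𝓝 (e x), z ∈ e.target ∧ ContDiffAt ℝ 1 e.symm z ∧
      e.symm z ∈ (extChartAt (𝓡 m) p).target ∧
      (extChartAt (𝓡 m) p).symm (e.symm z) ∈ V ∩ f ⁻¹' (extChartAt (𝓡 n) (f p)).source := by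
    have a1 : ∀ᶠ z in 𝓝 (e x), z ∈ e.target := e.open_target.mem_nhds (e.map_source he)
    have a2 : ∀ᶠ z in 𝓝 (e x), ContDiffAt ℝ 1 e.symm z :=
      (hes.of_le (m := 1) (by simp)).eventually (by simp)
    have a3 : ∀ᶠ z in 𝓝 (e x), e.symm z ∈ (extChartAt (𝓡 m) p).target :=
      ContinuousAt.preimage_mem_nhds hcσ (by rw [hsx, hx]; exact extChartAt_target_mem_nhds p)
    have a4 : ∀ᶠ z in 𝓝 (e x), (extChartAt (𝓡 m) p).symm (e.symm z) ∈
        V ∩ f ⁻¹' (extChartAt (𝓡 n) (f p)).source := by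
      refine hcχ.preimage_mem_nhds ?_
      rw [hsx, hxp]
      exact Filter.inter_mem hV (hf.continuous.continuousAt.preimage_mem_nhds
        (extChartAt_source_mem_nhds (f p)))
    filter_upwards [a1, a2, a3, a4] with z b1 b2 b3 b4 using ⟨b1, b2, b3, b4⟩
  obtain ⟨ε, hε, hball⟩ := Metric.eventually_nhds_iff_ball.1 hev
  have hopen1 : IsOpen (e.source ∩ e ⁻¹' Metric.ball (e x) ε) :=
    e.isOpen_inter_preimage Metric.isOpen_ball
  let U : Set P := (extChartAt (𝓡 m) p).source ∩
    extChartAt (𝓡 m) p ⁻¹' (e.source ∩ e ⁻¹' Metric.ball (e x) ε)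
  have hUo : IsOpen U := (continuousOn_extChartAt p).isOpen_inter_preimage
    (isOpen_extChartAt_source p) hopen1
  have hβU : ∀ z ∈ Metric.ball (e x) ε, (extChartAt (𝓡 m) p).symm (e.symm z) ∈ U := by
    intro z hz
    obtain ⟨b1, b2, b3, b4⟩ := hball z hz
    refine ⟨(extChartAt (𝓡 m) p).map_target b3, ?_⟩
    rw [mem_preimage, (extChartAt (𝓡 m) p).right_inv b3]
    refine ⟨e.map_target b1, ?_⟩
    rwa [mem_preimage, e.right_inv b1]
  have hβ : ∀ q ∈ U, (extChartAt (𝓡 m) p).symm (e.symm (e (extChartAt (𝓡 m) p q))) = q := by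
    intro q hq
    rw [e.left_inv hq.2.1, (extChartAt (𝓡 m) p).left_inv hq.1]
  have hβf : ∀ z ∈ Metric.ball (e x) ε,
      f ((extChartAt (𝓡 m) p).symm (e.symm z)) = (extChartAt (𝓡 n) (f p)).symm z.1 := by
    intro z hz
    obtain ⟨b1, b2, b3, b4⟩ := hball z hz
    have h4 := heF _ (e.map_target b1)
    rw [e.right_inv b1] at h4
    rw [h4, hF]
    exact ((extChartAt (𝓡 n) (f p)).left_inv b4.2).symm
  refine ⟨U, hUo, ⟨mem_extChartAt_source p, by rw [← hx]; exact he, by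
    rw [← hx]; exact Metric.mem_ball_self hε⟩, ?_, ?_⟩
  · intro q hq
    have := (hball _ hq.2.2).2.2.2.1
    rwa [hβ q hq] at this
  intro k hk hk0 q hq q' hq' hqq
  have hu : ∀ r ∈ U, (e (extChartAt (𝓡 m) p r)).1 = extChartAt (𝓡 n) (f p) (f r) := by
    intro r hr
    rw [heF _ hr.2.1, hF]
    simp only [comp_apply]
    rw [(extChartAt (𝓡 m) p).left_inv hr.1]
  set u := extChartAt (𝓡 n) (f p) (f q) with hudef
  have hb : ∀ r ∈ U, f r = f q → e (extChartAt (𝓡 m) p r) =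
      (u, (e (extChartAt (𝓡 m) p r)).2) := by
    intro r hr hrq
    refine Prod.ext ?_ rfl
    rw [hu r hr, hrq]
  have hbox : ∀ w, (u, w) ∈ Metric.ball (e x) ε ↔
      u ∈ Metric.ball (e x).1 ε ∧ w ∈ Metric.ball (e x).2 ε := by
    intro w
    rw [← ball_prod_same (e x).1 (e x).2 ε]
    exact mem_prod
  have hub : u ∈ Metric.ball (e x).1 ε := by
    have := hq.2.2
    rw [mem_preimage, hb q hq rfl, hbox] at this
    exact this.1
  have hwb : ∀ r ∈ U, f r = f q → (e (extChartAt (𝓡 m) p r)).2 ∈ Metric.ball (e x).2 ε := by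
    intro r hr hrq
    have := hr.2.2
    rw [mem_preimage, hb r hr hrq, hbox] at this
    exact this.2
  -- The slice of the coordinate box over `u` parametrises the fibre through `q` within `U`.
  let β : K → P := fun w => (extChartAt (𝓡 m) p).symm (e.symm (u, w))
  have hβd : ∀ w ∈ Metric.ball (e x).2 ε, MDifferentiableAt 𝓘(ℝ, K) (𝓡 m) β w := by
    intro w hw
    obtain ⟨b1, b2, b3, b4⟩ := hball (u, w) ((hbox w).2 ⟨hub, hw⟩)
    have c1 : ContMDiffAt 𝓘(ℝ, EuclideanSpace ℝ (Fin m)) (𝓡 m) ∞ (extChartAt (𝓡 m) p).symm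
        (e.symm (u, w)) :=
      (contMDiffOn_extChartAt_symm p).contMDiffAt ((isOpen_extChartAt_target p).mem_nhds b3)
    have c2 : DifferentiableAt ℝ (fun w : K => e.symm (u, w)) w := by
      refine DifferentiableAt.comp w (g := e.symm) (b2.differentiableAt (by simp)) ?_
      exact (differentiableAt_const u).prodMk differentiableAt_id
    exact (c1.mdifferentiableAt (by simp)).comp w c2.mdifferentiableAt
  have hconst := IsOpen.is_const_of_fderiv_eq_zero (𝕜 := ℝ) (f := k ∘ β)
    (Metric.isOpen_ball (x := (e x).2) (ε := ε)) (convex_ball _ _).isPreconnected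
    (fun w hw => by
      refine DifferentiableAt.differentiableWithinAt ?_
      rw [← mdifferentiableAt_iff_differentiableAt]
      exact (hk _ (hβU _ ((hbox w).2 ⟨hub, hw⟩))).comp w (hβd w hw))
    (fun w hw => by
      have hr := hβU _ ((hbox w).2 ⟨hub, hw⟩)
      have hcomp := mfderiv_comp w (hk _ hr) (hβd w hw)
      have hfcomp := mfderiv_comp w ((hf (β w)).mdifferentiableAt (by simp)) (hβd w hw)
      have hfc : f ∘ β =ᶠ[𝓝 w] fun _ => (extChartAt (𝓡 n) (f p)).symm u := by
        filter_upwards [Metric.isOpen_ball.mem_nhds hw] with w' hw'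
        exact hβf _ ((hbox w').2 ⟨hub, hw'⟩)
      rw [hfc.mfderiv_eq, mfderiv_const] at hfcomp
      refine (mfderiv_eq_fderiv (f := k ∘ β)).symm.trans ?_
      refine hcomp.trans ?_
      ext a
      refine hk0 _ hr _ ?_
      exact (DFunLike.congr_fun hfcomp a).symm)
    (hwb q hq rfl) (hwb q' hq' hqq.symm)
  have e1 : β (e (extChartAt (𝓡 m) p q)).2 = q := by
    have := hβ q hq
    rw [hb q hq rfl] at this
    exact this
  have e2 : β (e (extChartAt (𝓡 m) p q')).2 = q' := by
    have := hβ q' hq'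
    rw [hb q' hq' hqq.symm] at this
    exact this
  simp only [comp_apply, e1, e2] at hconst
  exact hconst

end Submersions

/-! ### The Nijenhuis tensor of a surface -/

section NijenhuisTensor

/-- On a real plane with a complex structure `J`, a bilinear map that vanishes on all pairs `(X, X)`
and `(X, J X)` is zero, since every vector is a combination of `X` and `J X` if `X ≠ 0`. -/
theorem bilinear_eq_zero_of_complex_structure {E : Type*} [AddCommGroup E] [Module ℝ E]
    (hE : Module.finrank ℝ E = 2) {J : E →ₗ[ℝ] E} (hJ : ∀ u, J (J u) = -u)
    (B : E →ₗ[ℝ] E →ₗ[ℝ] E) (h1 : ∀ X, B X X = 0) (h2 : ∀ X, B X (J X) = 0) : B = 0 := by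
  have : FiniteDimensional ℝ E := Module.finite_of_finrank_eq_succ hE
  ext X Y
  by_cases hX : X = 0
  · simp [hX]
  have hli : LinearIndependent ℝ ![X, J X] := by
    rw [LinearIndependent.pair_iff]
    intro s t hst
    have h3 : s • J X - t • X = 0 := by
      have := congrArg J hst
      rw [map_add, map_smul, map_smul, hJ, map_zero] at this
      rw [← this]
      module
    have h4 : (s ^ 2 + t ^ 2) • X = 0 := by
      have e : (s ^ 2 + t ^ 2) • X = s • (s • X + t • J X) - t • (s • J X - t • X) := by module
      rw [e, hst, h3, smul_zero, smul_zero, sub_zero]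
    have h5 := (smul_eq_zero.1 h4).resolve_right hX
    constructor <;> nlinarith [sq_nonneg s, sq_nonneg t]
  have hspan := hli.span_eq_top_of_card_eq_finrank (by simp [hE])
  have hY : Y ∈ Submodule.span ℝ (range ![X, J X]) := by
    rw [hspan]
    exact Submodule.mem_top
  rw [Matrix.range_cons_cons_empty] at hY
  obtain ⟨a, b, rfl⟩ := Submodule.mem_span_pair.1 hY
  simp [h1, h2]

open VectorField in
/-- The Nijenhuis tensor of an almost complex structure on a domain in a plane vanishes. Write
`A_v = D_v J`. As the brackets are commutators of directional derivatives, all derivatives of `X`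
and `Y` cancel and the expression is `-A_{JX} Y + A_{JY} X - J A_Y X + J A_X Y`, where `A_v`
anticommutes with `J`. -/
theorem nijenhuis_lieBracket_eq_zero {E : Type*} [NormedAddCommGroup E] [NormedSpace ℝ E]
    (hE : Module.finrank ℝ E = 2) {J : E → E →L[ℝ] E} {X Y : E → E} {x : E}
    (hJd : DifferentiableAt ℝ J x) (hJ : ∀ᶠ z in 𝓝 x, ∀ u, J z (J z u) = -u)
    (hX : DifferentiableAt ℝ X x) (hY : DifferentiableAt ℝ Y x) :
    lieBracket ℝ X Y x - lieBracket ℝ (fun z => J z (X z)) (fun z => J z (Y z)) x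
      + J x (lieBracket ℝ (fun z => J z (X z)) Y x)
      + J x (lieBracket ℝ X (fun z => J z (Y z)) x) = 0 := by
  have hJx := hJ.self_of_nhds
  have hprod : ∀ {V : E → E}, DifferentiableAt ℝ V x → ∀ v,
      fderiv ℝ (fun z => J z (V z)) x v = fderiv ℝ J x v (V x) + J x (fderiv ℝ V x v) := by
    intro V hV v
    rw [(hJd.hasFDerivAt.clm_apply hV.hasFDerivAt).fderiv]
    simp
    abel
  have hanti : ∀ v u, fderiv ℝ J x v (J x u) = -J x (fderiv ℝ J x v u) := by
    intro v u
    have hd : DifferentiableAt ℝ (fun z => J z u) x :=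
      hJd.clm_apply (differentiableAt_const u)
    have h0 : (fun z => J z (J z u)) =ᶠ[𝓝 x] fun _ => -u := by
      filter_upwards [hJ] with z hz using hz u
    have h1 := hprod hd v
    rw [h0.fderiv_eq, (hJd.hasFDerivAt.clm_apply (hasFDerivAt_const u x)).fderiv] at h1
    simp at h1
    exact eq_neg_of_add_eq_zero_left h1.symm
  let A : E →ₗ[ℝ] E →ₗ[ℝ] E := LinearMap.mk₂ ℝ (fun v u => fderiv ℝ J x v u)
    (by simp) (by simp) (by simp) (by simp)
  let B : E →ₗ[ℝ] E →ₗ[ℝ] E := LinearMap.mk₂ ℝ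
    (fun X Y => -A (J x X) Y + A (J x Y) X - J x (A Y X) + J x (A X Y))
    (by intros; simp only [map_add, LinearMap.add_apply]; abel)
    (by intros; simp only [map_smul, LinearMap.smul_apply]; module)
    (by intros; simp only [map_add, LinearMap.add_apply]; abel)
    (by intros; simp only [map_smul, LinearMap.smul_apply]; module)
  have hA : ∀ v u, A v u = fderiv ℝ J x v u := fun _ _ => rfl
  have hB : B = 0 := by
    refine bilinear_eq_zero_of_complex_structure hE (J := (J x).toLinearMap) hJx B
      (fun X => ?_) (fun X => ?_)
    · change -A (J x X) X + A (J x X) X - J x (A X X) + J x (A X X) = 0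
      abel
    · change -A (J x X) (J x X) + A (J x (J x X)) X - J x (A (J x X) X) + J x (A X (J x X)) = 0
      simp only [hA, hanti, hJx, map_neg, LinearMap.neg_apply]
      abel
  have hBX : -fderiv ℝ J x (J x (X x)) (Y x) + fderiv ℝ J x (J x (Y x)) (X x)
      - J x (fderiv ℝ J x (Y x) (X x)) + J x (fderiv ℝ J x (X x) (Y x)) = 0 :=
    congrArg (fun B : E →ₗ[ℝ] E →ₗ[ℝ] E => B (X x) (Y x)) hB
  simp only [lieBracket, hprod hX, hprod hY, map_sub, map_add, hJx]
  rw [← hBX]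
  abel

variable {n : ℕ} {M : Type*} [TopologicalSpace M] [ChartedSpace (EuclideanSpace ℝ (Fin n)) M]
  [IsManifold (𝓡 n) ∞ M]

/-- The matrix, in the chart at `y₀`, of the value at `y` of a field of endomorphisms; meaningful if
`y` lies in the domain of the chart. -/
def endomorphismInChart (J : ∀ y : M, TangentSpace (𝓡 n) y →L[ℝ] TangentSpace (𝓡 n) y)
    (y₀ y : M) : EuclideanSpace ℝ (Fin n) →L[ℝ] EuclideanSpace ℝ (Fin n) :=
  ContinuousLinearMap.inCoordinates (EuclideanSpace ℝ (Fin n)) (TangentSpace (𝓡 n) : M → Type _)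
    (EuclideanSpace ℝ (Fin n)) (TangentSpace (𝓡 n) : M → Type _) y₀ y y₀ y (J y)

theorem tangentComponents_endomorphism
    (J : ∀ y : M, TangentSpace (𝓡 n) y →L[ℝ] TangentSpace (𝓡 n) y) {y₀ y : M}
    (hy : y ∈ (chartAt (EuclideanSpace ℝ (Fin n)) y₀).source) (u : TangentSpace (𝓡 n) y) :
    tangentComponents y₀ y (J y u) = endomorphismInChart J y₀ y (tangentComponents y₀ y u) := by
  have h := (trivializationAt (EuclideanSpace ℝ (Fin n)) (TangentSpace (𝓡 n) : M → Type _) y₀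
    ).symmL_continuousLinearMapAt (R := ℝ) hy u
  exact (congrArg (fun w => tangentComponents y₀ y (J y w)) h).symm

theorem contMDiffAt_endomorphism_iff
    (J : ∀ y : M, TangentSpace (𝓡 n) y →L[ℝ] TangentSpace (𝓡 n) y) (y₀ : M) :
    ContMDiffAt (𝓡 n) ((𝓡 n).prod 𝓘(ℝ, EuclideanSpace ℝ (Fin n) →L[ℝ] EuclideanSpace ℝ (Fin n))) ∞
      (fun y => TotalSpace.mk' (EuclideanSpace ℝ (Fin n) →L[ℝ] EuclideanSpace ℝ (Fin n))
        (E := fun y : M => TangentSpace (𝓡 n) y →L[ℝ] TangentSpace (𝓡 n) y) y (J y)) y₀ ↔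
    ContMDiffAt (𝓡 n) 𝓘(ℝ, EuclideanSpace ℝ (Fin n) →L[ℝ] EuclideanSpace ℝ (Fin n)) ∞
      (endomorphismInChart J y₀) y₀ := by
  refine Iff.trans (contMDiffAt_hom_bundle (n := ∞) _) ?_
  exact ⟨fun h => h.2, fun h => ⟨contMDiffAt_id, h⟩⟩

theorem tangentComponents_eq_fieldInChart (V : ∀ q : M, TangentSpace (𝓡 n) q) {p : M}
    {x : EuclideanSpace ℝ (Fin n)} (hx : x ∈ (extChartAt (𝓡 n) p).target) :
    tangentComponents p ((extChartAt (𝓡 n) p).symm x) (V ((extChartAt (𝓡 n) p).symm x)) =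
      fieldInChart V p x := by
  rw [← chartVector_fieldInChart V p hx]
  exact (trivializationAt (EuclideanSpace ℝ (Fin n)) (TangentSpace (𝓡 n) : M → Type _) p
    ).continuousLinearMapAt_symmL (R := ℝ) (extChartAt_symm_mem_chart_source p hx) _

theorem fieldInChart_endomorphism
    (J : ∀ y : M, TangentSpace (𝓡 n) y →L[ℝ] TangentSpace (𝓡 n) y)
    (V : ∀ q : M, TangentSpace (𝓡 n) q) {p : M} {x : EuclideanSpace ℝ (Fin n)}
    (hx : x ∈ (extChartAt (𝓡 n) p).target) :
    fieldInChart (fun q => J q (V q)) p x =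
      endomorphismInChart J p ((extChartAt (𝓡 n) p).symm x) (fieldInChart V p x) := by
  rw [← tangentComponents_eq_fieldInChart _ hx, ← tangentComponents_eq_fieldInChart _ hx]
  exact tangentComponents_endomorphism J (extChartAt_symm_mem_chart_source p hx) _

theorem tangentComponents_self (p : M) (v : TangentSpace (𝓡 n) p) :
    tangentComponents p p v = v := by
  have h := fieldInChart_self (fun q : M => (v : EuclideanSpace ℝ (Fin n))) p
  have h2 := tangentComponents_eq_fieldInChart (fun q : M => (v : EuclideanSpace ℝ (Fin n)))
    (mem_extChartAt_target (I := 𝓡 n) p)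
  rw [h] at h2
  have h3 : ∀ q, q = p → tangentComponents p q (v : EuclideanSpace ℝ (Fin n)) = v →
      tangentComponents p p v = v := by
    rintro q rfl h
    exact h
  exact h3 _ (extChartAt_to_inv p) h2

/-- The chart representation of a vector field used in the definition of the Lie bracket on a
manifold is the one by components in the trivialisation. -/
theorem mpullbackWithin_eq_fieldInChart (V : ∀ q : M, TangentSpace (𝓡 n) q) {p : M}
    {x : EuclideanSpace ℝ (Fin n)} (hx : x ∈ (extChartAt (𝓡 n) p).target) :
    VectorField.mpullbackWithin 𝓘(ℝ, EuclideanSpace ℝ (Fin n)) (𝓡 n) (extChartAt (𝓡 n) p).symm V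
      (range (𝓡 n)) x = fieldInChart V p x := by
  have hs := extChartAt_symm_mem_chart_source p hx
  have h1 := TangentBundle.symmL_trivializationAt (I := 𝓡 n) hs
  rw [(extChartAt (𝓡 n) p).right_inv hx] at h1
  have h2 : (mfderivWithin 𝓘(ℝ, EuclideanSpace ℝ (Fin n)) (𝓡 n) (extChartAt (𝓡 n) p).symm
      (range (𝓡 n)) x).inverse = tangentComponents p ((extChartAt (𝓡 n) p).symm x) := by
    rw [← h1]
    refine ContinuousLinearMap.inverse_eq ?_ ?_
    · ext1 v
      exact (trivializationAt (EuclideanSpace ℝ (Fin n)) (TangentSpace (𝓡 n) : M → Type _) p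
        ).symmL_continuousLinearMapAt (R := ℝ) hs v
    · ext1 v
      exact (trivializationAt (EuclideanSpace ℝ (Fin n)) (TangentSpace (𝓡 n) : M → Type _) p
        ).continuousLinearMapAt_symmL (R := ℝ) hs v
  rw [VectorField.mpullbackWithin_apply, ← tangentComponents_eq_fieldInChart V hx]
  exact DFunLike.congr_fun h2 _

theorem mlieBracket_eq_lieBracket_fieldInChart (V W : ∀ q : M, TangentSpace (𝓡 n) q) (p : M) :
    VectorField.mlieBracket (𝓡 n) V W p = VectorField.lieBracket ℝ (fieldInChart V p)
      (fieldInChart W p) (extChartAt (𝓡 n) p p) := by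
  have h1 : mfderiv (𝓡 n) 𝓘(ℝ, EuclideanSpace ℝ (Fin n)) (extChartAt (𝓡 n) p) p =
      ContinuousLinearMap.id ℝ (EuclideanSpace ℝ (Fin n)) := by
    have := TangentBundle.continuousLinearMapAt_trivializationAt (I := 𝓡 n)
      (mem_chart_source (EuclideanSpace ℝ (Fin n)) p)
    refine this.symm.trans ?_
    ext1 v
    exact tangentComponents_self p v
  have hev : ∀ V : ∀ q : M, TangentSpace (𝓡 n) q,
      VectorField.mpullbackWithin 𝓘(ℝ, EuclideanSpace ℝ (Fin n)) (𝓡 n) (extChartAt (𝓡 n) p).symm V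
        (range (𝓡 n)) =ᶠ[𝓝 (extChartAt (𝓡 n) p p)] fieldInChart V p := by
    intro V
    filter_upwards [extChartAt_target_mem_nhds p] with x hx
    exact mpullbackWithin_eq_fieldInChart V hx
  have h2 := Filter.EventuallyEq.lieBracket_vectorField_eq (𝕜 := ℝ) (hev V) (hev W)
  refine Eq.trans ?_ h2
  refine (DFunLike.congr_fun (congrArg ContinuousLinearMap.inverse h1) _).trans ?_
  refine (DFunLike.congr_fun (ContinuousLinearMap.inverse_id (R := ℝ)
    (M := EuclideanSpace ℝ (Fin n))) _).trans ?_
  refine Eq.trans ?_ (congrFun (VectorField.lieBracketWithin_univ (𝕜 := ℝ)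
    (E := EuclideanSpace ℝ (Fin n))) _)
  have hset : (extChartAt (𝓡 n) p).symm ⁻¹' univ ∩ range (𝓡 n) = univ := by
    rw [preimage_univ, univ_inter, ModelWithCorners.range_eq_univ]
  exact congrArg (fun s => VectorField.lieBracketWithin ℝ (E := EuclideanSpace ℝ (Fin n)) _ _ s _)
    hset

/-- The Nijenhuis tensor of an almost complex structure on a surface vanishes. -/
theorem nijenhuis_mlieBracket_eq_zero {M : Type*} [TopologicalSpace M]
    [ChartedSpace (EuclideanSpace ℝ (Fin 2)) M] [IsManifold (𝓡 2) ∞ M]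
    {J : ∀ y : M, TangentSpace (𝓡 2) y →L[ℝ] TangentSpace (𝓡 2) y} {y : M}
    (hJs : ContMDiffAt (𝓡 2) 𝓘(ℝ, EuclideanSpace ℝ (Fin 2) →L[ℝ] EuclideanSpace ℝ (Fin 2)) ∞
      (endomorphismInChart J y) y)
    (hJ : ∀ᶠ z in 𝓝 y, ∀ u, J z (J z u) = -u) {X Y : ∀ z : M, TangentSpace (𝓡 2) z}
    (hX : ContMDiffAt (𝓡 2) (𝓡 2).tangent ∞ (fun z => (⟨z, X z⟩ : TangentBundle (𝓡 2) M)) y)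
    (hY : ContMDiffAt (𝓡 2) (𝓡 2).tangent ∞ (fun z => (⟨z, Y z⟩ : TangentBundle (𝓡 2) M)) y) :
    VectorField.mlieBracket (𝓡 2) X Y y
      - VectorField.mlieBracket (𝓡 2) (fun z => J z (X z)) (fun z => J z (Y z)) y
      + J y (VectorField.mlieBracket (𝓡 2) (fun z => J z (X z)) Y y)
      + J y (VectorField.mlieBracket (𝓡 2) X (fun z => J z (Y z)) y) = 0 := by
  obtain ⟨Jc, hJc⟩ : ∃ Jc : EuclideanSpace ℝ (Fin 2) → EuclideanSpace ℝ (Fin 2) →L[ℝ]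
      EuclideanSpace ℝ (Fin 2), Jc = fun x => endomorphismInChart J y ((extChartAt (𝓡 2) y).symm x) :=
    ⟨_, rfl⟩
  have hJd : DifferentiableAt ℝ Jc (extChartAt (𝓡 2) y y) := by
    rw [hJc]
    exact (contDiffAt_comp_extChartAt_symm hJs).differentiableAt (by simp)
  have hfield : ∀ V : ∀ z : M, TangentSpace (𝓡 2) z,
      fieldInChart (fun z => J z (V z)) y =ᶠ[𝓝 (extChartAt (𝓡 2) y y)]
        fun x => Jc x (fieldInChart V y x) := by
    intro V
    filter_upwards [extChartAt_target_mem_nhds y] with x hx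
    rw [fieldInChart_endomorphism J V hx, hJc]
  have hJ2 : ∀ᶠ x in 𝓝 (extChartAt (𝓡 2) y y), ∀ u, Jc x (Jc x u) = -u := by
    have hc := (continuousAt_extChartAt_symm (I := 𝓡 2) y).eventually (by
      rw [extChartAt_to_inv]; exact hJ)
    filter_upwards [hc, extChartAt_target_mem_nhds y] with x h1 hx u
    have hs := extChartAt_symm_mem_chart_source y hx
    obtain ⟨w, rfl⟩ := tangentComponents_surjective hs u
    rw [hJc]
    change endomorphismInChart J y _ (endomorphismInChart J y _ _) = _
    rw [← tangentComponents_endomorphism J hs, ← tangentComponents_endomorphism J hs, h1, map_neg]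
  have hJy : ∀ u : EuclideanSpace ℝ (Fin 2),
      (J y u : EuclideanSpace ℝ (Fin 2)) = Jc (extChartAt (𝓡 2) y y) u := by
    intro u
    have h := tangentComponents_endomorphism J (mem_chart_source (EuclideanSpace ℝ (Fin 2)) y) u
    rw [tangentComponents_self] at h
    refine h.trans ?_
    rw [hJc]
    change _ = endomorphismInChart J y ((extChartAt (𝓡 2) y).symm (extChartAt (𝓡 2) y y)) u
    rw [extChartAt_to_inv]
    exact congrArg _ (tangentComponents_self y u)
  have h := nijenhuis_lieBracket_eq_zero (by simp) hJd hJ2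
    (((contMDiffAt_vectorField_iff X y).1 hX).differentiableAt (by simp))
    (((contMDiffAt_vectorField_iff Y y).1 hY).differentiableAt (by simp))
  have e1 := mlieBracket_eq_lieBracket_fieldInChart X Y y
  have e2 := Eq.trans (α := EuclideanSpace ℝ (Fin 2))
    (mlieBracket_eq_lieBracket_fieldInChart (fun z => J z (X z)) (fun z => J z (Y z)) y)
    (Filter.EventuallyEq.lieBracket_vectorField_eq (𝕜 := ℝ) (hfield X) (hfield Y))
  have e3 := Eq.trans (α := EuclideanSpace ℝ (Fin 2))
    (mlieBracket_eq_lieBracket_fieldInChart (fun z => J z (X z)) Y y)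
    (Filter.EventuallyEq.lieBracket_vectorField_eq (𝕜 := ℝ) (hfield X) Filter.EventuallyEq.rfl)
  have e4 := Eq.trans (α := EuclideanSpace ℝ (Fin 2))
    (mlieBracket_eq_lieBracket_fieldInChart X (fun z => J z (Y z)) y)
    (Filter.EventuallyEq.lieBracket_vectorField_eq (𝕜 := ℝ) Filter.EventuallyEq.rfl (hfield Y))
  rw [e1, e2, e3, e4]
  refine Eq.trans ?_ h
  exact congrArg₂ (· + ·) (congrArg₂ (· + ·) rfl (hJy _)) (hJy _)

end NijenhuisTensor

/-! ### Descending the induced rotation to the base -/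

section DescendingRotations

/-- The endomorphism of the plane with matrix `c * (a, -b; d, -a)`, the form which trace-free
matrices take. -/
def planeEndomorphism (c a b d : ℝ) : EuclideanSpace ℝ (Fin 2) →L[ℝ] EuclideanSpace ℝ (Fin 2) :=
  (c * a) • (EuclideanSpace.proj 0).smulRight (EuclideanSpace.single 0 1) -
    (c * b) • (EuclideanSpace.proj 1).smulRight (EuclideanSpace.single 0 1) +
    (c * d) • (EuclideanSpace.proj 0).smulRight (EuclideanSpace.single 1 1) -
    (c * a) • (EuclideanSpace.proj 1).smulRight (EuclideanSpace.single 1 1)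

theorem planeEndomorphism_apply (c a b d : ℝ) (w : EuclideanSpace ℝ (Fin 2)) :
    planeEndomorphism c a b d w =
      WithLp.toLp 2 ![c * (a * w 0 - b * w 1), c * (d * w 0 - a * w 1)] := by
  ext i
  fin_cases i <;> simp [planeEndomorphism] <;> ring

theorem planeEndomorphism_contDiff (c : ℝ) :
    ContDiff ℝ ∞ fun z : ℝ × ℝ × ℝ => planeEndomorphism c z.1 z.2.1 z.2.2 := by
  unfold planeEndomorphism
  fun_prop

theorem planeEndomorphism_contMDiffAt {n : ℕ} {M : Type*} [TopologicalSpace M]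
    [ChartedSpace (EuclideanSpace ℝ (Fin n)) M] {a b d : M → ℝ} {y : M} (c : ℝ)
    (ha : ContMDiffAt (𝓡 n) 𝓘(ℝ, ℝ) ∞ a y) (hb : ContMDiffAt (𝓡 n) 𝓘(ℝ, ℝ) ∞ b y)
    (hd : ContMDiffAt (𝓡 n) 𝓘(ℝ, ℝ) ∞ d y) :
    ContMDiffAt (𝓡 n) 𝓘(ℝ, EuclideanSpace ℝ (Fin 2) →L[ℝ] EuclideanSpace ℝ (Fin 2)) ∞
      (fun z => planeEndomorphism c (a z) (b z) (d z)) y :=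
  ContMDiffAt.comp (I' := 𝓘(ℝ, ℝ × ℝ × ℝ)) y
    (g := fun z : ℝ × ℝ × ℝ => planeEndomorphism c z.1 z.2.1 z.2.2)
    (f := fun z => (a z, b z, d z)) (planeEndomorphism_contDiff c).contMDiff.contMDiffAt
    (ha.prodMk_space (hb.prodMk_space hd))

variable {P M : Type*} [TopologicalSpace P] [ChartedSpace (EuclideanSpace ℝ (Fin 3)) P]
  [TopologicalSpace M] [ChartedSpace (EuclideanSpace ℝ (Fin 2)) M] {f : P → M}

theorem mfderiv_eq_zero_of_eventuallyEq_comp (hf : ContMDiff (𝓡 3) (𝓡 2) ∞ f) {k : P → ℝ}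
    {h : M → ℝ} {p : P} (hh : MDifferentiableAt (𝓡 2) 𝓘(ℝ, ℝ) h (f p)) (hk : k =ᶠ[𝓝 p] h ∘ f)
    {X : TangentSpace (𝓡 3) p} (hX : mfderiv (𝓡 3) (𝓡 2) f p X = 0) :
    (mfderiv (𝓡 3) 𝓘(ℝ, ℝ) k p X : ℝ) = 0 := by
  have h1 := mfderiv_comp p hh ((hf p).mdifferentiableAt (by simp))
  rw [hk.mfderiv_eq]
  refine (DFunLike.congr_fun h1 X).trans ?_
  refine (congrArg (mfderiv (𝓡 2) 𝓘(ℝ, ℝ) h (f p)) hX).trans ?_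
  exact map_zero (mfderiv (𝓡 2) 𝓘(ℝ, ℝ) h (f p))

/-- Near `p`, orientations of the base are read off from determinants in the chart at `f p`. -/
theorem exists_sign_chartDet_comp [IsManifold (𝓡 2) ∞ M] (oM : ManifoldOrientation 2 M)
    (hf : ContMDiff (𝓡 3) (𝓡 2) ∞ f) (p : P) :
    ∃ c : ℝ, (c = 1 ∨ c = -1) ∧ ∀ᶠ q in 𝓝 p,
      f q ∈ (chartAt (EuclideanSpace ℝ (Fin 2)) (f p)).source ∧
        ∀ v : Fin 2 → TangentSpace (𝓡 2) (f q),
          IsPositiveBasis (oM.at_point (f q)) v ↔ 0 < c * chartDet (f p) (f q) v := by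
  obtain ⟨c, hc, ho⟩ := exists_sign_chartDet oM (f p)
  have hs : ∀ᶠ y in 𝓝 (f p), y ∈ (chartAt (EuclideanSpace ℝ (Fin 2)) (f p)).source :=
    (chartAt (EuclideanSpace ℝ (Fin 2)) (f p)).open_source.mem_nhds (mem_chart_source _ (f p))
  exact ⟨c, hc, hf.continuous.continuousAt.eventually (hs.and ho)⟩

variable [IsManifold (𝓡 3) ∞ P] (g : SmoothMetric 3 P)

theorem conformalRatio_symm (f : P → M) (y₀ : M) (i j : Fin 2) (q : P) :
    conformalRatio g f y₀ i j q = conformalRatio g f y₀ j i q := by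
  rw [conformalRatio, conformalRatio]
  congr 1
  rw [gradientInner, gradientInner, g.symm]

variable [IsManifold (𝓡 2) ∞ M] (oP : ManifoldOrientation 3 P) (oM : ManifoldOrientation 2 M)

theorem tangentComponents_fibreRotation_eq_planeEndomorphism (hf : ContMDiff (𝓡 3) (𝓡 2) ∞ f)
    (hsub : ∀ p, Surjective (mfderiv (𝓡 3) (𝓡 2) f p)) {y₀ : M} {q : P} {c : ℝ}
    (hc : c = 1 ∨ c = -1) (hq : f q ∈ (chartAt (EuclideanSpace ℝ (Fin 2)) y₀).source)
    (ho : ∀ v : Fin 2 → TangentSpace (𝓡 2) (f q),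
      IsPositiveBasis (oM.at_point (f q)) v ↔ 0 < c * chartDet y₀ (f q) v)
    (u : TangentSpace (𝓡 2) (f q)) :
    tangentComponents y₀ (f q) (fibreRotation g oP oM f hsub q u) =
      planeEndomorphism c (conformalRatio g f y₀ 0 1 q) (conformalRatio g f y₀ 0 0 q)
        (conformalRatio g f y₀ 1 1 q) (tangentComponents y₀ (f q) u) := by
  rw [tangentComponents_fibreRotation g oP oM hf hsub hc hq ho, planeEndomorphism_apply]

/-- Endomorphisms of two tangent spaces whose base points are equal agree if they have the same
matrix in a chart. Heterogeneous equality takes the place of a transport between the two spaces. -/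
theorem heq_of_tangentComponents {y₀ y y' : M} (h : y = y')
    (hy : y ∈ (chartAt (EuclideanSpace ℝ (Fin 2)) y₀).source)
    {A : TangentSpace (𝓡 2) y →L[ℝ] TangentSpace (𝓡 2) y}
    {A' : TangentSpace (𝓡 2) y' →L[ℝ] TangentSpace (𝓡 2) y'}
    {Φ : EuclideanSpace ℝ (Fin 2) →L[ℝ] EuclideanSpace ℝ (Fin 2)}
    (hA : ∀ u, tangentComponents y₀ y (A u) = Φ (tangentComponents y₀ y u))
    (hA' : ∀ u, tangentComponents y₀ y' (A' u) = Φ (tangentComponents y₀ y' u)) : HEq A A' := by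
  subst h
  refine heq_of_eq (ContinuousLinearMap.ext fun u => tangentComponents_injective hy ?_)
  rw [hA, hA']

/-- A family of elements indexed by `α` that is constant along the fibres of `f` over a set
comes from a family over the base. -/
theorem exists_family_of_heq {α β : Type*} {C : β → Type*} [∀ b, Zero (C b)] (f : α → β)
    (s : ∀ a, C (f a)) (U : Set α)
    (h : ∀ a ∈ U, ∀ a' ∈ U, f a = f a' → HEq (s a) (s a')) :
    ∃ J : ∀ b, C b, ∀ a ∈ U, J (f a) = s a := by
  classical
  refine ⟨fun b => if hb : ∃ a ∈ U, f a = b then cast (congrArg C hb.choose_spec.2) (s hb.choose)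
    else 0, fun a ha => ?_⟩
  have hb : ∃ a' ∈ U, f a' = f a := ⟨a, ha, rfl⟩
  simp only [dif_pos hb]
  exact eq_of_heq ((cast_heq _ _).trans (h _ hb.choose_spec.1 _ ha hb.choose_spec.2))

/-- If `f` is CR holomorphic then the rotation induced on the base is locally constant along the
fibres: its matrix consists of the conformal ratios, whose derivative along the fibres vanishes. -/
theorem exists_open_fibreRotation_heq (hf : ContMDiff (𝓡 3) (𝓡 2) ∞ f)
    (hsub : ∀ p, Surjective (mfderiv (𝓡 3) (𝓡 2) f p))
    (hcr : IsCRHolomorphic (fibredCR g oP oM f hsub) (sphereBundleCR g oP)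
      (fibreDirectionMap g oP oM f hsub)) (p : P) :
    ∃ U : Set P, IsOpen U ∧ p ∈ U ∧ ∀ q ∈ U, ∀ q' ∈ U, f q = f q' →
      HEq (fibreRotation g oP oM f hsub q) (fibreRotation g oP oM f hsub q') := by
  rw [isCRHolomorphic_iff g oP oM hf hsub] at hcr
  obtain ⟨c, hc, hV⟩ := exists_sign_chartDet_comp oM hf p
  obtain ⟨U, hU, hpU, hUV, hconst⟩ := exists_open_eq_of_mfderiv_eq_zero_on_ker hf (hsub p) hV
  refine ⟨U, hU, hpU, fun q hq q' hq' hqq => ?_⟩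
  have hN : ∀ i j, conformalRatio g f (f p) i j q = conformalRatio g f (f p) i j q' := by
    intro i j
    refine hconst _ (fun r hr => ?_) (fun r hr X hX => ?_) q hq q' hq' hqq
    · exact (conformalRatio_contMDiffAt g oP oM hf hsub (hUV hr).1 i j).mdifferentiableAt (by simp)
    · obtain ⟨t, rfl⟩ := exists_eq_smul_unitFibreField g oP oM f hsub r X hX
      have h0 : (mfderiv (𝓡 3) 𝓘(ℝ, ℝ) (conformalRatio g f (f p) i j) r
          (unitFibreField g oP oM f hsub r) : ℝ) = 0 :=
        (commutes_covDeriv_iff_mfderiv_conformalRatio g oP oM hf hsub (hUV hr).1).1 (hcr r) i j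
      refine (map_smul (mfderiv (𝓡 3) 𝓘(ℝ, ℝ) (conformalRatio g f (f p) i j) r) t _).trans ?_
      exact (congrArg (fun x : ℝ => t * x) h0).trans (mul_zero t)
  refine heq_of_tangentComponents hqq (hUV hq).1
    (tangentComponents_fibreRotation_eq_planeEndomorphism g oP oM hf hsub hc (hUV hq).1 (hUV hq).2)
    ?_
  simp only [hN]
  exact tangentComponents_fibreRotation_eq_planeEndomorphism g oP oM hf hsub hc (hUV hq').1
    (hUV hq').2

/-- An almost complex structure on the base that pulls back to the induced rotations is read in
a chart by the matrix of conformal ratios. -/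
theorem endomorphismInChart_eq_planeEndomorphism (hf : ContMDiff (𝓡 3) (𝓡 2) ∞ f)
    (hsub : ∀ p, Surjective (mfderiv (𝓡 3) (𝓡 2) f p))
    {J : ∀ y : M, TangentSpace (𝓡 2) y →L[ℝ] TangentSpace (𝓡 2) y} {y₀ : M} {q : P} {c : ℝ}
    (hc : c = 1 ∨ c = -1) (hq : f q ∈ (chartAt (EuclideanSpace ℝ (Fin 2)) y₀).source)
    (ho : ∀ v : Fin 2 → TangentSpace (𝓡 2) (f q),
      IsPositiveBasis (oM.at_point (f q)) v ↔ 0 < c * chartDet y₀ (f q) v)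
    (hJ : J (f q) = fibreRotation g oP oM f hsub q) :
    endomorphismInChart J y₀ (f q) =
      planeEndomorphism c (conformalRatio g f y₀ 0 1 q) (conformalRatio g f y₀ 0 0 q)
        (conformalRatio g f y₀ 1 1 q) := by
  refine ContinuousLinearMap.ext fun w => ?_
  obtain ⟨u, rfl⟩ := tangentComponents_surjective hq w
  rw [← tangentComponents_endomorphism J hq, hJ]
  exact tangentComponents_fibreRotation_eq_planeEndomorphism g oP oM hf hsub hc hq ho u

/-- Smoothness of the descended almost complex structure, by means of a local section of `f`. -/
theorem endomorphismInChart_contMDiffAt (hf : ContMDiff (𝓡 3) (𝓡 2) ∞ f)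
    (hsub : ∀ p, Surjective (mfderiv (𝓡 3) (𝓡 2) f p))
    {J : ∀ y : M, TangentSpace (𝓡 2) y →L[ℝ] TangentSpace (𝓡 2) y} {p : P}
    (hJ : ∀ᶠ q in 𝓝 p, J (f q) = fibreRotation g oP oM f hsub q) :
    ContMDiffAt (𝓡 2) 𝓘(ℝ, EuclideanSpace ℝ (Fin 2) →L[ℝ] EuclideanSpace ℝ (Fin 2)) ∞
      (endomorphismInChart J (f p)) (f p) := by
  obtain ⟨s, hs, hsp, hfs⟩ := exists_local_section hf (hsub p)
  obtain ⟨c, hc, ho⟩ := exists_sign_chartDet oM (f p)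
  have hN : ∀ i j, ContMDiffAt (𝓡 2) 𝓘(ℝ, ℝ) ∞
      (fun y => conformalRatio g f (f p) i j (s y)) (f p) := by
    intro i j
    refine ContMDiffAt.comp (f p) (g := conformalRatio g f (f p) i j) ?_ hs
    rw [hsp]
    exact conformalRatio_contMDiffAt g oP oM hf hsub (mem_chart_source _ _) i j
  have h1 : ContMDiffAt (𝓡 2) 𝓘(ℝ, EuclideanSpace ℝ (Fin 2) →L[ℝ] EuclideanSpace ℝ (Fin 2)) ∞
      (fun y => planeEndomorphism c (conformalRatio g f (f p) 0 1 (s y))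
        (conformalRatio g f (f p) 0 0 (s y)) (conformalRatio g f (f p) 1 1 (s y))) (f p) :=
    planeEndomorphism_contMDiffAt c (hN 0 1) (hN 0 0) (hN 1 1)
  refine h1.congr_of_eventuallyEq ?_
  have hJs : ∀ᶠ y in 𝓝 (f p), J (f (s y)) = fibreRotation g oP oM f hsub (s y) :=
    hs.continuousAt.eventually (by rwa [hsp])
  filter_upwards [hJs, hfs, ho, (chartAt (EuclideanSpace ℝ (Fin 2)) (f p)).open_source.mem_nhds
    (mem_chart_source _ (f p))] with y a1 a2 a3 a4
  have := endomorphismInChart_eq_planeEndomorphism g oP oM hf hsub (y₀ := f p) (q := s y) hc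
    (by rwa [a2]) (by rw [a2]; exact a3) a1
  rwa [a2] at this

/-- If the induced rotation is constant along the fibres of `f` in an open set, it defines a
complex structure on the image for which `f` is conformal. -/
theorem exists_isComplexStructureOn_of_heq (c : ConformalStructure 3 P) (hg : g ∈ c.metrics)
    (hf : ContMDiff (𝓡 3) (𝓡 2) ∞ f) (hsub : ∀ p, Surjective (mfderiv (𝓡 3) (𝓡 2) f p))
    {U : Set P} (hU : IsOpen U) (hUR : ∀ q ∈ U, ∀ q' ∈ U, f q = f q' →
      HEq (fibreRotation g oP oM f hsub q) (fibreRotation g oP oM f hsub q')) :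
    ∃ J : ∀ y : M, TangentSpace (𝓡 2) y →L[ℝ] TangentSpace (𝓡 2) y,
      IsComplexStructureOn oM J (f '' U) ∧ IsConformalSubmersionOn c J f U := by
  obtain ⟨J, hJ⟩ := exists_family_of_heq
    (C := fun y : M => TangentSpace (𝓡 2) y →L[ℝ] TangentSpace (𝓡 2) y) f
    (fibreRotation g oP oM f hsub) U hUR
  have hopen := isOpen_image_of_submersion hf hsub hU
  have hJev : ∀ p ∈ U, ∀ᶠ q in 𝓝 p, J (f q) = fibreRotation g oP oM f hsub q := fun p hp =>
    Filter.mem_of_superset (hU.mem_nhds hp) fun q hq => hJ q hq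
  have hsq : ∀ y ∈ f '' U, ∀ u : TangentSpace (𝓡 2) y, J y (J y u) = -u := by
    rintro _ ⟨q, hq, rfl⟩ u
    rw [hJ q hq]
    exact fibreRotation_fibreRotation g oP oM f hsub q u
  refine ⟨J, ⟨hopen, ?_, hsq, ?_, ?_⟩, ?_⟩
  · rintro _ ⟨q, hq, rfl⟩
    exact ((contMDiffAt_endomorphism_iff J (f q)).2
      (endomorphismInChart_contMDiffAt g oP oM hf hsub (hJev q hq))).contMDiffWithinAt
  · rintro _ ⟨q, hq, rfl⟩ u hu
    rw [hJ q hq]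
    exact isPositiveBasis_fibreRotation g oP oM f hsub q u hu
  · rintro _ ⟨q, hq, rfl⟩ X Y hX hY
    exact nijenhuis_mlieBracket_eq_zero
      (endomorphismInChart_contMDiffAt g oP oM hf hsub (hJev q hq))
      (Filter.mem_of_superset (hopen.mem_nhds (mem_image_of_mem f hq)) hsq) hX hY
  · intro g' hg' p hp b hb
    rw [hJ p hp] at hb
    obtain ⟨r, hr, hbr⟩ := isHermitianInner_fibreRotation_scaling g oP oM f hsub p b hb
    -- Another metric of the conformal class is a multiple of `g`, with the same horizontal planes.
    obtain ⟨φ, -, hφ, hgg⟩ := (c.mem_iff g hg g').1 hg'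
    have horth : ∀ X ∈ (metricForm g' p).orthogonal
        (LinearMap.ker (mfderiv (𝓡 3) (𝓡 2) f p).toLinearMap),
        g.inner p (unitFibreField g oP oM f hsub p) X = 0 := by
      intro X hX
      have h : g'.inner p (unitFibreField g oP oM f hsub p) X = 0 :=
        hX _ (mfderiv_unitFibreField g oP oM f hsub p)
      rw [hgg] at h
      exact (mul_eq_zero.1 h).resolve_left (hφ p).ne'
    refine ⟨r / φ p, div_pos hr (hφ p), fun X hX Y hY => ?_⟩
    rw [hbr X Y (horth X hX) (horth Y hY), hgg]
    have := (hφ p).ne'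
    field_simp

/-- If `f` is conformal for a complex structure on the base then the conformal ratios are
functions on the base, so that the differential of `Ψ` is complex linear. -/
theorem commutes_covDeriv_of_isConformalSubmersionOn (c : ConformalStructure 3 P)
    (hg : g ∈ c.metrics) (hf : ContMDiff (𝓡 3) (𝓡 2) ∞ f)
    (hsub : ∀ p, Surjective (mfderiv (𝓡 3) (𝓡 2) f p)) {U : Set P} (hU : IsOpen U)
    {J : ∀ y : M, TangentSpace (𝓡 2) y →L[ℝ] TangentSpace (𝓡 2) y}
    (hJ : IsComplexStructureOn oM J (f '' U)) (hconf : IsConformalSubmersionOn c J f U)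
    {p : P} (hp : p ∈ U) (X : TangentSpace (𝓡 3) p)
    (hX : g.inner p (unitFibreField g oP oM f hsub p) X = 0) :
    covDeriv g (unitFibreField g oP oM f hsub) p
        (tangentCross g oP p (unitFibreField g oP oM f hsub p) X) =
      tangentCross g oP p (unitFibreField g oP oM f hsub p)
        (covDeriv g (unitFibreField g oP oM f hsub) p X) := by
  refine (commutes_covDeriv_iff_mfderiv_conformalRatio g oP oM hf hsub
    (mem_chart_source (EuclideanSpace ℝ (Fin 2)) (f p))).2 ?_ X hX
  obtain ⟨σ, hσ, h1⟩ := exists_sign_chartDet_comp oM hf p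
  have hσ2 : σ * σ = 1 := by rcases hσ with rfl | rfl <;> norm_num
  have hsm := (contMDiffAt_endomorphism_iff J (f p)).1
    ((hJ.smooth (f p) (mem_image_of_mem f hp)).contMDiffAt
      (hJ.isOpen.mem_nhds (mem_image_of_mem f hp)))
  have hev : ∀ᶠ q in 𝓝 p, endomorphismInChart J (f p) (f q) =
      planeEndomorphism σ (conformalRatio g f (f p) 0 1 q) (conformalRatio g f (f p) 0 0 q)
        (conformalRatio g f (f p) 1 1 q) := by
    filter_upwards [h1, hU.mem_nhds hp] with q hq hqU
    exact endomorphismInChart_eq_planeEndomorphism g oP oM hf hsub hσ hq.1 hq.2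
      (eq_fibreRotation_of_conformal g oP oM f hsub q (J (f q))
        (hJ.sq _ (mem_image_of_mem f hqU)) (hJ.positive _ (mem_image_of_mem f hqU))
        (hconf g hg q hqU))
  -- The ratios are entries of the smooth matrix of `J`, hence near `p` functions of `f q`.
  have hentry : ∀ (a : ℝ) (k l : Fin 2), MDifferentiableAt (𝓡 2) 𝓘(ℝ, ℝ)
      (fun y => a * endomorphismInChart J (f p) y (EuclideanSpace.single k 1) l) (f p) := by
    intro a k l
    have hL : ContDiff ℝ ∞ (fun A : EuclideanSpace ℝ (Fin 2) →L[ℝ] EuclideanSpace ℝ (Fin 2) =>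
        a * A (EuclideanSpace.single k 1) l) := by fun_prop
    exact (hL.contMDiff.contMDiffAt.comp (f p) hsm).mdifferentiableAt (by simp)
  have hker := mfderiv_unitFibreField g oP oM f hsub p
  have h00 := mfderiv_eq_zero_of_eventuallyEq_comp hf (k := conformalRatio g f (f p) 0 0)
    (hentry (-σ) 1 0) (by
      filter_upwards [hev] with q hq
      simp only [comp_apply, hq, planeEndomorphism_apply]
      simp
      linear_combination -(conformalRatio g f (f p) 0 0 q) * hσ2) hker
  have h01 := mfderiv_eq_zero_of_eventuallyEq_comp hf (k := conformalRatio g f (f p) 0 1)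
    (hentry σ 0 0) (by
      filter_upwards [hev] with q hq
      simp only [comp_apply, hq, planeEndomorphism_apply]
      simp
      linear_combination -(conformalRatio g f (f p) 0 1 q) * hσ2) hker
  have h11 := mfderiv_eq_zero_of_eventuallyEq_comp hf (k := conformalRatio g f (f p) 1 1)
    (hentry σ 0 1) (by
      filter_upwards [hev] with q hq
      simp only [comp_apply, hq, planeEndomorphism_apply]
      simp
      linear_combination -(conformalRatio g f (f p) 1 1 q) * hσ2) hker
  intro i j
  fin_cases i <;> fin_cases j
  · exact h00
  · exact h01
  · have : conformalRatio g f (f p) 1 0 = conformalRatio g f (f p) 0 1 :=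
      funext fun q => conformalRatio_symm g f (f p) 1 0 q
    change mfderiv (𝓡 3) 𝓘(ℝ, ℝ) (conformalRatio g f (f p) 1 0) p _ = (0 : ℝ)
    rw [this]
    exact h01
  · exact h11

end DescendingRotations

end

theorem mainTheorem5 {P M : Type*}
    [TopologicalSpace P] [ChartedSpace (EuclideanSpace ℝ (Fin 3)) P] [IsManifold (𝓡 3) ∞ P]
    [T2Space P] [SecondCountableTopology P]
    [TopologicalSpace M] [ChartedSpace (EuclideanSpace ℝ (Fin 2)) M] [IsManifold (𝓡 2) ∞ M]
    [T2Space M] [SecondCountableTopology M]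
    (oP : ManifoldOrientation 3 P) (oM : ManifoldOrientation 2 M)
    (c : ConformalStructure 3 P)
    (f : P → M) (hf : ContMDiff (𝓡 3) (𝓡 2) ∞ f)
    (hsub : ∀ p, Surjective (mfderiv (𝓡 3) (𝓡 2) f p))
    (g : SmoothMetric 3 P) (hg : g ∈ c.metrics) :
    ((∀ y : M, IsPreconnected (f ⁻¹' {y})) →
      ((∃ J : ∀ y : M, TangentSpace (𝓡 2) y →L[ℝ] TangentSpace (𝓡 2) y,
          IsComplexStructureOn oM J (range f) ∧ IsConformalSubmersionOn c J f univ) ↔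
        IsCRHolomorphic (fibredCR g oP oM f hsub) (sphereBundleCR g oP)
          (fibreDirectionMap g oP oM f hsub))) ∧
    (IsCRHolomorphic (fibredCR g oP oM f hsub) (sphereBundleCR g oP)
        (fibreDirectionMap g oP oM f hsub) ↔
      ∀ p : P, ∃ U : Set P, IsOpen U ∧ p ∈ U ∧
        ∃ J : ∀ y : M, TangentSpace (𝓡 2) y →L[ℝ] TangentSpace (𝓡 2) y,
          IsComplexStructureOn oM J (f '' U) ∧ IsConformalSubmersionOn c J f U) := by
  have hlocal := exists_open_fibreRotation_heq g oP oM hf hsub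
  have hcr : ∀ {p : P} {U : Set P}, IsOpen U → p ∈ U →
      (∃ J : ∀ y : M, TangentSpace (𝓡 2) y →L[ℝ] TangentSpace (𝓡 2) y,
        IsComplexStructureOn oM J (f '' U) ∧ IsConformalSubmersionOn c J f U) →
      ∀ X : TangentSpace (𝓡 3) p, g.inner p (unitFibreField g oP oM f hsub p) X = 0 →
        covDeriv g (unitFibreField g oP oM f hsub) p
            (tangentCross g oP p (unitFibreField g oP oM f hsub p) X) =
          tangentCross g oP p (unitFibreField g oP oM f hsub p)
            (covDeriv g (unitFibreField g oP oM f hsub) p X) := by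
    rintro p U hU hp ⟨J, hJ, hconf⟩ X hX
    exact commutes_covDeriv_of_isConformalSubmersionOn g oP oM c hg hf hsub hU hJ hconf hp X hX
  refine ⟨fun hconn => ⟨fun hJ => ?_, fun h => ?_⟩, ⟨fun h p => ?_, fun h => ?_⟩⟩
  · rw [isCRHolomorphic_iff g oP oM hf hsub]
    rw [← image_univ] at hJ
    exact fun p => hcr isOpen_univ (mem_univ p) hJ
  · rw [← image_univ]
    refine exists_isComplexStructureOn_of_heq g oP oM c hg hf hsub isOpen_univ
      fun q _ q' _ hqq => ?_
    -- On a connected fibre, a locally constant family is constant.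
    refine (hconn (f q)).induction₂' (fun r r' => HEq (fibreRotation g oP oM f hsub r)
      (fibreRotation g oP oM f hsub r')) (fun r hr => ?_)
      (fun _ _ _ _ _ _ h1 h2 => HEq.trans h1 h2) (show q ∈ f ⁻¹' {f q} from rfl) hqq.symm
    obtain ⟨U, hU, hrU, hconst⟩ := hlocal h r
    filter_upwards [mem_nhdsWithin_of_mem_nhds (hU.mem_nhds hrU), self_mem_nhdsWithin]
      with r' hr' hfr'
    have hff : f r = f r' := Eq.trans hr (Eq.symm hfr')
    exact ⟨hconst r hrU r' hr' hff, hconst r' hr' r hrU hff.symm⟩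
  · obtain ⟨U, hU, hpU, hconst⟩ := hlocal h p
    exact ⟨U, hU, hpU, exists_isComplexStructureOn_of_heq g oP oM c hg hf hsub hU hconst⟩
  · rw [isCRHolomorphic_iff g oP oM hf hsub]
    intro p
    obtain ⟨U, hU, hpU, hJ⟩ := h p
    exact hcr hU hpU hJ
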